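/- **Model.** Fix $0\le\alpha\le 1$. In the $(2,1,1)$-MISO wiretap channel with delayed CSIT and alternating topology, the outputs at the legitimate receiver and at the eavesdropper at time $t=1,\dots,n$ are $$y_t=\sqrt{\rho^{A_{1,t}}}\,\mathbf h_t\mathbf x_t+n_{1t},\qquad z_t=\sqrt{\rho^{A_{2,t}}}\,\mathbf g_t\mathbf x_t+n_{2t},$$ where $\mathbf x_t\in\mathbb C^{2}$ is the channel input, $\mathbf h_t,\mathbf g_t\in\mathbb C^{1\times 2}$ are the channel vectors, and the noises $n_{1t},n_{2t}$ are i.i.d. $\mathcal{CN}(0,1)$ over $t$, independent of each other and of the channel. The link exponents $(A_{1,t},A_{2,t})\in\{1,\alpha\}^2$ form a known deterministic sequence for each block length $n$; for $A_1,A_2\in\{1,\alpha\}$ (read as labels "strong", "weak" if $\alpha=1$), the fraction of the times $t\le n$ in state $(A_1,A_2)$ tends to $\lambda_{A_1A_2}$ as $n\to\infty$. The channel states $\mathbf S_t=(\mathbf h_t,\mathbf g_t)$ are i.i.d. over $t$ with a fixed law such that $\mathbb E[\|\mathbf h_t\|^2+\|\mathbf g_t\|^2]<\infty$, $\mathbf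 h_t$ and $\mathbf g_t$ are linearly independent almost surely, and two independent copies of $\mathbf h_t$, as well as two independent copies of $\mathbf g_t$, are linearly independent almost surely (this holds, for instance, if the law of $\mathbf S_t$ has a density). **Codes.** A code of length $n$ for the parameter $\rho$ has a message $W$ uniform on a finite set $\mathcal W(n,\rho)$, stochastic encoders that compute $\mathbf x_t$ from $W$, private randomness of the transmitter and the past states $\mathbf S^{t-1}$ only, with $\mathbb E\|\mathbf x_t\|^2\le 1$ for every $t$, and a decoder that computes $\hat W$ from $(y^n,\mathbf S^{n-1},\mathbf h_n)$. The message, the private randomness, the states and the noises are independent. **GSDoF.** A number $d$ is achievable if there are codes such that, for every $\rho>1$, $$\limsup_{n\to\infty}\Pr\{\hat W\ne W\}=0,\qquad \limsup_{n\to\infty}\frac1n I(W;z^n,\mathbf S^{n-1},\mathbf g_n)=0,$$ and $\lim_{\rho\to\infty}\liminf_{n\to\infty}\frac{\log|\mathcal W(n,\rho)|}{n\log\rho}$ exists and is at least $d$. The GSDoF $d(\lambda_{A_1A_2})$ is the supremum of the achievable $d$. **Theorem.** $$d(\lambda_{A_1A_2})\le\frac{(3-\alpha)\lambda_{1\alpha}+2(\lambda_{11}+\alpha\lambda_{\alpha\alpha})+(1+\alpha)\lambda_{\alpha1}}{3}.$$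 -/

import Mathlib

open MeasureTheory ProbabilityTheory Filter Topology
open scoped ENNReal

namespace MISOWiretap

/-- Strength of a link: strong links have power exponent `1`, weak links have exponent `α`. -/
inductive Link where
  | strong
  | weak
  deriving DecidableEq

/-- The link power exponent. -/
def Link.exponent (α : ℝ) : Link → ℝ
  | .strong => 1
  | .weak => α

/-- Topology state: link strength to receiver 1 and link strength to receiver 2. -/
abbrev TopologyState : Type := Link × Link

/-- Vectors in `ℂ²` (channel inputs and channel vectors). -/
abbrev Vec : Type := Fin 2 → ℂ

/-- Channel state `(h, g)` at one time instant: `h` towards receiver 1, `g` towards receiver 2. -/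
abbrev ChannelState : Type := Vec × Vec

/-- Squared Euclidean norm `|x₁|² + |x₂|²`, as an extended non-negative real. -/
noncomputable def sqNorm (x : Vec) : ℝ≥0∞ := ∑ i, ‖x i‖ₑ ^ 2

/-- The circularly symmetric complex Gaussian law `CN(0, 1)`: real and imaginary part are
independent centred Gaussians of variance `1 / 2`. -/
noncomputable def stdComplexGaussian : Measure ℂ :=
  ((gaussianReal 0 (1 / 2)).prod (gaussianReal 0 (1 / 2))).map
    (fun p : ℝ × ℝ => (⟨p.1, p.2⟩ : ℂ))

/-- Admissible laws of the channel state at one time instant. The state matrix has full rank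
almost surely, two independent realisations of the channel vector of the same receiver are
linearly independent almost surely, and the channel vectors have finite mean power. No relation
between `h` and `g` (such as independence) is imposed. -/
structure IsFadingLaw (ν : Measure ChannelState) : Prop where
  isProbabilityMeasure : IsProbabilityMeasure ν
  fullRank : ∀ᵐ S ∂ν, LinearIndependent ℂ ![S.1, S.2]
  fullRank_copy₁ : ∀ᵐ p ∂(ν.prod ν), LinearIndependent ℂ ![p.1.1, p.2.1]
  fullRank_copy₂ : ∀ᵐ p ∂(ν.prod ν), LinearIndependent ℂ ![p.1.2, p.2.2]
  power_ne_top : ∫⁻ S, (sqNorm S.1 + sqNorm S.2) ∂ν ≠ ∞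

/-- What a receiver knows after `n` channel uses: its `n` channel outputs, its own `n` channel
vectors, and the channel vectors of the other receiver at all times but the last one. -/
abbrev Observation (n : ℕ) : Type :=
  (Fin n → ℂ) × (Fin n → Vec) × ({t : Fin n // (t : ℕ) + 1 < n} → Vec)

/-- A code of block length `n` for the wiretap channel with delayed channel state information at
the transmitter: a message set `Fin size`, a private random seed of the transmitter (which makes
the encoders stochastic), an encoder for each time `t` that sees the message, the seed and the
channel states at times before `t`, and a decoder at receiver 1. -/
structure Code (n : ℕ) where
  size : ℕ
  size_pos : 0 < size
  Seed : Type
  [seedSpace : MeasurableSpace Seed]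
  seedLaw : Measure Seed
  [seedProb : IsProbabilityMeasure seedLaw]
  enc : (t : Fin n) → Fin size × Seed × (Set.Iio t → ChannelState) → Vec
  measurable_enc : ∀ t, Measurable (enc t)
  dec : Observation n → Fin size
  measurable_dec : Measurable dec

attribute [instance] Code.seedSpace Code.seedProb

namespace Code

variable {n : ℕ} (C : Code n)

/-- Elementary outcomes: message, seed, channel states, and noise at receivers 1 and 2. -/
abbrev Outcome : Type :=
  Fin C.size × C.Seed × (Fin n → ChannelState) × (Fin n → ℂ × ℂ)

/-- Joint law when the channel state has law `ν`: the message is uniform, the states are i.i.d.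
over time, the noises are i.i.d. `CN(0, 1)`, and all of these and the seed are independent. -/
noncomputable def law (ν : Measure ChannelState) : Measure C.Outcome :=
  (uniformOn Set.univ).prod (C.seedLaw.prod
    ((Measure.pi fun _ : Fin n => ν).prod
      (Measure.pi fun _ : Fin n => stdComplexGaussian.prod stdComplexGaussian)))

/-- The transmitted message. -/
def message (ω : C.Outcome) : Fin C.size := ω.1

/-- The channel states over time. -/
def state (ω : C.Outcome) : Fin n → ChannelState := ω.2.2.1

/-- The channel input at time `t`. -/
def input (t : Fin n) (ω : C.Outcome) : Vec :=
  C.enc t (ω.1, ω.2.1, fun s => C.state ω s)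

/-- The channel output `y_t` at receiver 1. -/
noncomputable def output₁ (α ρ : ℝ) (T : Fin n → TopologyState) (t : Fin n) (ω : C.Outcome) : ℂ :=
  (Real.sqrt (ρ ^ (T t).1.exponent α) : ℂ) * ((C.state ω t).1 ⬝ᵥ C.input t ω) + (ω.2.2.2 t).1

/-- The channel output `z_t` at receiver 2. -/
noncomputable def output₂ (α ρ : ℝ) (T : Fin n → TopologyState) (t : Fin n) (ω : C.Outcome) : ℂ :=
  (Real.sqrt (ρ ^ (T t).2.exponent α) : ℂ) * ((C.state ω t).2 ⬝ᵥ C.input t ω) + (ω.2.2.2 t).2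

/-- The observation of receiver 1, the legitimate receiver. -/
noncomputable def observation₁ (α ρ : ℝ) (T : Fin n → TopologyState) (ω : C.Outcome) :
    Observation n :=
  (fun t => C.output₁ α ρ T t ω, fun t => (C.state ω t).1, fun t => (C.state ω t).2)

/-- The observation of receiver 2, the eavesdropper. -/
noncomputable def observation₂ (α ρ : ℝ) (T : Fin n → TopologyState) (ω : C.Outcome) :
    Observation n :=
  (fun t => C.output₂ α ρ T t ω, fun t => (C.state ω t).2, fun t => (C.state ω t).1)

/-- The normalised input power constraint `E ‖x_t‖² ≤ 1` at every time `t`; in particular it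
holds if `‖x_t‖² ≤ 1` always. -/
def PowerConstraint (ν : Measure ChannelState) : Prop :=
  ∀ t, ∫⁻ ω, sqNorm (C.input t ω) ∂(C.law ν) ≤ 1

/-- The probability that receiver 1 decodes the message wrongly. -/
noncomputable def errorProb (α ρ : ℝ) (T : Fin n → TopologyState) (ν : Measure ChannelState) :
    ℝ≥0∞ :=
  C.law ν {ω | C.dec (C.observation₁ α ρ T ω) ≠ C.message ω}

/-- The information leakage to receiver 2. -/
noncomputable def leakage (α ρ : ℝ) (T : Fin n → TopologyState) (ν : Measure ChannelState) :
    ℝ≥0∞ :=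
  InformationTheory.klDiv
    ((C.law ν).map fun ω => (C.message ω, C.observation₂ α ρ T ω))
    (((C.law ν).map C.message).prod ((C.law ν).map (C.observation₂ α ρ T)))

end Code

/-- `d` generalized secure degrees of freedom are achievable, where `T n` lists the topology
states during a block of length `n`: there are codes for all `ρ` and `n` that obey the power
constraint such that, for each `ρ`, the error probability and the leakage per channel use vanish
as `n → ∞`, and the limit as `ρ → ∞` of the normalised rate is at least `d`. -/
def Achievable (α : ℝ) (T : (n : ℕ) → Fin n → TopologyState) (ν : Measure ChannelState)
    (d : ℝ) : Prop :=
  ∃ C : (ρ : ℝ) → (n : ℕ) → Code n,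
    (∀ ρ : ℝ, 1 < ρ →
      (∀ n, (C ρ n).PowerConstraint ν) ∧
      limsup (fun n : ℕ => (C ρ n).errorProb α ρ (T n) ν) atTop = 0 ∧
      limsup (fun n : ℕ => (C ρ n).leakage α ρ (T n) ν / (n : ℝ≥0∞)) atTop = 0) ∧
    ∃ l : EReal,
      Tendsto (fun ρ : ℝ => liminf (fun n : ℕ =>
        ((Real.log (C ρ n).size / (n * Real.log ρ) : ℝ) : EReal)) atTop) atTop (𝓝 l) ∧
      (d : EReal) ≤ l

/-- The generalized secure degrees of freedom: the supremum of all achievable values. -/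
noncomputable def gsdof (α : ℝ) (T : (n : ℕ) → Fin n → TopologyState)
    (ν : Measure ChannelState) : EReal :=
  ⨆ (d : ℝ) (_ : Achievable α T ν d), (d : EReal)

/-- The topology state `(a, b)` occupies asymptotically the fraction `lam a b` of the block. -/
def HasFractions (T : (n : ℕ) → Fin n → TopologyState) (lam : Link → Link → ℝ) : Prop :=
  ∀ a b : Link, Tendsto
    (fun n : ℕ => ((Finset.univ.filter fun t : Fin n => T n t = (a, b)).card : ℝ) / n)
    atTop (𝓝 (lam a b))

end MISOWiretap

namespace MISOWiretap

section PiIntegrals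

variable {ι : Type*} [Fintype ι]

lemma lintegral_pi_prod {X : ι → Type*} [∀ i, MeasurableSpace (X i)] (μ : ∀ i, Measure (X i))
    [∀ i, SigmaFinite (μ i)] {f : ∀ i, X i → ℝ≥0∞} (hf : ∀ i, Measurable (f i)) :
    ∫⁻ x, ∏ i, f i (x i) ∂Measure.pi μ = ∏ i, ∫⁻ x, f i x ∂μ i := by
  classical
  have hmeas : ∀ s : Finset ι, Measurable fun x : ∀ i, X i => ∏ i ∈ s, f i (x i) := fun s =>
    Finset.measurable_prod _ fun i _ => (hf i).comp (measurable_pi_apply i)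
  have key : ∀ s : Finset ι,
      (∫⋯∫⁻_s, (fun x : ∀ i, X i => ∏ i ∈ s, f i (x i)) ∂μ) =
        fun _ => ∏ i ∈ s, ∫⁻ x, f i x ∂μ i := by
    intro s
    induction s using Finset.induction_on with
    | empty => simp
    | insert a s ha ih =>
      rw [lmarginal_insert' _ (hmeas _) ha]
      have h1 : (fun x : ∀ i, X i => ∫⁻ xi, ∏ i ∈ insert a s, f i (Function.update x a xi i) ∂μ a)
          = fun x => (∫⁻ xi, f a xi ∂μ a) * ∏ i ∈ s, f i (x i) := by
        funext x
        have h2 : ∀ xi, ∏ i ∈ insert a s, f i (Function.update x a xi i)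
            = f a xi * ∏ i ∈ s, f i (x i) := by
          intro xi
          rw [Finset.prod_insert ha, Function.update_self]
          congr 1
          refine Finset.prod_congr rfl fun i hi => ?_
          rw [Function.update_of_ne (ne_of_mem_of_not_mem hi ha)]
        simp_rw [h2]
        rw [lintegral_mul_const _ (hf a)]
      rw [h1]
      funext x
      have h3 := congrFun ih x
      simp only [lmarginal] at h3 ⊢
      rw [lintegral_const_mul, h3, Finset.prod_insert ha]
      exact (hmeas s).comp measurable_updateFinset
  by_cases hne : Nonempty (∀ i, X i)
  · obtain ⟨x0⟩ := hne
    rw [lintegral_eq_lmarginal_univ x0]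
    exact congrFun (key Finset.univ) x0
  · rw [not_nonempty_iff] at hne
    obtain ⟨i, hi⟩ := isEmpty_pi.1 hne
    rw [lintegral_of_isEmpty]
    exact (Finset.prod_eq_zero (Finset.mem_univ i) (lintegral_of_isEmpty _ _)).symm

lemma pi_withDensity {X : ι → Type*} [∀ i, MeasurableSpace (X i)] (μ : ∀ i, Measure (X i))
    [∀ i, SigmaFinite (μ i)] {f : ∀ i, X i → ℝ≥0∞} (hf : ∀ i, Measurable (f i))
    [∀ i, SigmaFinite ((μ i).withDensity (f i))] :
    Measure.pi (fun i => (μ i).withDensity (f i)) =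
      (Measure.pi μ).withDensity fun x => ∏ i, f i (x i) := by
  refine (Measure.pi_eq fun s hs => ?_)
  rw [withDensity_apply _ (MeasurableSet.univ_pi hs)]
  have h1 : ∀ i, ((μ i).withDensity (f i)) (s i) = ∫⁻ x, (s i).indicator (f i) x ∂μ i := fun i => by
    rw [withDensity_apply _ (hs i), lintegral_indicator (hs i)]
  simp_rw [h1]
  rw [← lintegral_pi_prod μ fun i => (hf i).indicator (hs i),
    ← lintegral_indicator (MeasurableSet.univ_pi hs)]
  refine lintegral_congr fun x => ?_
  classical
  by_cases hx : x ∈ Set.univ.pi s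
  · rw [Set.indicator_of_mem hx]
    exact Finset.prod_congr rfl fun i _ => (Set.indicator_of_mem (hx i (Set.mem_univ i)) _).symm
  · rw [Set.indicator_of_notMem hx]
    simp only [Set.mem_univ_pi, not_forall] at hx
    obtain ⟨i, hi⟩ := hx
    exact (Finset.prod_eq_zero (Finset.mem_univ i) (Set.indicator_of_notMem hi _)).symm

/-- Replacing one coordinate of an i.i.d. family by the one of an independent copy does not change
the law. -/
lemma measurePreserving_update_copy [DecidableEq ι] {X : Type*} [MeasurableSpace X] (μ : Measure X)
    [IsProbabilityMeasure μ] (t : ι) :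
    MeasurePreserving (fun p : (ι → X) × (ι → X) => Function.update p.1 t (p.2 t))
      ((Measure.pi fun _ => μ).prod (Measure.pi fun _ => μ)) (Measure.pi fun _ => μ) := by
  have hmeas : Measurable (fun p : (ι → X) × (ι → X) => Function.update p.1 t (p.2 t)) := by
    refine measurable_pi_lambda _ fun i => ?_
    by_cases h : i = t
    · subst h
      simpa using (show Measurable fun p : (ι → X) × (ι → X) => p.2 i by fun_prop)
    · simpa [Function.update_of_ne h] using
        (show Measurable fun p : (ι → X) × (ι → X) => p.1 i by fun_prop)
  refine ⟨hmeas, ?_⟩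
  refine (Measure.pi_eq fun s hs => ?_).symm
  rw [Measure.map_apply hmeas (MeasurableSet.univ_pi hs)]
  have h1 : (fun p : (ι → X) × (ι → X) => Function.update p.1 t (p.2 t)) ⁻¹' (Set.univ.pi s)
      = (Set.univ.pi fun i => if i = t then Set.univ else s i) ×ˢ
        (Set.univ.pi fun i => if i = t then s i else Set.univ) := by
    ext p
    simp only [Set.mem_preimage, Set.mem_univ_pi, Set.mem_prod]
    constructor
    · intro h
      refine ⟨fun i => ?_, fun i => ?_⟩
      · by_cases hi : i = t
        · simp [hi]
        · simpa [hi] using h i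
      · by_cases hi : i = t
        · subst hi; simpa using h i
        · simp [hi]
    · rintro ⟨h2, h3⟩ i
      by_cases hi : i = t
      · subst hi; simpa using h3 i
      · simpa [hi] using h2 i
  rw [h1, Measure.prod_prod, Measure.pi_pi, Measure.pi_pi, ← Finset.prod_mul_distrib]
  refine Finset.prod_congr rfl fun i _ => ?_
  by_cases hi : i = t <;> simp [hi]

end PiIntegrals

section Gaussian

/-- The density of the circularly symmetric complex Gaussian law of mean `m` and variance `v`. -/
noncomputable def gaussDensity (v : ℝ) (m z : ℂ) : ℝ≥0∞ :=
  ENNReal.ofReal ((Real.pi * v)⁻¹ * Real.exp (-(‖z - m‖ ^ 2 / v)))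

lemma gaussDensity_pos {v : ℝ} (hv : 0 < v) (m z : ℂ) : 0 < gaussDensity v m z := by
  unfold gaussDensity
  rw [ENNReal.ofReal_pos]
  have := Real.pi_pos
  positivity

lemma gaussDensity_ne_top (v : ℝ) (m z : ℂ) : gaussDensity v m z ≠ ∞ := ENNReal.ofReal_ne_top

lemma gaussDensity_le_one {v : ℝ} (hv : 1 ≤ v) (m z : ℂ) : gaussDensity v m z ≤ 1 := by
  unfold gaussDensity
  rw [ENNReal.ofReal_le_one]
  have h1 : (Real.pi * v)⁻¹ ≤ 1 := inv_le_one_of_one_le₀ (by nlinarith [Real.pi_gt_three])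
  have h2 : Real.exp (-(‖z - m‖ ^ 2 / v)) ≤ 1 := by
    rw [Real.exp_le_one_iff]
    have : 0 ≤ ‖z - m‖ ^ 2 / v := by positivity
    linarith
  exact mul_le_one₀ h1 (Real.exp_pos _).le h2

lemma log_gaussDensity {v : ℝ} (hv : 0 < v) (m z : ℂ) :
    Real.log (gaussDensity v m z).toReal = -(Real.log Real.pi + Real.log v + ‖z - m‖ ^ 2 / v) := by
  have := Real.pi_pos
  unfold gaussDensity
  rw [ENNReal.toReal_ofReal (by positivity), Real.log_mul (by positivity) (Real.exp_pos _).ne',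
    Real.log_exp, Real.log_inv, Real.log_mul this.ne' hv.ne']
  ring

@[fun_prop]
lemma measurable_gaussDensity {X : Type*} [MeasurableSpace X] {v : X → ℝ} {m z : X → ℂ}
    (hv : Measurable v) (hm : Measurable m) (hz : Measurable z) :
    Measurable fun x => gaussDensity (v x) (m x) (z x) := by
  unfold gaussDensity
  fun_prop

lemma gaussDensity_eq_gaussianPDF {v : ℝ} (hv : 0 < v) (m : ℂ) (x y : ℝ) :
    gaussDensity v m ⟨x, y⟩ =
      gaussianPDF m.re (v / 2).toNNReal x * gaussianPDF m.im (v / 2).toNNReal y := by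
  have := Real.pi_pos
  unfold gaussDensity gaussianPDF
  rw [← ENNReal.ofReal_mul (gaussianPDFReal_nonneg _ _ _)]
  congr 1
  unfold gaussianPDFReal
  rw [Real.coe_toNNReal _ (by positivity : 0 ≤ v / 2), Complex.sq_norm, Complex.normSq_apply]
  have h1 : 2 * Real.pi * (v / 2) = Real.pi * v := by ring
  rw [h1, mul_mul_mul_comm, ← Real.exp_add, ← mul_inv, Real.mul_self_sqrt (by positivity)]
  congr 2
  simp
  field_simp
  ring

lemma lintegral_gaussDensity {v : ℝ} (hv : 0 < v) (m : ℂ) : ∫⁻ z, gaussDensity v m z = 1 := by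
  have hv2 : (v / 2).toNNReal ≠ 0 := by
    rw [Ne, Real.toNNReal_eq_zero, not_le]; positivity
  rw [← (Complex.volume_preserving_equiv_real_prod.symm).lintegral_comp_emb
    Complex.measurableEquivRealProd.symm.measurableEmbedding, Measure.volume_eq_prod,
    lintegral_prod _ (by fun_prop)]
  have h1 : ∀ x y : ℝ, gaussDensity v m (Complex.measurableEquivRealProd.symm (x, y)) =
      gaussianPDF m.re (v / 2).toNNReal x * gaussianPDF m.im (v / 2).toNNReal y :=
    fun x y => gaussDensity_eq_gaussianPDF hv m x y
  simp_rw [h1]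
  simp_rw [lintegral_const_mul _ (measurable_gaussianPDF _ _), lintegral_gaussianPDF_eq_one _ hv2,
    mul_one]
  exact lintegral_gaussianPDF_eq_one _ hv2

lemma stdComplexGaussian_eq_withDensity :
    stdComplexGaussian = volume.withDensity (gaussDensity 1 0) := by
  have h2 : (1 / 2 : NNReal) ≠ 0 := by norm_num
  ext s hs
  unfold stdComplexGaussian
  have he : (fun p : ℝ × ℝ => (⟨p.1, p.2⟩ : ℂ)) = Complex.measurableEquivRealProd.symm := rfl
  rw [gaussianReal_of_var_ne_zero _ h2,
    prod_withDensity (measurable_gaussianPDF _ _) (measurable_gaussianPDF _ _), he,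
    Measure.map_apply Complex.measurableEquivRealProd.symm.measurable hs,
    withDensity_apply _ (Complex.measurableEquivRealProd.symm.measurable hs),
    withDensity_apply _ hs,
    ← (Complex.volume_preserving_equiv_real_prod.symm).setLIntegral_comp_preimage_emb
      Complex.measurableEquivRealProd.symm.measurableEmbedding, Measure.volume_eq_prod]
  have hv : (1 / 2 : NNReal) = ((1 : ℝ) / 2).toNNReal := by
    ext; simp
  refine lintegral_congr fun p => ?_
  simpa [hv] using (gaussDensity_eq_gaussianPDF one_pos 0 p.1 p.2).symm

instance : IsProbabilityMeasure stdComplexGaussian := by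
  rw [stdComplexGaussian_eq_withDensity]
  exact ⟨by simp [lintegral_gaussDensity one_pos]⟩

lemma integrable_norm_sq_stdComplexGaussian :
    Integrable (fun z : ℂ => ‖z‖ ^ 2) stdComplexGaussian := by
  unfold stdComplexGaussian
  have he : (fun p : ℝ × ℝ => (⟨p.1, p.2⟩ : ℂ)) = Complex.measurableEquivRealProd.symm := rfl
  rw [he, Complex.measurableEquivRealProd.symm.measurableEmbedding.integrable_map_iff]
  have h1 : Integrable (fun x : ℝ => x ^ 2) (gaussianReal 0 (1 / 2)) := by
    have := memLp_id_gaussianReal (μ := 0) (v := 1 / 2) 2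
    exact this.integrable_sq
  have h2 := (h1.comp_fst (gaussianReal 0 (1 / 2))).add (h1.comp_snd (gaussianReal 0 (1 / 2)))
  refine h2.congr (ae_of_all _ fun p => ?_)
  simp [Complex.sq_norm, Complex.normSq_apply, Complex.measurableEquivRealProd_symm_apply]
  ring

end Gaussian
end MISOWiretap

namespace MISOWiretap

section Gibbs

variable {Ω : Type*} [MeasurableSpace Ω] {P : Measure Ω} [IsProbabilityMeasure P]

/-- Gibbs' inequality for a likelihood ratio `R`. -/
lemma integral_log_nonpos {R : Ω → ℝ≥0∞} (hR : AEMeasurable R P) (hpos : ∀ ω, R ω ≠ 0)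
    (hle : ∫⁻ ω, R ω ∂P ≤ 1) (hint : Integrable (fun ω => Real.log (R ω).toReal) P) :
    ∫ ω, Real.log (R ω).toReal ∂P ≤ 0 := by
  have hfin : ∫⁻ ω, R ω ∂P ≠ ∞ := (hle.trans_lt ENNReal.one_lt_top).ne
  have hR1 : Integrable (fun ω => (R ω).toReal) P := integrable_toReal_of_lintegral_ne_top hR hfin
  have h1 : ∫ ω, Real.log (R ω).toReal ∂P ≤ ∫ ω, ((R ω).toReal - 1) ∂P := by
    refine integral_mono_ae hint (hR1.sub (integrable_const _)) ?_
    filter_upwards [ae_lt_top' hR hfin] with ω hω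
    exact Real.log_le_sub_one_of_pos (ENNReal.toReal_pos (hpos ω) hω.ne)
  have h2 : ∫ ω, (R ω).toReal ∂P ≤ 1 := by
    rw [integral_toReal hR (ae_lt_top' hR hfin)]
    exact ENNReal.toReal_le_of_le_ofReal zero_le_one (by simpa using hle)
  rw [integral_sub hR1 (integrable_const _)] at h1
  simp at h1
  linarith

lemma log_toReal_div {a b : ℝ≥0∞} (ha : a ≠ 0) (ha' : a ≠ ∞) (hb : b ≠ 0) (hb' : b ≠ ∞) :
    Real.log (a / b).toReal = Real.log a.toReal - Real.log b.toReal := by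
  rw [ENNReal.toReal_div, Real.log_div (ENNReal.toReal_ne_zero.2 ⟨ha, ha'⟩)
    (ENNReal.toReal_ne_zero.2 ⟨hb, hb'⟩)]

lemma log_toReal_mul {a b : ℝ≥0∞} (ha : a ≠ 0) (ha' : a ≠ ∞) (hb : b ≠ 0) (hb' : b ≠ ∞) :
    Real.log (a * b).toReal = Real.log a.toReal + Real.log b.toReal := by
  rw [ENNReal.toReal_mul, Real.log_mul (ENNReal.toReal_ne_zero.2 ⟨ha, ha'⟩)
    (ENNReal.toReal_ne_zero.2 ⟨hb, hb'⟩)]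

lemma log_toReal_prod {ι : Type*} (s : Finset ι) {f : ι → ℝ≥0∞} (h0 : ∀ i, f i ≠ 0)
    (h1 : ∀ i, f i ≠ ∞) :
    Real.log (∏ i ∈ s, f i).toReal = ∑ i ∈ s, Real.log (f i).toReal := by
  rw [ENNReal.toReal_prod, Real.log_prod]
  exact fun i _ => ENNReal.toReal_ne_zero.2 ⟨h0 i, h1 i⟩

lemma log_toReal_nonpos {a : ℝ≥0∞} (ha : a ≤ 1) : Real.log a.toReal ≤ 0 :=
  Real.log_nonpos ENNReal.toReal_nonneg (ENNReal.toReal_le_of_le_ofReal zero_le_one (by simpa))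

lemma log_toReal_mono {a b : ℝ≥0∞} (ha : a ≠ 0) (hab : a ≤ b) (hb : b ≠ ∞) :
    Real.log a.toReal ≤ Real.log b.toReal :=
  Real.log_le_log (ENNReal.toReal_pos ha (ne_top_of_le_ne_top hb hab)) (ENNReal.toReal_mono hb hab)

/-- A density that is bounded by one has an integrable logarithm if some other
density with integrable logarithm can be compared with it. -/
lemma integrable_log_of_ratio {p q : Ω → ℝ≥0∞} (hp : Measurable p) (hq : Measurable q)
    (hp0 : ∀ ω, p ω ≠ 0) (hp1 : ∀ ω, p ω ≤ 1) (hq0 : ∀ ω, q ω ≠ 0) (hq1 : ∀ ω, q ω ≠ ∞)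
    (hle : ∫⁻ ω, q ω / p ω ∂P ≤ 1) (hint : Integrable (fun ω => Real.log (q ω).toReal) P) :
    Integrable (fun ω => Real.log (p ω).toReal) P := by
  have hp2 : ∀ ω, p ω ≠ ∞ := fun ω => ne_top_of_le_ne_top ENNReal.one_ne_top (hp1 ω)
  have hR : Measurable fun ω => q ω / p ω := hq.div hp
  have hR1 : Integrable (fun ω => (q ω / p ω).toReal) P :=
    integrable_toReal_of_lintegral_ne_top hR.aemeasurable
      (hle.trans_lt ENNReal.one_lt_top).ne
  refine (hR1.add hint.norm).mono' hp.ennreal_toReal.log.aestronglyMeasurable (ae_of_all _ fun ω => ?_)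
  have h1 := log_toReal_div (hq0 ω) (hq1 ω) (hp0 ω) (hp2 ω)
  have h2 := log_toReal_nonpos (hp1 ω)
  have h3 : 0 < (q ω / p ω).toReal := ENNReal.toReal_pos
    (ENNReal.div_ne_zero.2 ⟨hq0 ω, hp2 ω⟩) (ENNReal.div_ne_top (hq1 ω) (hp0 ω))
  have h4 := Real.log_le_sub_one_of_pos h3
  simp only [Pi.add_apply, Real.norm_eq_abs]
  rw [abs_of_nonpos h2]
  have := neg_abs_le (Real.log (q ω).toReal)
  linarith

lemma integral_log_le_of_ratio {p q : Ω → ℝ≥0∞} (hp : Measurable p) (hq : Measurable q)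
    (hp0 : ∀ ω, p ω ≠ 0) (hp1 : ∀ ω, p ω ≠ ∞) (hq0 : ∀ ω, q ω ≠ 0) (hq1 : ∀ ω, q ω ≠ ∞)
    (hle : ∫⁻ ω, q ω / p ω ∂P ≤ 1) (hint : Integrable (fun ω => Real.log (q ω).toReal) P)
    (hint' : Integrable (fun ω => Real.log (p ω).toReal) P) :
    ∫ ω, Real.log (q ω).toReal ∂P ≤ ∫ ω, Real.log (p ω).toReal ∂P := by
  have h := integral_log_nonpos (hq.div hp).aemeasurable
    (fun ω => ENNReal.div_ne_zero.2 ⟨hq0 ω, hp1 ω⟩) hle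
  have h1 : ∀ ω, Real.log ((q / p) ω).toReal =
      Real.log (q ω).toReal - Real.log (p ω).toReal :=
    fun ω => log_toReal_div (hq0 ω) (hq1 ω) (hp0 ω) (hp1 ω)
  simp_rw [h1] at h
  have h2 := h (hint.sub hint')
  rw [integral_sub hint hint'] at h2
  linarith

end Gibbs

lemma measurable_comp₂ {A B X Y : Type*} [MeasurableSpace A] [MeasurableSpace B]
    [MeasurableSpace X] [MeasurableSpace Y] {F : A → B → Y}
    (hF : Measurable fun p : A × B => F p.1 p.2) {f : X → A} {g : X → B}
    (hf : Measurable f) (hg : Measurable g) : Measurable fun x => F (f x) (g x) :=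
  hF.comp (hf.prodMk hg)

section Noise

variable {ι : Type*} [Fintype ι]

/-- The law of a family of independent `CN(0, 1)` noises. -/
noncomputable abbrev noiseLaw (ι : Type*) [Fintype ι] : Measure (ι → ℂ) :=
  Measure.pi fun _ => stdComplexGaussian

/-- The density of outputs `o` that consist of means `c` and independent `CN(0, 1)` noises. -/
noncomputable def noiseDensity (c o : ι → ℂ) : ℝ≥0∞ := ∏ i, gaussDensity 1 (c i) (o i)

lemma noiseDensity_ne_zero (c o : ι → ℂ) : noiseDensity c o ≠ 0 :=
  Finset.prod_ne_zero_iff.2 fun _ _ => (gaussDensity_pos one_pos _ _).ne'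

@[fun_prop]
lemma measurable_noiseDensity {X : Type*} [MeasurableSpace X] {c o : X → ι → ℂ}
    (hc : Measurable c) (ho : Measurable o) :
    Measurable fun x => noiseDensity (c x) (o x) := by
  unfold noiseDensity
  fun_prop

lemma noiseDensity_le_one (c o : ι → ℂ) : noiseDensity c o ≤ 1 :=
  Finset.prod_le_one' fun _ _ => gaussDensity_le_one le_rfl _ _

lemma noiseLaw_eq_withDensity : noiseLaw ι = volume.withDensity (noiseDensity (ι := ι) 0) := by
  have h : SigmaFinite ((volume : Measure ℂ).withDensity (gaussDensity 1 0)) := by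
    rw [← stdComplexGaussian_eq_withDensity]; infer_instance
  unfold noiseLaw
  rw [stdComplexGaussian_eq_withDensity]
  rw [pi_withDensity (fun _ : ι => (volume : Measure ℂ)) fun _ => by fun_prop]
  rfl

/-- Integration over outputs with means `c`. -/
lemma lintegral_noise_add (c : ι → ℂ) {F : (ι → ℂ) → ℝ≥0∞} (hF : Measurable F) :
    ∫⁻ e, F (c + e) ∂noiseLaw ι = ∫⁻ o, F o * noiseDensity c o := by
  rw [noiseLaw_eq_withDensity, lintegral_withDensity_eq_lintegral_mul _ (by fun_prop)
    (by fun_prop), 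
    ← lintegral_add_left_eq_self (fun o => F o * noiseDensity c o) c]
  refine lintegral_congr fun e => ?_
  simp [noiseDensity, gaussDensity, mul_comm]

end Noise

section Mixture

variable {Θ S ι : Type*} [MeasurableSpace Θ] [MeasurableSpace S] [Fintype ι]
  (μ : Measure Θ) (κ : Measure S) (m : Θ → S → ι → ℂ)

/-- The density of the outputs given the state `s`, when the input data have law `μ` and lead to
the mean outputs `m`. -/
noncomputable def mixDensity (s : S) (o : ι → ℂ) : ℝ≥0∞ := ∫⁻ θ, noiseDensity (m θ s) o ∂μ

/-- The joint law of input data, state, and noise. -/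
noncomputable abbrev channelLaw (ι : Type*) [Fintype ι] : Measure (Θ × S × (ι → ℂ)) :=
  μ.prod (κ.prod (noiseLaw ι))

/-- Minus the differential entropy of the outputs given the states. -/
noncomputable def negEntropy : ℝ :=
  ∫ ω, Real.log (mixDensity μ m ω.2.1 (m ω.1 ω.2.1 + ω.2.2)).toReal ∂(channelLaw μ κ ι)

variable {μ κ m} [IsProbabilityMeasure μ] [IsProbabilityMeasure κ]

lemma mixDensity_le_one (s : S) (o : ι → ℂ) : mixDensity μ m s o ≤ 1 := by
  calc mixDensity μ m s o ≤ ∫⁻ _, 1 ∂μ := lintegral_mono fun _ => noiseDensity_le_one _ _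
    _ = 1 := by simp

lemma mixDensity_ne_top (s : S) (o : ι → ℂ) : mixDensity μ m s o ≠ ∞ :=
  ne_top_of_le_ne_top ENNReal.one_ne_top (mixDensity_le_one s o)

lemma mixDensity_ne_zero (hm : Measurable fun p : Θ × S => m p.1 p.2) (s : S) (o : ι → ℂ) :
    mixDensity μ m s o ≠ 0 := by
  unfold mixDensity
  have h1 : Measurable fun θ => m θ s := hm.comp (by fun_prop : Measurable fun θ : Θ => (θ, s))
  rw [Ne, lintegral_eq_zero_iff (by fun_prop)]
  intro h
  have h2 : ∀ᵐ _ ∂μ, False := by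
    filter_upwards [h] with θ hθ using noiseDensity_ne_zero _ _ hθ
  simp only [eventually_false_iff_eq_bot, ae_eq_bot] at h2
  exact IsProbabilityMeasure.ne_zero μ h2

lemma measurable_mixDensity (hm : Measurable fun p : Θ × S => m p.1 p.2) :
    Measurable fun p : S × (ι → ℂ) => mixDensity μ m p.1 p.2 := by
  unfold mixDensity
  have h1 : Measurable fun p : (S × (ι → ℂ)) × Θ => m p.2 p.1.1 :=
    hm.comp (by fun_prop : Measurable fun p : (S × (ι → ℂ)) × Θ => (p.2, p.1.1))
  exact Measurable.lintegral_prod_right' (f := fun p : (S × (ι → ℂ)) × Θ =>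
    noiseDensity (m p.2 p.1.1) p.1.2) (by fun_prop)

lemma measurable_mixDensity_output (hm : Measurable fun p : Θ × S => m p.1 p.2) :
    Measurable fun ω : Θ × S × (ι → ℂ) => mixDensity μ m ω.2.1 (m ω.1 ω.2.1 + ω.2.2) := by
  have h1 : Measurable fun ω : Θ × S × (ι → ℂ) => m ω.1 ω.2.1 :=
    measurable_comp₂ hm (by fun_prop) (by fun_prop)
  exact measurable_comp₂ (F := mixDensity μ m) (measurable_mixDensity hm) (by fun_prop)
    (by fun_prop)

lemma lintegral_output (hm : Measurable fun p : Θ × S => m p.1 p.2)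
    {G : S → (ι → ℂ) → ℝ≥0∞} (hG : Measurable fun p : S × (ι → ℂ) => G p.1 p.2) :
    ∫⁻ ω, G ω.2.1 (m ω.1 ω.2.1 + ω.2.2) ∂(channelLaw μ κ ι) =
      ∫⁻ s, (∫⁻ o, G s o * mixDensity μ m s o) ∂κ := by
  have h1 : Measurable fun ω : Θ × S × (ι → ℂ) => m ω.1 ω.2.1 :=
    measurable_comp₂ hm (by fun_prop) (by fun_prop)
  have hGs : ∀ s, Measurable (G s) := fun s =>
    hG.comp (by fun_prop : Measurable fun o : ι → ℂ => (s, o))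
  rw [lintegral_prod _ (measurable_comp₂ hG (by fun_prop) (by fun_prop)).aemeasurable]
  have h2 : ∀ θ, ∫⁻ p : S × (ι → ℂ), G p.1 (m θ p.1 + p.2) ∂(κ.prod (noiseLaw ι)) =
      ∫⁻ s, (∫⁻ o, G s o * noiseDensity (m θ s) o) ∂κ := by
    intro θ
    have h3 : Measurable fun p : S × (ι → ℂ) => m θ p.1 :=
      measurable_comp₂ hm (by fun_prop) (by fun_prop)
    rw [lintegral_prod _ (measurable_comp₂ hG (by fun_prop) (by fun_prop)).aemeasurable]
    exact lintegral_congr fun s => lintegral_noise_add (m θ s) (hGs s)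
  simp_rw [h2]
  have h4 : Measurable fun p : (Θ × S) × (ι → ℂ) => G p.1.2 p.2 * noiseDensity (m p.1.1 p.1.2) p.2 := by
    have h5 : Measurable fun p : (Θ × S) × (ι → ℂ) => m p.1.1 p.1.2 :=
      measurable_comp₂ hm (by fun_prop) (by fun_prop)
    exact (measurable_comp₂ hG (by fun_prop) (by fun_prop)).mul (by fun_prop)
  rw [lintegral_lintegral_swap h4.lintegral_prod_right'.aemeasurable]
  refine lintegral_congr fun s => ?_
  have h6 : Measurable fun p : Θ × (ι → ℂ) => G s p.2 * noiseDensity (m p.1 s) p.2 :=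
    h4.comp (by fun_prop : Measurable fun p : Θ × (ι → ℂ) => ((p.1, s), p.2))
  rw [lintegral_lintegral_swap (f := fun θ o => G s o * noiseDensity (m θ s) o) h6.aemeasurable]
  refine lintegral_congr fun o => ?_
  have h5 : Measurable fun θ => m θ s := measurable_comp₂ hm (by fun_prop) (by fun_prop)
  rw [lintegral_const_mul _ (by fun_prop)]
  rfl

lemma lintegral_ratio_le_one (hm : Measurable fun p : Θ × S => m p.1 p.2)
    {q : S → (ι → ℂ) → ℝ≥0∞} (hq : Measurable fun p : S × (ι → ℂ) => q p.1 p.2)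
    (hq1 : ∀ s, ∫⁻ o, q s o ≤ 1) :
    ∫⁻ ω, q ω.2.1 (m ω.1 ω.2.1 + ω.2.2) / mixDensity μ m ω.2.1 (m ω.1 ω.2.1 + ω.2.2)
      ∂(channelLaw μ κ ι) ≤ 1 := by
  rw [lintegral_output hm (G := fun s o => q s o / mixDensity μ m s o)
    (hq.div (measurable_mixDensity hm))]
  have h1 : ∀ s o, q s o / mixDensity μ m s o * mixDensity μ m s o = q s o := fun s o =>
    ENNReal.div_mul_cancel (mixDensity_ne_zero hm s o) (mixDensity_ne_top s o)
  simp_rw [h1]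
  calc ∫⁻ s, (∫⁻ o, q s o) ∂κ ≤ ∫⁻ _, 1 ∂κ := lintegral_mono hq1
    _ = 1 := by simp

/-- The differential entropy is at most the cross entropy. -/
lemma crossEntropy_le_negEntropy (hm : Measurable fun p : Θ × S => m p.1 p.2)
    {q : S → (ι → ℂ) → ℝ≥0∞} (hq : Measurable fun p : S × (ι → ℂ) => q p.1 p.2)
    (hq1 : ∀ s, ∫⁻ o, q s o ≤ 1) (hq0 : ∀ s o, q s o ≠ 0) (hqt : ∀ s o, q s o ≠ ∞)
    (hint : Integrable (fun ω => Real.log (q ω.2.1 (m ω.1 ω.2.1 + ω.2.2)).toReal)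
      (channelLaw μ κ ι)) :
    Integrable (fun ω => Real.log (mixDensity μ m ω.2.1 (m ω.1 ω.2.1 + ω.2.2)).toReal)
      (channelLaw μ κ ι) ∧
    ∫ ω, Real.log (q ω.2.1 (m ω.1 ω.2.1 + ω.2.2)).toReal ∂(channelLaw μ κ ι) ≤
      negEntropy μ κ m := by
  have h1 : Measurable fun ω : Θ × S × (ι → ℂ) => m ω.1 ω.2.1 :=
    measurable_comp₂ hm (by fun_prop) (by fun_prop)
  have hq' : Measurable fun ω : Θ × S × (ι → ℂ) => q ω.2.1 (m ω.1 ω.2.1 + ω.2.2) :=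
    measurable_comp₂ hq (by fun_prop) (by fun_prop)
  have h2 := integrable_log_of_ratio (measurable_mixDensity_output hm) hq'
    (fun ω => mixDensity_ne_zero hm _ _) (fun ω => mixDensity_le_one _ _) (fun ω => hq0 _ _)
    (fun ω => hqt _ _) (lintegral_ratio_le_one hm hq hq1) hint
  exact ⟨h2, integral_log_le_of_ratio (measurable_mixDensity_output hm) hq'
    (fun ω => mixDensity_ne_zero hm _ _) (fun ω => mixDensity_ne_top _ _) (fun ω => hq0 _ _)
    (fun ω => hqt _ _) (lintegral_ratio_le_one hm hq hq1) hint h2⟩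

end Mixture
end MISOWiretap

namespace MISOWiretap

section Message

variable {M : ℕ} [NeZero M]

/-- The law of a uniform message. -/
noncomputable abbrev messageLaw (M : ℕ) : Measure (Fin M) := uniformOn Set.univ

instance : IsProbabilityMeasure (messageLaw M) :=
  isProbabilityMeasure_uniformOn Set.finite_univ Set.univ_nonempty

lemma messageLaw_singleton (w : Fin M) : messageLaw M {w} = (M : ℝ≥0∞)⁻¹ := by
  simp [messageLaw, uniformOn_univ]

lemma lintegral_messageLaw (f : Fin M → ℝ≥0∞) :
    ∫⁻ w, f w ∂messageLaw M = (M : ℝ≥0∞)⁻¹ * ∑ w, f w := by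
  rw [lintegral_fintype, Finset.mul_sum]
  simp_rw [messageLaw_singleton, mul_comm]

lemma integral_messageLaw (f : Fin M → ℝ) :
    ∫ w, f w ∂messageLaw M = (M : ℝ)⁻¹ * ∑ w, f w := by
  rw [integral_fintype (Integrable.of_finite), Finset.mul_sum]
  simp [Measure.real, messageLaw_singleton]

variable {V X : Type*} [MeasurableSpace V] [MeasurableSpace X]
  {σ : Measure V} {χ : Measure X} [IsProbabilityMeasure σ] [IsProbabilityMeasure χ]

lemma lintegral_message_slice {F : (Fin M × V) × X → ℝ≥0∞} (hF : Measurable F) :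
    ∫⁻ ω, F ω ∂((messageLaw M).prod σ).prod χ =
      (M : ℝ≥0∞)⁻¹ * ∑ w, ∫⁻ p, F ((w, p.1), p.2) ∂σ.prod χ := by
  have h := (measurePreserving_prodAssoc (messageLaw M) σ χ).symm
  rw [← h.lintegral_comp hF, lintegral_prod _ (show Measurable fun a => F (MeasurableEquiv.prodAssoc.symm a) from
      hF.comp h.measurable).aemeasurable,
    lintegral_messageLaw]
  rfl

lemma integral_message_slice {F : (Fin M × V) × X → ℝ}
    (hF : Integrable F (((messageLaw M).prod σ).prod χ)) :
    ∫ ω, F ω ∂((messageLaw M).prod σ).prod χ =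
      (M : ℝ)⁻¹ * ∑ w, ∫ p, F ((w, p.1), p.2) ∂σ.prod χ := by
  have h := (measurePreserving_prodAssoc (messageLaw M) σ χ).symm
  rw [← h.integral_comp MeasurableEquiv.prodAssoc.symm.measurableEmbedding,
    integral_prod _ (show Integrable (fun a => F (MeasurableEquiv.prodAssoc.symm a)) _ from
      h.integrable_comp_of_integrable hF), integral_messageLaw]
  rfl

lemma integrable_message_slice {F : (Fin M × V) × X → ℝ} (hF : Measurable F)
    (h : ∀ w, Integrable (fun p => F ((w, p.1), p.2)) (σ.prod χ)) :
    Integrable F (((messageLaw M).prod σ).prod χ) := by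
  have h1 := (measurePreserving_prodAssoc (messageLaw M) σ χ).symm
  rw [← h1.integrable_comp_emb MeasurableEquiv.prodAssoc.symm.measurableEmbedding,
    integrable_prod_iff (hF.comp h1.measurable).aestronglyMeasurable]
  exact ⟨ae_of_all _ h, Integrable.of_finite⟩

lemma measurable_message_comp {Y Z : Type*} [MeasurableSpace Y] [MeasurableSpace Z]
    {G : Fin M → Y → Z} (hG : ∀ w, Measurable (G w)) {f : X → Fin M} {g : X → Y}
    (hf : Measurable f) (hg : Measurable g) : Measurable fun x => G (f x) (g x) := by
  have h : Measurable fun p : Fin M × Y => G p.1 p.2 := measurable_from_prod_countable_right hG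
  exact measurable_comp₂ h hf hg

end Message

section InformationBounds

variable {M : ℕ} [NeZero M] {V S ι : Type*} [MeasurableSpace V] [MeasurableSpace S] [Fintype ι]
  {σ : Measure V} {κ : Measure S} [IsProbabilityMeasure σ] [IsProbabilityMeasure κ]
  {m : Fin M × V → S → ι → ℂ}

/-- The mean outputs for a fixed message. -/
def fixMessage (m : Fin M × V → S → ι → ℂ) (w : Fin M) (v : V) : S → ι → ℂ := m (w, v)

lemma measurable_fixMessage (hm : Measurable fun p : (Fin M × V) × S => m p.1 p.2) (w : Fin M) :
    Measurable fun p : V × S => fixMessage m w p.1 p.2 :=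
  measurable_comp₂ (F := m) hm (by fun_prop) (by fun_prop)

lemma measurable_fixMessage_output (hm : Measurable fun p : (Fin M × V) × S => m p.1 p.2) :
    Measurable fun ω : (Fin M × V) × S × (ι → ℂ) =>
      mixDensity σ (fixMessage m ω.1.1) ω.2.1 (m ω.1 ω.2.1 + ω.2.2) := by
  have h1 : Measurable fun ω : (Fin M × V) × S × (ι → ℂ) => m ω.1 ω.2.1 :=
    measurable_comp₂ hm (by fun_prop) (by fun_prop)
  exact measurable_message_comp
    (G := fun w (p : S × (ι → ℂ)) => mixDensity σ (fixMessage m w) p.1 p.2)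
    (fun w => measurable_mixDensity (measurable_fixMessage hm w))
    (f := fun ω : (Fin M × V) × S × (ι → ℂ) => ω.1.1)
    (g := fun ω => (ω.2.1, m ω.1 ω.2.1 + ω.2.2)) (by fun_prop) (by fun_prop)

lemma lintegral_message_output (hm : Measurable fun p : (Fin M × V) × S => m p.1 p.2)
    {G : Fin M → S → (ι → ℂ) → ℝ≥0∞}
    (hG : ∀ w, Measurable fun p : S × (ι → ℂ) => G w p.1 p.2) :
    ∫⁻ ω, G ω.1.1 ω.2.1 (m ω.1 ω.2.1 + ω.2.2) ∂(channelLaw ((messageLaw M).prod σ) κ ι) =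
      (M : ℝ≥0∞)⁻¹ * ∑ w, ∫⁻ s, (∫⁻ o, G w s o * mixDensity σ (fixMessage m w) s o) ∂κ := by
  have h1 : Measurable fun ω : (Fin M × V) × S × (ι → ℂ) => m ω.1 ω.2.1 :=
    measurable_comp₂ hm (by fun_prop) (by fun_prop)
  rw [lintegral_message_slice]
  · congr 1
    refine Finset.sum_congr rfl fun w _ => ?_
    exact lintegral_output (measurable_fixMessage hm w) (hG w)
  · exact measurable_message_comp (G := fun w (p : S × (ι → ℂ)) => G w p.1 p.2) hG
      (f := fun ω : (Fin M × V) × S × (ι → ℂ) => ω.1.1)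
      (g := fun ω => (ω.2.1, m ω.1 ω.2.1 + ω.2.2)) (by fun_prop) (by fun_prop)

/-- The logarithm of the output density for the given message. -/
noncomputable def logDensityMessage (σ : Measure V) (m : Fin M × V → S → ι → ℂ)
    (ω : (Fin M × V) × S × (ι → ℂ)) : ℝ :=
  Real.log (mixDensity σ (fixMessage m ω.1.1) ω.2.1 (m ω.1 ω.2.1 + ω.2.2)).toReal

lemma integrable_logDensityMessage (hm : Measurable fun p : (Fin M × V) × S => m p.1 p.2)
    (hint : ∀ w, Integrable (fun ω => Real.log (mixDensity σ (fixMessage m w) ω.2.1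
      (fixMessage m w ω.1 ω.2.1 + ω.2.2)).toReal) (channelLaw σ κ ι)) :
    Integrable (logDensityMessage σ m) (channelLaw ((messageLaw M).prod σ) κ ι) :=
  integrable_message_slice (measurable_fixMessage_output hm).ennreal_toReal.log hint

lemma integral_logDensityMessage (hm : Measurable fun p : (Fin M × V) × S => m p.1 p.2)
    (hint : ∀ w, Integrable (fun ω => Real.log (mixDensity σ (fixMessage m w) ω.2.1
      (fixMessage m w ω.1 ω.2.1 + ω.2.2)).toReal) (channelLaw σ κ ι)) :
    ∫ ω, logDensityMessage σ m ω ∂(channelLaw ((messageLaw M).prod σ) κ ι) =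
      (M : ℝ)⁻¹ * ∑ w, negEntropy σ κ (fixMessage m w) :=
  integral_message_slice (integrable_logDensityMessage hm hint)

lemma lintegral_mixDensity {Θ : Type*} [MeasurableSpace Θ] {μ : Measure Θ} [IsProbabilityMeasure μ]
    {m : Θ → S → ι → ℂ} (hm : Measurable fun p : Θ × S => m p.1 p.2) :
    ∫⁻ s, (∫⁻ o, mixDensity μ m s o) ∂κ = 1 := by
  have h := lintegral_output (μ := μ) (κ := κ) hm (G := fun _ _ => 1) measurable_const
  simpa using h.symm

/-- Fano's inequality: a reliable decoder makes the message rate a lower bound of the mutual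
information between message and outputs. -/
lemma fano_le (hm : Measurable fun p : (Fin M × V) × S => m p.1 p.2)
    (hint : ∀ w, Integrable (fun ω => Real.log (mixDensity σ (fixMessage m w) ω.2.1
      (fixMessage m w ω.1 ω.2.1 + ω.2.2)).toReal) (channelLaw σ κ ι))
    (hint' : Integrable (fun ω => Real.log (mixDensity ((messageLaw M).prod σ) m ω.2.1
      (m ω.1 ω.2.1 + ω.2.2)).toReal) (channelLaw ((messageLaw M).prod σ) κ ι))
    {d : S → (ι → ℂ) → Fin M} (hd : Measurable fun p : S × (ι → ℂ) => d p.1 p.2) :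
    (1 - (channelLaw ((messageLaw M).prod σ) κ ι).real
        {ω | d ω.2.1 (m ω.1 ω.2.1 + ω.2.2) ≠ ω.1.1}) * Real.log M - Real.log 2 ≤
      (M : ℝ)⁻¹ * ∑ w, negEntropy σ κ (fixMessage m w) -
        negEntropy ((messageLaw M).prod σ) κ m := by
  set Q := channelLaw ((messageLaw M).prod σ) κ ι with hQ
  have hM0 : (M : ℝ≥0∞) ≠ 0 := by exact_mod_cast NeZero.ne M
  have hMt : (M : ℝ≥0∞) ≠ ∞ := ENNReal.natCast_ne_top M
  have hMr : (0 : ℝ) < M := by exact_mod_cast Nat.pos_of_ne_zero (NeZero.ne M)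
  have h1 : Measurable fun ω : (Fin M × V) × S × (ι → ℂ) => m ω.1 ω.2.1 :=
    measurable_comp₂ hm (by fun_prop) (by fun_prop)
  let r : Fin M → S → (ι → ℂ) → ℝ≥0∞ := fun w s o =>
    (if d s o = w then (2 : ℝ≥0∞)⁻¹ else 0) + (2 * (M : ℝ≥0∞))⁻¹
  have hr : ∀ w, Measurable fun p : S × (ι → ℂ) => r w p.1 p.2 := fun w =>
    (Measurable.ite (hd (measurableSet_singleton w)) measurable_const measurable_const).add
      measurable_const
  have hrsum : ∀ s o, ∑ w, r w s o = 1 := fun s o => by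
    simp only [r, Finset.sum_add_distrib, Finset.sum_ite_eq, Finset.mem_univ, if_true,
      Finset.sum_const, Finset.card_univ, Fintype.card_fin, nsmul_eq_mul]
    rw [ENNReal.mul_inv (by simp) (by simp), mul_left_comm, ENNReal.mul_inv_cancel hM0 hMt,
      mul_one, ENNReal.inv_two_add_inv_two]
  have hr0 : ∀ w s o, r w s o ≠ 0 := fun w s o => by
    simp [r, ENNReal.mul_eq_top, hMt]
  have hrt : ∀ w s o, r w s o ≠ ∞ := fun w s o => by
    simp only [r]
    refine ENNReal.add_ne_top.2 ⟨by split_ifs <;> simp, by simp [hM0]⟩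
  let p := mixDensity ((messageLaw M).prod σ) m
  let pw := fun w => mixDensity σ (fixMessage m w)
  let q := fun w s o => r w s o * (M * p s o)
  have hp0 : ∀ s o, p s o ≠ 0 := mixDensity_ne_zero hm
  have hpt : ∀ s o, p s o ≠ ∞ := mixDensity_ne_top
  have hpw0 : ∀ w s o, pw w s o ≠ 0 := fun w => mixDensity_ne_zero (measurable_fixMessage hm w)
  have hpwt : ∀ w s o, pw w s o ≠ ∞ := fun w => mixDensity_ne_top
  have hMp0 : ∀ s o, (M : ℝ≥0∞) * p s o ≠ 0 := fun s o => mul_ne_zero hM0 (hp0 s o)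
  have hMpt : ∀ s o, (M : ℝ≥0∞) * p s o ≠ ∞ := fun s o => ENNReal.mul_ne_top hMt (hpt s o)
  have hqm : ∀ w, Measurable fun x : S × (ι → ℂ) => q w x.1 x.2 := fun w =>
    (hr w).mul (measurable_const.mul (measurable_mixDensity hm))
  have hle : ∫⁻ ω, q ω.1.1 ω.2.1 (m ω.1 ω.2.1 + ω.2.2) / pw ω.1.1 ω.2.1 (m ω.1 ω.2.1 + ω.2.2) ∂Q
      ≤ 1 := by
    rw [hQ, lintegral_message_output hm (G := fun w s o => q w s o / pw w s o)
      fun w => (hqm w).div (measurable_mixDensity (measurable_fixMessage hm w))]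
    have h2 : ∀ w s o, q w s o / pw w s o * mixDensity σ (fixMessage m w) s o
        = M * (r w s o * p s o) := fun w s o => by
      rw [ENNReal.div_mul_cancel (hpw0 w s o) (hpwt w s o)]
      exact mul_left_comm _ _ _
    simp_rw [h2]
    have hrp : ∀ w, Measurable fun x : S × (ι → ℂ) => r w x.1 x.2 * p x.1 x.2 := fun w =>
      (hr w).mul (measurable_mixDensity hm)
    have hrps : ∀ w s, Measurable fun o : ι → ℂ => r w s o * p s o := fun w s =>
      (hrp w).comp (by fun_prop : Measurable fun o : ι → ℂ => (s, o))
    have h3 : ∀ w, ∫⁻ s, (∫⁻ o, (M : ℝ≥0∞) * (r w s o * p s o)) ∂κ =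
        M * ∫⁻ s, (∫⁻ o, r w s o * p s o) ∂κ := fun w => by
      simp_rw [lintegral_const_mul _ (hrps w _)]
      rw [lintegral_const_mul _ (hrp w).lintegral_prod_right']
    simp_rw [h3]
    rw [← Finset.mul_sum, ← mul_assoc, ENNReal.inv_mul_cancel hM0 hMt, one_mul,
      ← lintegral_finsetSum _ fun w _ => (hrp w).lintegral_prod_right']
    simp_rw [← lintegral_finsetSum Finset.univ fun w _ => hrps w _, ← Finset.sum_mul, hrsum,
      one_mul]
    exact (lintegral_mixDensity hm).le
  have hdm : Measurable fun ω : (Fin M × V) × S × (ι → ℂ) => d ω.2.1 (m ω.1 ω.2.1 + ω.2.2) :=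
    measurable_comp₂ hd (by fun_prop) (by fun_prop)
  have hE : MeasurableSet {ω : (Fin M × V) × S × (ι → ℂ) |
      d ω.2.1 (m ω.1 ω.2.1 + ω.2.2) ≠ ω.1.1} :=
    (measurableSet_eq_fun hdm (by fun_prop)).compl
  set E := {ω : (Fin M × V) × S × (ι → ℂ) | d ω.2.1 (m ω.1 ω.2.1 + ω.2.2) ≠ ω.1.1} with hEdef
  have hrmeas : Measurable fun ω : (Fin M × V) × S × (ι → ℂ) =>
      r ω.1.1 ω.2.1 (m ω.1 ω.2.1 + ω.2.2) :=
    measurable_message_comp (G := fun w (p : S × (ι → ℂ)) => r w p.1 p.2) hr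
      (f := fun ω : (Fin M × V) × S × (ι → ℂ) => ω.1.1)
      (g := fun ω => (ω.2.1, m ω.1 ω.2.1 + ω.2.2)) (by fun_prop) (by fun_prop)
  have hlogr_le : ∀ w s o, Real.log (r w s o).toReal ≤ 0 := fun w s o => by
    refine log_toReal_nonpos ?_
    rw [← hrsum s o]
    exact Finset.single_le_sum (f := fun w => r w s o) (fun _ _ => zero_le) (Finset.mem_univ w)
  have hlogr_ge : ∀ ω : (Fin M × V) × S × (ι → ℂ),
      -Real.log 2 - E.indicator (fun _ => Real.log M) ω ≤
        Real.log (r ω.1.1 ω.2.1 (m ω.1 ω.2.1 + ω.2.2)).toReal := fun ω => by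
    by_cases hω : ω ∈ E
    · rw [Set.indicator_of_mem hω]
      have h2 : Real.log ((2 * (M : ℝ≥0∞))⁻¹).toReal = -Real.log 2 - Real.log M := by
        simp [Real.log_inv, Real.log_mul, hMr.ne', ENNReal.toReal_inv]
        ring
      rw [← h2]
      exact log_toReal_mono (by simp [ENNReal.mul_eq_top, hMt]) le_add_self (hrt _ _ _)
    · rw [Set.indicator_of_notMem hω]
      have h2 : Real.log ((2 : ℝ≥0∞)⁻¹).toReal = -Real.log 2 := by simp
      rw [sub_zero, ← h2]
      refine log_toReal_mono (by simp) ?_ (hrt _ _ _)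
      have h3 : d ω.2.1 (m ω.1 ω.2.1 + ω.2.2) = ω.1.1 := by simpa [hEdef] using hω
      simp only [r, h3, if_true]
      exact le_self_add
  have hlogr_int : Integrable
      (fun ω => Real.log (r ω.1.1 ω.2.1 (m ω.1 ω.2.1 + ω.2.2)).toReal) Q := by
    refine (integrable_const (Real.log 2 + Real.log M)).mono'
      hrmeas.ennreal_toReal.log.aestronglyMeasurable (ae_of_all _ fun ω => ?_)
    rw [Real.norm_eq_abs, abs_of_nonpos (hlogr_le _ _ _)]
    have h2 := hlogr_ge ω
    have h3 : E.indicator (fun _ => Real.log M) ω ≤ Real.log M :=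
      Set.indicator_le_self' (fun _ _ => Real.log_natCast_nonneg M) ω
    linarith
  have hlogq : ∀ ω : (Fin M × V) × S × (ι → ℂ),
      Real.log (q ω.1.1 ω.2.1 (m ω.1 ω.2.1 + ω.2.2)).toReal =
      Real.log (r ω.1.1 ω.2.1 (m ω.1 ω.2.1 + ω.2.2)).toReal +
        (Real.log M + Real.log (p ω.2.1 (m ω.1 ω.2.1 + ω.2.2)).toReal) := fun ω => by
    rw [log_toReal_mul (hr0 _ _ _) (hrt _ _ _) (hMp0 _ _) (hMpt _ _),
      log_toReal_mul hM0 hMt (hp0 _ _) (hpt _ _)]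
    simp
  have hMpint : Integrable (fun ω : (Fin M × V) × S × (ι → ℂ) =>
      Real.log M + Real.log (p ω.2.1 (m ω.1 ω.2.1 + ω.2.2)).toReal) Q :=
    (integrable_const _).add hint'
  have hmain := integral_log_le_of_ratio (measurable_fixMessage_output hm)
    (q := fun ω => q ω.1.1 ω.2.1 (m ω.1 ω.2.1 + ω.2.2))
    (hrmeas.mul (measurable_const.mul (measurable_mixDensity_output hm)))
    (fun ω => hpw0 _ _ _) (fun ω => hpwt _ _ _) (fun ω => mul_ne_zero (hr0 _ _ _) (hMp0 _ _))
    (fun ω => ENNReal.mul_ne_top (hrt _ _ _) (hMpt _ _)) hle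
    (by simp_rw [hlogq]; exact hlogr_int.add hMpint) (integrable_logDensityMessage hm hint)
  simp_rw [hlogq] at hmain
  rw [integral_add hlogr_int hMpint, integral_add (integrable_const _) hint'] at hmain
  have h5 : ∫ ω, (-Real.log 2 - E.indicator (fun _ => Real.log M) ω) ∂Q ≤
      ∫ ω, Real.log (r ω.1.1 ω.2.1 (m ω.1 ω.2.1 + ω.2.2)).toReal ∂Q :=
    integral_mono ((integrable_const _).sub ((integrable_const _).indicator hE)) hlogr_int hlogr_ge
  rw [integral_sub (integrable_const _) ((integrable_const _).indicator hE),
    integral_indicator_const _ hE] at h5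
  have h6 := integral_logDensityMessage hm hint
  simp only [logDensityMessage] at h6
  rw [← h6]
  simp only [integral_const, probReal_univ, smul_eq_mul] at hmain h5
  unfold negEntropy

  linarith

/-- The leakage is the difference between the output entropies with and without knowledge of the
message. -/
lemma toReal_klDiv_message (hm : Measurable fun p : (Fin M × V) × S => m p.1 p.2)
    (hint : ∀ w, Integrable (fun ω => Real.log (mixDensity σ (fixMessage m w) ω.2.1
      (fixMessage m w ω.1 ω.2.1 + ω.2.2)).toReal) (channelLaw σ κ ι))
    (hint' : Integrable (fun ω => Real.log (mixDensity ((messageLaw M).prod σ) m ω.2.1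
      (m ω.1 ω.2.1 + ω.2.2)).toReal) (channelLaw ((messageLaw M).prod σ) κ ι))
    {X : Type*} [MeasurableSpace X] {g : S → (ι → ℂ) → X} {r₁ : X → S} {r₂ : X → ι → ℂ}
    (hg : Measurable fun p : S × (ι → ℂ) => g p.1 p.2) (hr₁ : Measurable r₁) (hr₂ : Measurable r₂)
    (hmr : ∀ θ s o, m θ (r₁ (g s o)) = m θ s) (hro : ∀ s o, r₂ (g s o) = o) :
    (InformationTheory.klDiv
      ((channelLaw ((messageLaw M).prod σ) κ ι).map
        fun ω => (ω.1.1, g ω.2.1 (m ω.1 ω.2.1 + ω.2.2)))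
      (((channelLaw ((messageLaw M).prod σ) κ ι).map fun ω => ω.1.1).prod
        ((channelLaw ((messageLaw M).prod σ) κ ι).map
          fun ω => g ω.2.1 (m ω.1 ω.2.1 + ω.2.2)))).toReal =
      (M : ℝ)⁻¹ * ∑ w, negEntropy σ κ (fixMessage m w) -
        negEntropy ((messageLaw M).prod σ) κ m := by
  set Q := channelLaw ((messageLaw M).prod σ) κ ι with hQ
  let p := mixDensity ((messageLaw M).prod σ) m
  let pw := fun w => mixDensity σ (fixMessage m w)
  have hp0 : ∀ s o, p s o ≠ 0 := mixDensity_ne_zero hm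
  have hpt : ∀ s o, p s o ≠ ∞ := mixDensity_ne_top
  have hpw0 : ∀ w s o, pw w s o ≠ 0 := fun w => mixDensity_ne_zero (measurable_fixMessage hm w)
  have hpwt : ∀ w s o, pw w s o ≠ ∞ := fun w => mixDensity_ne_top
  have hp : Measurable fun x : S × (ι → ℂ) => p x.1 x.2 := measurable_mixDensity hm
  have hpw : ∀ w, Measurable fun x : S × (ι → ℂ) => pw w x.1 x.2 := fun w =>
    measurable_mixDensity (measurable_fixMessage hm w)
  let L : Fin M × X → ℝ≥0∞ := fun x => pw x.1 (r₁ x.2) (r₂ x.2) / p (r₁ x.2) (r₂ x.2)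
  have hL : Measurable L := by
    refine measurable_from_prod_countable_right fun w => ?_
    exact (measurable_comp₂ (hpw w) hr₁ hr₂).div (measurable_comp₂ hp hr₁ hr₂)
  have hLg : ∀ w s o, L (w, g s o) = pw w s o / p s o := fun w s o => by
    simp only [L, p, pw, mixDensity, fixMessage, hmr, hro]
  have hmm : Measurable fun ω : (Fin M × V) × S × (ι → ℂ) => m ω.1 ω.2.1 :=
    measurable_comp₂ hm (by fun_prop) (by fun_prop)
  have hgm : Measurable fun ω : (Fin M × V) × S × (ι → ℂ) => g ω.2.1 (m ω.1 ω.2.1 + ω.2.2) :=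
    measurable_comp₂ hg (by fun_prop) (by fun_prop)
  have hjm : Measurable fun ω : (Fin M × V) × S × (ι → ℂ) =>
      (ω.1.1, g ω.2.1 (m ω.1 ω.2.1 + ω.2.2)) := by fun_prop
  have hfst : Q.map (fun ω => ω.1.1) = messageLaw M :=
    (measurePreserving_fst.comp measurePreserving_fst).map_eq
  have hprob : IsProbabilityMeasure (Q.map fun ω => g ω.2.1 (m ω.1 ω.2.1 + ω.2.2)) :=
    Measure.isProbabilityMeasure_map hgm.aemeasurable
  have hprob' : IsProbabilityMeasure
      (Q.map fun ω => (ω.1.1, g ω.2.1 (m ω.1 ω.2.1 + ω.2.2))) :=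
    Measure.isProbabilityMeasure_map hjm.aemeasurable
  rw [hfst]
  set prodLaw := (messageLaw M).prod (Q.map fun ω => g ω.2.1 (m ω.1 ω.2.1 + ω.2.2)) with hprodLaw
  have hwd : (Q.map fun ω => (ω.1.1, g ω.2.1 (m ω.1 ω.2.1 + ω.2.2))) = prodLaw.withDensity L := by
    refine Measure.ext_of_lintegral _ fun F hF => ?_
    have hFg : ∀ w, Measurable fun x : S × (ι → ℂ) => F (w, g x.1 x.2) := fun w => by fun_prop
    rw [lintegral_map hF hjm, lintegral_withDensity_eq_lintegral_mul _ hL hF, hprodLaw,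
      lintegral_prod _ (hL.mul hF).aemeasurable, lintegral_messageLaw, hQ,
      lintegral_message_output hm (G := fun w s o => F (w, g s o)) hFg]
    congr 1
    refine Finset.sum_congr rfl fun w _ => ?_
    have hLF : Measurable fun x : S × (ι → ℂ) => pw w x.1 x.2 / p x.1 x.2 * F (w, g x.1 x.2) :=
      ((hpw w).div hp).mul (hFg w)
    rw [lintegral_map (show Measurable fun y => (L * F) (w, y) from
      (hL.mul hF).comp measurable_prodMk_left) hgm]
    simp only [Pi.mul_apply, hLg]
    rw [lintegral_output hm (G := fun s o => pw w s o / p s o * F (w, g s o)) hLF]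
    refine lintegral_congr fun s => lintegral_congr fun o => ?_
    change _ = pw w s o / p s o * F (w, g s o) * p s o
    rw [mul_right_comm, ENNReal.div_mul_cancel (hp0 s o) (hpt s o), mul_comm]
  have hac : (Q.map fun ω => (ω.1.1, g ω.2.1 (m ω.1 ω.2.1 + ω.2.2))) ≪ prodLaw := by
    rw [hwd]; exact withDensity_absolutelyContinuous _ _
  rw [InformationTheory.toReal_klDiv_of_measure_eq hac (by simp)]
  have hllr : llr (Q.map fun ω => (ω.1.1, g ω.2.1 (m ω.1 ω.2.1 + ω.2.2))) prodLaw
      =ᵐ[Q.map fun ω => (ω.1.1, g ω.2.1 (m ω.1 ω.2.1 + ω.2.2))]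
        fun x => Real.log (L x).toReal := by
    refine hac.ae_le ?_
    have h := Measure.rnDeriv_withDensity prodLaw hL
    rw [← hwd] at h
    filter_upwards [h] with x hx
    rw [llr, hx]
  rw [integral_congr_ae hllr,
    integral_map hjm.aemeasurable hL.ennreal_toReal.log.aestronglyMeasurable]
  have hlog : ∀ ω : (Fin M × V) × S × (ι → ℂ),
      Real.log (L (ω.1.1, g ω.2.1 (m ω.1 ω.2.1 + ω.2.2))).toReal =
        logDensityMessage σ m ω - Real.log (p ω.2.1 (m ω.1 ω.2.1 + ω.2.2)).toReal := fun ω => by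
    rw [hLg, log_toReal_div (hpw0 _ _ _) (hpwt _ _ _) (hp0 _ _) (hpt _ _)]
    rfl
  simp_rw [hlog]
  rw [integral_sub (integrable_logDensityMessage hm hint) hint', integral_logDensityMessage hm hint]
  rfl

end InformationBounds
end MISOWiretap

namespace MISOWiretap

section SumIndices

variable {ι₁ ι₂ : Type*} [Fintype ι₁] [Fintype ι₂]

@[fun_prop]
lemma measurable_sumElim {X : Type*} [MeasurableSpace X] {f : X → ι₁ → ℂ} {g : X → ι₂ → ℂ}
    (hf : Measurable f) (hg : Measurable g) : Measurable fun x => Sum.elim (f x) (g x) := by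
  refine measurable_pi_iff.2 ?_
  rintro (i | i)
  · exact (measurable_pi_apply i).comp hf
  · exact (measurable_pi_apply i).comp hg

lemma lintegral_sum_pi {F : (ι₁ ⊕ ι₂ → ℂ) → ℝ≥0∞} (hF : Measurable F) :
    ∫⁻ o, F o = ∫⁻ a, ∫⁻ b, F (Sum.elim a b) := by
  rw [← (volume_measurePreserving_sumPiEquivProdPi_symm fun _ : ι₁ ⊕ ι₂ => ℂ).lintegral_comp hF,
    Measure.volume_eq_prod, lintegral_prod _ (by fun_prop)]
  rfl

lemma noiseDensity_sum (c o : ι₁ ⊕ ι₂ → ℂ) :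
    noiseDensity c o = noiseDensity (c ∘ Sum.inl) (o ∘ Sum.inl) *
      noiseDensity (c ∘ Sum.inr) (o ∘ Sum.inr) := by
  simp [noiseDensity, Fintype.prod_sum_type]

lemma measurePreserving_noiseLaw_sum :
    MeasurePreserving (fun e : ι₁ ⊕ ι₂ → ℂ => (e ∘ Sum.inl, e ∘ Sum.inr)) (noiseLaw (ι₁ ⊕ ι₂))
      ((noiseLaw ι₁).prod (noiseLaw ι₂)) :=
  measurePreserving_sumPiEquivProdPi fun _ : ι₁ ⊕ ι₂ => stdComplexGaussian

lemma measurePreserving_noiseLaw_sumElim :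
    MeasurePreserving (fun e : (ι₁ → ℂ) × (ι₂ → ℂ) => Sum.elim e.1 e.2)
      ((noiseLaw ι₁).prod (noiseLaw ι₂)) (noiseLaw (ι₁ ⊕ ι₂)) := by
  have h := measurePreserving_sumPiEquivProdPi_symm fun _ : ι₁ ⊕ ι₂ => stdComplexGaussian
  convert h using 1
  funext e i
  cases i <;> rfl

lemma measurePreserving_noiseLaw_inl :
    MeasurePreserving (fun e : ι₁ ⊕ ι₂ → ℂ => e ∘ Sum.inl) (noiseLaw (ι₁ ⊕ ι₂)) (noiseLaw ι₁) :=
  measurePreserving_fst.comp measurePreserving_noiseLaw_sum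

lemma measurePreserving_noiseLaw_inr :
    MeasurePreserving (fun e : ι₁ ⊕ ι₂ → ℂ => e ∘ Sum.inr) (noiseLaw (ι₁ ⊕ ι₂)) (noiseLaw ι₂) :=
  measurePreserving_snd.comp measurePreserving_noiseLaw_sum

end SumIndices

section Pair

variable {Θ S ι₁ ι₂ : Type*} [MeasurableSpace Θ] [MeasurableSpace S] [Fintype ι₁] [Fintype ι₂]
  {μ : Measure Θ} {κ : Measure S} [IsProbabilityMeasure μ] [IsProbabilityMeasure κ]

/-- The mean outputs of two receivers that cooperate. -/
def pairMean (m₁ : Θ → S → ι₁ → ℂ) (m₂ : Θ → S → ι₂ → ℂ) (θ : Θ) (s : S) : ι₁ ⊕ ι₂ → ℂ :=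
  Sum.elim (m₁ θ s) (m₂ θ s)

variable {m₁ : Θ → S → ι₁ → ℂ} {m₂ : Θ → S → ι₂ → ℂ}

lemma measurable_pairMean (hm₁ : Measurable fun p : Θ × S => m₁ p.1 p.2)
    (hm₂ : Measurable fun p : Θ × S => m₂ p.1 p.2) :
    Measurable fun p : Θ × S => pairMean m₁ m₂ p.1 p.2 := measurable_sumElim hm₁ hm₂

lemma mixDensity_pairMean_le (s : S) (o : ι₁ ⊕ ι₂ → ℂ) :
    mixDensity μ (pairMean m₁ m₂) s o ≤ mixDensity μ m₁ s (o ∘ Sum.inl) := by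
  refine lintegral_mono fun θ => ?_
  rw [noiseDensity_sum]
  exact mul_le_of_le_one_right' (noiseDensity_le_one _ _)

lemma measurePreserving_channelLaw_noise {ι ι' : Type*} [Fintype ι] [Fintype ι']
    {f : (ι → ℂ) → (ι' → ℂ)} (hf : MeasurePreserving f (noiseLaw ι) (noiseLaw ι')) :
    MeasurePreserving (fun ω : Θ × S × (ι → ℂ) => (ω.1, ω.2.1, f ω.2.2))
      (channelLaw μ κ ι) (channelLaw μ κ ι') :=
  (MeasurePreserving.id μ).prod ((MeasurePreserving.id κ).prod hf)

/-- The logarithm of the density of the outputs of all receivers is at most the one of the outputs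
of the first receiver. -/
lemma negEntropy_pairMean_le (hm₁ : Measurable fun p : Θ × S => m₁ p.1 p.2)
    (hm₂ : Measurable fun p : Θ × S => m₂ p.1 p.2)
    (hint : Integrable (fun ω => Real.log (mixDensity μ (pairMean m₁ m₂) ω.2.1
      (pairMean m₁ m₂ ω.1 ω.2.1 + ω.2.2)).toReal) (channelLaw μ κ (ι₁ ⊕ ι₂)))
    (hint₁ : Integrable (fun ω => Real.log (mixDensity μ m₁ ω.2.1
      (m₁ ω.1 ω.2.1 + ω.2.2)).toReal) (channelLaw μ κ ι₁)) :
    negEntropy μ κ (pairMean m₁ m₂) ≤ negEntropy μ κ m₁ := by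
  have h1 : MeasurePreserving _ (channelLaw μ κ (ι₁ ⊕ ι₂)) (channelLaw μ κ ι₁) :=
    measurePreserving_channelLaw_noise (μ := μ) (κ := κ) measurePreserving_noiseLaw_inl
  unfold negEntropy
  rw [← h1.map_eq, integral_map h1.measurable.aemeasurable
    (measurable_mixDensity_output hm₁).ennreal_toReal.log.aestronglyMeasurable]
  refine integral_mono hint (h1.integrable_comp_of_integrable hint₁) fun ω => ?_
  exact log_toReal_mono (mixDensity_ne_zero (measurable_pairMean hm₁ hm₂) _ _)
    (mixDensity_pairMean_le _ _) (mixDensity_ne_top _ _)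

/-- The order of the receivers is immaterial. -/
lemma negEntropy_pairMean_swap (hm₁ : Measurable fun p : Θ × S => m₁ p.1 p.2)
    (hm₂ : Measurable fun p : Θ × S => m₂ p.1 p.2) :
    negEntropy μ κ (pairMean m₁ m₂) = negEntropy μ κ (pairMean m₂ m₁) := by
  have h0 : MeasurePreserving (fun e : ι₁ ⊕ ι₂ → ℂ => Sum.elim (e ∘ Sum.inr) (e ∘ Sum.inl))
      (noiseLaw (ι₁ ⊕ ι₂)) (noiseLaw (ι₂ ⊕ ι₁)) :=
    measurePreserving_noiseLaw_sumElim.comp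
      (Measure.measurePreserving_swap.comp measurePreserving_noiseLaw_sum)
  have h1 : MeasurePreserving _ (channelLaw μ κ (ι₁ ⊕ ι₂)) (channelLaw μ κ (ι₂ ⊕ ι₁)) :=
    measurePreserving_channelLaw_noise (μ := μ) (κ := κ) h0
  unfold negEntropy
  rw [← h1.map_eq, integral_map h1.measurable.aemeasurable
    (measurable_mixDensity_output
      (measurable_pairMean hm₂ hm₁)).ennreal_toReal.log.aestronglyMeasurable]
  refine integral_congr_ae (ae_of_all _ fun ω => ?_)
  simp only
  congr 2
  refine lintegral_congr fun θ => ?_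
  rw [noiseDensity_sum, noiseDensity_sum, mul_comm]
  rfl

end Pair

section Copy

variable {Θ A : Type*} [MeasurableSpace Θ] [MeasurableSpace A] {n : ℕ}
  {μ : Measure Θ} {ν : Measure A} [IsProbabilityMeasure μ] [IsProbabilityMeasure ν]
  {m m' : Θ → (Fin n → A) → Fin n → ℂ}

/-- The joint density of the first `k` outputs. -/
noncomputable def prefixDensity (μ : Measure Θ) (m : Θ → (Fin n → A) → Fin n → ℂ) (k : ℕ)
    (s : Fin n → A) (o : Fin n → ℂ) : ℝ≥0∞ :=
  ∫⁻ θ, ∏ i : Fin n with i.val < k, gaussDensity 1 (m θ s i) (o i) ∂μ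

lemma prefixDensity_zero (s : Fin n → A) (o : Fin n → ℂ) : prefixDensity μ m 0 s o = 1 := by
  simp [prefixDensity]

lemma prefixDensity_top (s : Fin n → A) (o : Fin n → ℂ) :
    prefixDensity μ m n s o = mixDensity μ m s o := by
  simp [prefixDensity, mixDensity, noiseDensity]

lemma prefixDensity_le_one (k : ℕ) (s : Fin n → A) (o : Fin n → ℂ) :
    prefixDensity μ m k s o ≤ 1 := by
  calc prefixDensity μ m k s o ≤ ∫⁻ _, 1 ∂μ :=
        lintegral_mono fun _ => Finset.prod_le_one' fun _ _ => gaussDensity_le_one le_rfl _ _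
    _ = 1 := by simp

lemma prefixDensity_ne_top (k : ℕ) (s : Fin n → A) (o : Fin n → ℂ) :
    prefixDensity μ m k s o ≠ ∞ := ne_top_of_le_ne_top ENNReal.one_ne_top (prefixDensity_le_one k s o)

lemma mixDensity_le_prefixDensity (k : ℕ) (s : Fin n → A) (o : Fin n → ℂ) :
    mixDensity μ m s o ≤ prefixDensity μ m k s o := by
  refine lintegral_mono fun θ => ?_
  exact Finset.prod_le_prod_of_subset_of_le_one' (Finset.filter_subset _ _)
    fun _ _ _ => gaussDensity_le_one le_rfl _ _

lemma prefixDensity_ne_zero (hm : Measurable fun p : Θ × (Fin n → A) => m p.1 p.2) (k : ℕ)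
    (s : Fin n → A) (o : Fin n → ℂ) : prefixDensity μ m k s o ≠ 0 :=
  ((mixDensity_ne_zero hm s o).bot_lt.trans_le (mixDensity_le_prefixDensity k s o)).ne'

lemma measurable_prefixDensity (hm : Measurable fun p : Θ × (Fin n → A) => m p.1 p.2) (k : ℕ) :
    Measurable fun p : (Fin n → A) × (Fin n → ℂ) => prefixDensity μ m k p.1 p.2 := by
  unfold prefixDensity
  have h1 : Measurable fun p : ((Fin n → A) × (Fin n → ℂ)) × Θ => m p.2 p.1.1 :=
    measurable_comp₂ hm (by fun_prop) (by fun_prop)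
  exact Measurable.lintegral_prod_right' (ν := μ) (f := fun p : ((Fin n → A) × (Fin n → ℂ)) × Θ =>
    ∏ i : Fin n with i.val < k, gaussDensity 1 (m p.2 p.1.1 i) (p.1.2 i)) (by fun_prop)

/-- Mean outputs at a time that depend on the states up to that time only. -/
def IsCausal (m : Θ → (Fin n → A) → Fin n → ℂ) : Prop :=
  ∀ θ s s' t, (∀ i ≤ t, s i = s' i) → m θ s t = m θ s' t

lemma prefixDensity_congr (hc : IsCausal m) {k : ℕ} {s s' : Fin n → A} {o o' : Fin n → ℂ}
    (hs : ∀ i : Fin n, i.val < k → s i = s' i) (ho : ∀ i : Fin n, i.val < k → o i = o' i) :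
    prefixDensity μ m k s o = prefixDensity μ m k s' o' := by
  refine lintegral_congr fun θ => Finset.prod_congr rfl fun i hi => ?_
  have hi' : i.val < k := (Finset.mem_filter.1 hi).2
  rw [ho i hi', hc θ s s' i fun j hj => hs j (lt_of_le_of_lt hj hi')]

lemma lintegral_prefixDensity_update (hm : Measurable fun p : Θ × (Fin n → A) => m p.1 p.2)
    (hc : IsCausal m) (t : Fin n) (s : Fin n → A) (a : A) (o : Fin n → ℂ) :
    ∫⁻ z, prefixDensity μ m (t + 1) (Function.update s t a) (Function.update o t z) =
      prefixDensity μ m t s o := by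
  have hfilter : (Finset.univ.filter fun i : Fin n => i.val < t.val + 1) =
      insert t (Finset.univ.filter fun i : Fin n => i.val < t.val) := by
    ext i; simp [Fin.ext_iff]; omega
  have h1 : ∀ θ z, ∏ i : Fin n with i.val < t.val + 1,
      gaussDensity 1 (m θ (Function.update s t a) i) (Function.update o t z i) =
      gaussDensity 1 (m θ (Function.update s t a) t) z *
        ∏ i : Fin n with i.val < t.val, gaussDensity 1 (m θ s i) (o i) := by
    intro θ z
    rw [hfilter, Finset.prod_insert (by simp), Function.update_self]
    congr 1
    refine Finset.prod_congr rfl fun i hi => ?_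
    have hi' : i < t := by simpa using hi
    rw [Function.update_of_ne hi'.ne, hc θ _ s i fun j hj => Function.update_of_ne (hj.trans_lt hi').ne _ _]
  unfold prefixDensity
  simp_rw [h1]
  have hms : ∀ s, Measurable fun θ => m θ s := fun s =>
    measurable_comp₂ hm (by fun_prop) (by fun_prop)
  have hmsi : ∀ s i, Measurable fun θ => m θ s i := fun s i => (measurable_pi_apply i).comp (hms s)
  rw [lintegral_lintegral_swap]
  · refine lintegral_congr fun θ => ?_
    rw [lintegral_mul_const _ (by fun_prop), lintegral_gaussDensity one_pos, one_mul]
  · have h2 : ∀ s i, Measurable fun p : ℂ × Θ => m p.2 s i := fun s i =>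
      (hmsi s i).comp measurable_snd
    exact ((measurable_gaussDensity measurable_const (h2 _ _) measurable_fst).mul
      (Finset.measurable_prod _ fun i _ =>
        measurable_gaussDensity measurable_const (h2 _ _) measurable_const)).aemeasurable

lemma integrable_log_prefixDensity (hm : Measurable fun p : Θ × (Fin n → A) => m p.1 p.2)
    {κ : Measure (Fin n → A)} (k : ℕ)
    (hint : Integrable (fun ω => Real.log (mixDensity μ m ω.2.1
      (m ω.1 ω.2.1 + ω.2.2)).toReal) (channelLaw μ κ (Fin n))) :
    Integrable (fun ω => Real.log (prefixDensity μ m k ω.2.1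
      (m ω.1 ω.2.1 + ω.2.2)).toReal) (channelLaw μ κ (Fin n)) := by
  have h1 : Measurable fun ω : Θ × (Fin n → A) × (Fin n → ℂ) => m ω.1 ω.2.1 :=
    measurable_comp₂ hm (by fun_prop) (by fun_prop)
  refine hint.mono (measurable_comp₂ (measurable_prefixDensity hm k) (by fun_prop)
    (by fun_prop)).ennreal_toReal.log.aestronglyMeasurable (ae_of_all _ fun ω => ?_)
  rw [Real.norm_eq_abs, Real.norm_eq_abs, abs_of_nonpos (log_toReal_nonpos (prefixDensity_le_one _ _ _)),
    abs_of_nonpos (log_toReal_nonpos (mixDensity_le_one _ _))]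
  exact neg_le_neg (log_toReal_mono (mixDensity_ne_zero hm _ _)
    (mixDensity_le_prefixDensity _ _ _) (prefixDensity_ne_top _ _ _))

/-- The mean outputs of a receiver, of a copy of it with independent states that are used one time
at a time, and of another receiver. -/
def copyMean (m m' : Θ → (Fin n → A) → Fin n → ℂ) (θ : Θ) (s : (Fin n → A) × (Fin n → A)) :
    Fin n ⊕ (Fin n ⊕ Fin n) → ℂ :=
  Sum.elim (m θ s.1)
    (Sum.elim (fun t => m θ (Function.update s.1 t (s.2 t)) t) (m' θ s.1))

lemma measurable_update_copy (t : Fin n) {X B : Type*} [MeasurableSpace X] [MeasurableSpace B]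
    {f : X → Fin n → B} {g : X → B} (hf : Measurable f) (hg : Measurable g) :
    Measurable fun x => Function.update (f x) t (g x) := by
  refine measurable_pi_iff.2 fun i => ?_
  by_cases h : i = t
  · subst h; simpa using hg
  · simpa [Function.update_of_ne h] using (show Measurable fun x => f x i by fun_prop)

lemma measurable_copyMean (hm : Measurable fun p : Θ × (Fin n → A) => m p.1 p.2)
    (hm' : Measurable fun p : Θ × (Fin n → A) => m' p.1 p.2) :
    Measurable fun p : Θ × ((Fin n → A) × (Fin n → A)) => copyMean m m' p.1 p.2 := by
  refine measurable_sumElim (measurable_comp₂ hm (by fun_prop) (by fun_prop))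
    (measurable_sumElim (measurable_pi_iff.2 fun t => ?_)
      (measurable_comp₂ hm' (by fun_prop) (by fun_prop)))
  exact (measurable_pi_apply t).comp
    (measurable_comp₂ hm (by fun_prop) (measurable_update_copy t (by fun_prop) (by fun_prop)))

/-- The law of input data, states, copied states, and noises. -/
noncomputable abbrev copyLaw (μ : Measure Θ) (ν : Measure A) (n : ℕ) :
    Measure (Θ × ((Fin n → A) × (Fin n → A)) × (Fin n ⊕ (Fin n ⊕ Fin n) → ℂ)) :=
  channelLaw μ ((Measure.pi fun _ => ν).prod (Measure.pi fun _ => ν)) (Fin n ⊕ (Fin n ⊕ Fin n))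

lemma measurePreserving_copyLaw {ι : Type*} [Fintype ι]
    {f : (Fin n ⊕ (Fin n ⊕ Fin n) → ℂ) → ι → ℂ}
    (hf : MeasurePreserving f (noiseLaw _) (noiseLaw ι)) :
    MeasurePreserving (fun ω : Θ × ((Fin n → A) × (Fin n → A)) × (Fin n ⊕ (Fin n ⊕ Fin n) → ℂ) =>
      (ω.1, ω.2.1.1, f ω.2.2)) (copyLaw μ ν n) (channelLaw μ (Measure.pi fun _ => ν) ι) :=
  (MeasurePreserving.id μ).prod (measurePreserving_fst.prod hf)

lemma measurePreserving_copyLaw_update (t : Fin n) :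
    MeasurePreserving (fun ω : Θ × ((Fin n → A) × (Fin n → A)) × (Fin n ⊕ (Fin n ⊕ Fin n) → ℂ) =>
      (ω.1, Function.update ω.2.1.1 t (ω.2.1.2 t),
        Function.update (ω.2.2 ∘ Sum.inl) t (ω.2.2 (Sum.inr (Sum.inl t)))))
      (copyLaw μ ν n) (channelLaw μ (Measure.pi fun _ => ν) (Fin n)) := by
  have h1 : MeasurePreserving (fun e : Fin n ⊕ (Fin n ⊕ Fin n) → ℂ =>
      (e ∘ Sum.inl, (e ∘ Sum.inr) ∘ Sum.inl)) (noiseLaw _) ((noiseLaw (Fin n)).prod (noiseLaw _)) :=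
    ((MeasurePreserving.id _).prod measurePreserving_noiseLaw_inl).comp
      measurePreserving_noiseLaw_sum
  exact (MeasurePreserving.id μ).prod ((measurePreserving_update_copy ν t).prod
    ((measurePreserving_update_copy stdComplexGaussian t).comp h1))

lemma mixDensity_copyMean_le (s : (Fin n → A) × (Fin n → A)) (o : Fin n ⊕ (Fin n ⊕ Fin n) → ℂ) :
    mixDensity μ (copyMean m m') s o ≤ mixDensity μ (pairMean m m') s.1
      (Sum.elim (o ∘ Sum.inl) ((o ∘ Sum.inr) ∘ Sum.inr)) := by
  refine lintegral_mono fun θ => ?_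
  rw [noiseDensity_sum, noiseDensity_sum, noiseDensity_sum]
  exact mul_le_mul_right (mul_le_of_le_one_left' (noiseDensity_le_one _ _)) _

/-- If the other receiver's output can be predicted, with density `q`, from the output of a receiver
and of its copy, then the joint entropy of both receivers is at most twice the entropy of
the receiver plus the prediction loss. -/
lemma copy_le_negEntropy (hm : Measurable fun p : Θ × (Fin n → A) => m p.1 p.2)
    (hm' : Measurable fun p : Θ × (Fin n → A) => m' p.1 p.2) (hc : IsCausal m)
    {q : Fin n → (A × A) × (ℂ × ℂ) → ℂ → ℝ≥0∞}
    (hq : ∀ t, Measurable fun p : ((A × A) × (ℂ × ℂ)) × ℂ => q t p.1 p.2)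
    (hq1 : ∀ t c, ∫⁻ y, q t c y ≤ 1) (hq0 : ∀ t c y, q t c y ≠ 0) (hqt : ∀ t c y, q t c y ≠ ∞)
    (hqint : ∀ t, Integrable (fun ω => Real.log (q t ((ω.2.1.1 t, ω.2.1.2 t),
      ((copyMean m m' ω.1 ω.2.1 + ω.2.2) (Sum.inl t),
        (copyMean m m' ω.1 ω.2.1 + ω.2.2) (Sum.inr (Sum.inl t))))
      ((copyMean m m' ω.1 ω.2.1 + ω.2.2) (Sum.inr (Sum.inr t)))).toReal) (copyLaw μ ν n))
    (hint : Integrable (fun ω => Real.log (mixDensity μ m ω.2.1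
      (m ω.1 ω.2.1 + ω.2.2)).toReal) (channelLaw μ (Measure.pi fun _ => ν) (Fin n)))
    (hint' : Integrable (fun ω => Real.log (mixDensity μ (pairMean m m') ω.2.1
      (pairMean m m' ω.1 ω.2.1 + ω.2.2)).toReal)
      (channelLaw μ (Measure.pi fun _ => ν) (Fin n ⊕ Fin n))) :
    2 * negEntropy μ (Measure.pi fun _ => ν) m +
      ∑ t, ∫ ω, Real.log (q t ((ω.2.1.1 t, ω.2.1.2 t),
        ((copyMean m m' ω.1 ω.2.1 + ω.2.2) (Sum.inl t),
          (copyMean m m' ω.1 ω.2.1 + ω.2.2) (Sum.inr (Sum.inl t))))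
        ((copyMean m m' ω.1 ω.2.1 + ω.2.2) (Sum.inr (Sum.inr t)))).toReal ∂(copyLaw μ ν n) ≤
      negEntropy μ (Measure.pi fun _ => ν) (pairMean m m') := by
  let Qf : Fin n → (Fin n → A) × (Fin n → A) → (Fin n ⊕ (Fin n ⊕ Fin n) → ℂ) → ℝ≥0∞ :=
    fun t s o => q t ((s.1 t, s.2 t), (o (Sum.inl t), o (Sum.inr (Sum.inl t))))
      (o (Sum.inr (Sum.inr t)))
  let U : Fin n → (Fin n → A) × (Fin n → A) → (Fin n ⊕ (Fin n ⊕ Fin n) → ℂ) → ℝ≥0∞ :=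
    fun t s o => prefixDensity μ m (t + 1) (Function.update s.1 t (s.2 t))
      (Function.update (o ∘ Sum.inl) t (o (Sum.inr (Sum.inl t))))
  let D : Fin n → (Fin n → A) × (Fin n → A) → (Fin n ⊕ (Fin n ⊕ Fin n) → ℂ) → ℝ≥0∞ :=
    fun t s o => prefixDensity μ m t s.1 (o ∘ Sum.inl)
  let C : (Fin n → A) × (Fin n → A) → (Fin n ⊕ (Fin n ⊕ Fin n) → ℂ) → ℝ≥0∞ :=
    fun s o => mixDensity μ m s.1 (o ∘ Sum.inl)
  let B : (Fin n → A) × (Fin n → A) → (Fin n ⊕ (Fin n ⊕ Fin n) → ℂ) → ℝ≥0∞ :=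
    fun s o => mixDensity μ (pairMean m m') s.1 (Sum.elim (o ∘ Sum.inl) ((o ∘ Sum.inr) ∘ Sum.inr))
  let G : (Fin n → A) × (Fin n → A) → (Fin n ⊕ (Fin n ⊕ Fin n) → ℂ) → ℝ≥0∞ :=
    fun s o => (∏ t, Qf t s o) * (C s o * ∏ t, U t s o / D t s o)
  have hinl : Measurable fun o : Fin n ⊕ (Fin n ⊕ Fin n) → ℂ => o ∘ Sum.inl :=
    measurePreserving_noiseLaw_inl.measurable
  have hinr : Measurable fun o : Fin n ⊕ (Fin n ⊕ Fin n) → ℂ => o ∘ Sum.inr :=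
    measurePreserving_noiseLaw_inr.measurable
  have hinrr : Measurable fun o : Fin n ⊕ Fin n → ℂ => o ∘ Sum.inr :=
    measurePreserving_noiseLaw_inr.measurable
  have hpm := measurable_pairMean hm hm'
  have hcm := measurable_copyMean hm hm'
  have hQm : ∀ t, Measurable fun p : ((Fin n → A) × (Fin n → A)) × _ => Qf t p.1 p.2 := fun t =>
    measurable_comp₂ (hq t) (by fun_prop) (by fun_prop)
  have hUm : ∀ t, Measurable fun p : ((Fin n → A) × (Fin n → A)) × _ => U t p.1 p.2 := fun t =>
    measurable_comp₂ (measurable_prefixDensity hm (t + 1))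
      (measurable_update_copy t (by fun_prop) (by fun_prop))
      (measurable_update_copy t (by fun_prop) (by fun_prop))
  have hDm : ∀ t, Measurable fun p : ((Fin n → A) × (Fin n → A)) × _ => D t p.1 p.2 := fun t =>
    measurable_comp₂ (measurable_prefixDensity hm t) (by fun_prop) (by fun_prop)
  have hCm : Measurable fun p : ((Fin n → A) × (Fin n → A)) × _ => C p.1 p.2 :=
    measurable_comp₂ (measurable_mixDensity hm) (by fun_prop) (by fun_prop)
  have hBm : Measurable fun p : ((Fin n → A) × (Fin n → A)) × _ => B p.1 p.2 :=
    measurable_comp₂ (measurable_mixDensity hpm) (by fun_prop) (by fun_prop)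
  have hGm : Measurable fun p : ((Fin n → A) × (Fin n → A)) × _ => G p.1 p.2 :=
    (Finset.measurable_prod _ fun t _ => hQm t).mul
      (hCm.mul (Finset.measurable_prod _ fun t _ => (hUm t).div (hDm t)))
  have hQ0 : ∀ t s o, Qf t s o ≠ 0 := fun t s o => hq0 _ _ _
  have hQt : ∀ t s o, Qf t s o ≠ ∞ := fun t s o => hqt _ _ _
  have hU0 : ∀ t s o, U t s o ≠ 0 := fun t s o => prefixDensity_ne_zero hm _ _ _
  have hUt : ∀ t s o, U t s o ≠ ∞ := fun t s o => prefixDensity_ne_top _ _ _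
  have hD0 : ∀ t s o, D t s o ≠ 0 := fun t s o => prefixDensity_ne_zero hm _ _ _
  have hDt : ∀ t s o, D t s o ≠ ∞ := fun t s o => prefixDensity_ne_top _ _ _
  have hUD0 : ∀ t s o, U t s o / D t s o ≠ 0 := fun t s o =>
    ENNReal.div_ne_zero.2 ⟨hU0 _ _ _, hDt _ _ _⟩
  have hUDt : ∀ t s o, U t s o / D t s o ≠ ∞ := fun t s o =>
    ENNReal.div_ne_top (hUt _ _ _) (hD0 _ _ _)
  have hC0 : ∀ s o, C s o ≠ 0 := fun s o => mixDensity_ne_zero hm _ _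
  have hCt : ∀ s o, C s o ≠ ∞ := fun s o => mixDensity_ne_top _ _
  have hB0 : ∀ s o, B s o ≠ 0 := fun s o => mixDensity_ne_zero hpm _ _
  have hBt : ∀ s o, B s o ≠ ∞ := fun s o => mixDensity_ne_top _ _
  have hprodQ0 : ∀ s o, ∏ t, Qf t s o ≠ 0 := fun s o =>
    Finset.prod_ne_zero_iff.2 fun t _ => hQ0 t s o
  have hprodQt : ∀ s o, ∏ t, Qf t s o ≠ ∞ := fun s o =>
    ENNReal.prod_ne_top fun t _ => hQt t s o
  have hprodU0 : ∀ s o, ∏ t, U t s o / D t s o ≠ 0 := fun s o =>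
    Finset.prod_ne_zero_iff.2 fun t _ => hUD0 t s o
  have hprodUt : ∀ s o, ∏ t, U t s o / D t s o ≠ ∞ := fun s o =>
    ENNReal.prod_ne_top fun t _ => hUDt t s o
  have hG0 : ∀ s o, G s o ≠ 0 := fun s o =>
    mul_ne_zero (hprodQ0 s o) (mul_ne_zero (hC0 s o) (hprodU0 s o))
  have hGt : ∀ s o, G s o ≠ ∞ := fun s o =>
    ENNReal.mul_ne_top (hprodQt s o) (ENNReal.mul_ne_top (hCt s o) (hprodUt s o))
  have hGint : ∀ s, ∫⁻ o, G s o ≤ ∫⁻ z, mixDensity μ m s.1 z := by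
    intro s
    have hGs : Measurable (G s) := hGm.comp measurable_prodMk_left
    rw [lintegral_sum_pi hGs]
    refine lintegral_mono fun z => ?_
    have hGz : Measurable fun b : Fin n ⊕ Fin n → ℂ => G s (Sum.elim z b) :=
      hGs.comp (measurable_sumElim measurable_const measurable_id)
    rw [lintegral_sum_pi hGz]
    let u : Fin n → ℂ → ℝ≥0∞ := fun t v =>
      prefixDensity μ m (t + 1) (Function.update s.1 t (s.2 t)) (Function.update z t v) /
        prefixDensity μ m t s.1 z
    have hu' : ∀ t : Fin n, Measurable fun v => prefixDensity μ m (t + 1)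
        (Function.update s.1 t (s.2 t)) (Function.update z t v) := fun t =>
      measurable_comp₂ (measurable_prefixDensity hm (t + 1)) measurable_const
        (measurable_update_copy t measurable_const measurable_id)
    have hu : ∀ t, Measurable (u t) := fun t => (hu' t).div measurable_const
    have hu1 : ∀ t, ∫⁻ v, u t v = 1 := fun t => by
      simp only [u, ENNReal.div_eq_inv_mul]
      rw [lintegral_const_mul _ (hu' t), lintegral_prefixDensity_update hm hc]
      exact ENNReal.inv_mul_cancel (prefixDensity_ne_zero hm _ _ _) (prefixDensity_ne_top _ _ _)
    have h1 : ∀ z', ∫⁻ y, G s (Sum.elim z (Sum.elim z' y)) ≤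
        mixDensity μ m s.1 z * ∏ t, u t (z' t) := by
      intro z'
      change ∫⁻ y : Fin n → ℂ, (∏ t, q t ((s.1 t, s.2 t), (z t, z' t)) (y t)) *
        (mixDensity μ m s.1 z * ∏ t, u t (z' t)) ≤ _
      have hqt : ∀ t, Measurable fun y => q t ((s.1 t, s.2 t), (z t, z' t)) y := fun t =>
        (hq t).comp measurable_prodMk_left
      have hprod : Measurable fun y : Fin n → ℂ => ∏ t, q t ((s.1 t, s.2 t), (z t, z' t)) (y t) :=
        Finset.measurable_prod _ fun t _ => (hqt t).comp (measurable_pi_apply t)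
      rw [lintegral_mul_const _ hprod, volume_pi, lintegral_pi_prod _ hqt]
      exact mul_le_of_le_one_left' (Finset.prod_le_one' fun t _ => hq1 t _)
    calc ∫⁻ z', ∫⁻ y, G s (Sum.elim z (Sum.elim z' y))
        ≤ ∫⁻ z' : Fin n → ℂ, mixDensity μ m s.1 z * ∏ t, u t (z' t) := lintegral_mono h1
      _ = mixDensity μ m s.1 z := by
          have hprod : Measurable fun z' : Fin n → ℂ => ∏ t, u t (z' t) :=
            Finset.measurable_prod _ fun t _ => (hu t).comp (measurable_pi_apply t)
          rw [lintegral_const_mul _ hprod, volume_pi, lintegral_pi_prod _ hu]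
          simp [hu1]
  let out : Θ × ((Fin n → A) × (Fin n → A)) × (Fin n ⊕ (Fin n ⊕ Fin n) → ℂ) →
      (Fin n ⊕ (Fin n ⊕ Fin n) → ℂ) := fun ω => copyMean m m' ω.1 ω.2.1 + ω.2.2
  have hout : Measurable out := by
    have h1 : Measurable fun ω : Θ × ((Fin n → A) × (Fin n → A)) ×
        (Fin n ⊕ (Fin n ⊕ Fin n) → ℂ) => copyMean m m' ω.1 ω.2.1 :=
      measurable_comp₂ hcm (by fun_prop) (by fun_prop)
    simp only [out]
    fun_prop
  have hle : ∫⁻ ω, G ω.2.1 (out ω) / B ω.2.1 (out ω) ∂(copyLaw μ ν n) ≤ 1 := by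
    rw [lintegral_output hcm (G := fun s o => G s o / B s o) (hGm.div hBm)]
    have h1 : ∀ s o, G s o / B s o * mixDensity μ (copyMean m m') s o ≤ G s o := fun s o =>
      (mul_le_mul_right (mixDensity_copyMean_le s o) _).trans
        (ENNReal.div_mul_cancel (hB0 s o) (hBt s o)).le
    have hmarg : Measurable fun s => ∫⁻ z, mixDensity μ m s z :=
      (measurable_mixDensity hm).lintegral_prod_right'
    calc _ ≤ ∫⁻ s : (Fin n → A) × (Fin n → A), (∫⁻ z, mixDensity μ m s.1 z)
            ∂((Measure.pi fun _ => ν).prod (Measure.pi fun _ => ν)) :=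
          lintegral_mono fun s => (lintegral_mono (h1 s)).trans (hGint s)
      _ = ∫⁻ s, (∫⁻ z, mixDensity μ m s z) ∂(Measure.pi fun _ => ν) :=
          (measurePreserving_fst (ν := Measure.pi fun _ : Fin n => ν)).lintegral_comp hmarg
      _ ≤ 1 := (lintegral_mixDensity hm).le
  have hmp1 := measurePreserving_copyLaw (μ := μ) (ν := ν) (n := n)
    (f := fun e => e ∘ Sum.inl) measurePreserving_noiseLaw_inl
  have hmp2 := measurePreserving_copyLaw (μ := μ) (ν := ν) (n := n)
    (f := fun e => Sum.elim (e ∘ Sum.inl) ((e ∘ Sum.inr) ∘ Sum.inr))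
    (measurePreserving_noiseLaw_sumElim.comp
      (((MeasurePreserving.id _).prod measurePreserving_noiseLaw_inr).comp
        measurePreserving_noiseLaw_sum))
  have hCint : Integrable (fun ω => Real.log (C ω.2.1 (out ω)).toReal) (copyLaw μ ν n) :=
    hmp1.integrable_comp_of_integrable hint
  have hCval : ∫ ω, Real.log (C ω.2.1 (out ω)).toReal ∂(copyLaw μ ν n) =
      negEntropy μ (Measure.pi fun _ => ν) m := by
    unfold negEntropy
    rw [← hmp1.map_eq, integral_map hmp1.measurable.aemeasurable
      (measurable_mixDensity_output hm).ennreal_toReal.log.aestronglyMeasurable]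
    rfl
  have hBeq : ∀ ω, B ω.2.1 (out ω) = mixDensity μ (pairMean m m') ω.2.1.1
      (pairMean m m' ω.1 ω.2.1.1 +
        Sum.elim (ω.2.2 ∘ Sum.inl) ((ω.2.2 ∘ Sum.inr) ∘ Sum.inr)) := fun ω => by
    simp only [B]
    congr 1
    funext i
    cases i <;> rfl
  have hBint : Integrable (fun ω => Real.log (B ω.2.1 (out ω)).toReal) (copyLaw μ ν n) := by
    simp_rw [hBeq]
    exact hmp2.integrable_comp_of_integrable hint'
  have hBval : ∫ ω, Real.log (B ω.2.1 (out ω)).toReal ∂(copyLaw μ ν n) =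
      negEntropy μ (Measure.pi fun _ => ν) (pairMean m m') := by
    simp_rw [hBeq]
    unfold negEntropy
    rw [← hmp2.map_eq, integral_map hmp2.measurable.aemeasurable
      (measurable_mixDensity_output hpm).ennreal_toReal.log.aestronglyMeasurable]
  have hpre : ∀ k, Measurable fun ω : Θ × (Fin n → A) × (Fin n → ℂ) =>
      prefixDensity μ m k ω.2.1 (m ω.1 ω.2.1 + ω.2.2) := fun k => by
    have h1 : Measurable fun ω : Θ × (Fin n → A) × (Fin n → ℂ) => m ω.1 ω.2.1 :=
      measurable_comp₂ hm (by fun_prop) (by fun_prop)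
    exact measurable_comp₂ (measurable_prefixDensity hm k) (by fun_prop) (by fun_prop)
  let L : ℕ → ℝ := fun k => ∫ ω, Real.log (prefixDensity μ m k ω.2.1
    (m ω.1 ω.2.1 + ω.2.2)).toReal ∂(channelLaw μ (Measure.pi fun _ => ν) (Fin n))
  have hDint : ∀ t, Integrable (fun ω => Real.log (D t ω.2.1 (out ω)).toReal) (copyLaw μ ν n) :=
    fun t => hmp1.integrable_comp_of_integrable (integrable_log_prefixDensity hm t hint)
  have hDval : ∀ t, ∫ ω, Real.log (D t ω.2.1 (out ω)).toReal ∂(copyLaw μ ν n) = L t := fun t => by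
    simp only [L]
    rw [← hmp1.map_eq, integral_map hmp1.measurable.aemeasurable
      (hpre t).ennreal_toReal.log.aestronglyMeasurable]
    rfl
  have hUeq : ∀ t ω, U t ω.2.1 (out ω) = prefixDensity μ m (t + 1)
      (Function.update ω.2.1.1 t (ω.2.1.2 t))
      (m ω.1 (Function.update ω.2.1.1 t (ω.2.1.2 t)) +
        Function.update (ω.2.2 ∘ Sum.inl) t (ω.2.2 (Sum.inr (Sum.inl t)))) := fun t ω => by
    refine prefixDensity_congr hc (fun _ _ => rfl) fun i hi => ?_
    by_cases h : i = t
    · subst h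
      simp [out, copyMean]
    · have hit : i < t := lt_of_le_of_ne (Nat.lt_succ_iff.1 hi) h
      simp only [Function.update_of_ne h, Pi.add_apply, Function.comp_apply, out, copyMean,
        Sum.elim_inl]
      rw [hc ω.1 (Function.update ω.2.1.1 t (ω.2.1.2 t)) ω.2.1.1 i fun j hj =>
        Function.update_of_ne (hj.trans_lt hit).ne _ _]
  have hUint : ∀ t, Integrable (fun ω => Real.log (U t ω.2.1 (out ω)).toReal) (copyLaw μ ν n) :=
    fun t => by
    simp_rw [hUeq]
    exact (measurePreserving_copyLaw_update t).integrable_comp_of_integrable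
      (integrable_log_prefixDensity hm (t + 1) hint)
  have hUval : ∀ t : Fin n, ∫ ω, Real.log (U t ω.2.1 (out ω)).toReal ∂(copyLaw μ ν n) = L (t + 1) :=
    fun t => by
    simp_rw [hUeq]
    have h1 := measurePreserving_copyLaw_update (μ := μ) (ν := ν) t
    simp only [L]
    rw [← h1.map_eq, integral_map h1.measurable.aemeasurable
      (hpre _).ennreal_toReal.log.aestronglyMeasurable]
  have htel : ∑ t : Fin n, (L (t + 1) - L t) = negEntropy μ (Measure.pi fun _ => ν) m := by
    rw [Fin.sum_univ_eq_sum_range (fun k => L (k + 1) - L k), Finset.sum_range_sub]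
    simp [L, prefixDensity_zero, prefixDensity_top, negEntropy]
  have hGlog : ∀ ω, Real.log (G ω.2.1 (out ω)).toReal =
      (∑ t, Real.log (Qf t ω.2.1 (out ω)).toReal) + (Real.log (C ω.2.1 (out ω)).toReal +
        ∑ t, (Real.log (U t ω.2.1 (out ω)).toReal - Real.log (D t ω.2.1 (out ω)).toReal)) :=
    fun ω => by
    simp only [G]
    rw [log_toReal_mul (hprodQ0 _ _) (hprodQt _ _) (mul_ne_zero (hC0 _ _) (hprodU0 _ _))
      (ENNReal.mul_ne_top (hCt _ _) (hprodUt _ _)), log_toReal_mul (hC0 _ _) (hCt _ _)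
      (hprodU0 _ _) (hprodUt _ _), log_toReal_prod _ (fun t => hQ0 t _ _) fun t => hQt t _ _,
      log_toReal_prod _ (fun t => hUD0 t _ _) fun t => hUDt t _ _]
    simp_rw [log_toReal_div (hU0 _ _ _) (hUt _ _ _) (hD0 _ _ _) (hDt _ _ _)]
  have hUDint : ∀ t ∈ Finset.univ, Integrable (fun ω => Real.log (U t ω.2.1 (out ω)).toReal -
      Real.log (D t ω.2.1 (out ω)).toReal) (copyLaw μ ν n) := fun t _ => (hUint t).sub (hDint t)
  have hQint' : ∀ t ∈ Finset.univ, Integrable (fun ω => Real.log (Qf t ω.2.1 (out ω)).toReal)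
      (copyLaw μ ν n) := fun t _ => hqint t
  have hsum1 := integrable_finsetSum _ hQint'
  have hsum2 := integrable_finsetSum _ hUDint
  have hsum3 : Integrable (fun ω => Real.log (C ω.2.1 (out ω)).toReal +
      ∑ t, (Real.log (U t ω.2.1 (out ω)).toReal - Real.log (D t ω.2.1 (out ω)).toReal))
      (copyLaw μ ν n) := hCint.add hsum2
  have hGval : ∫ ω, Real.log (G ω.2.1 (out ω)).toReal ∂(copyLaw μ ν n) =
      (∑ t, ∫ ω, Real.log (Qf t ω.2.1 (out ω)).toReal ∂(copyLaw μ ν n)) +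
        (negEntropy μ (Measure.pi fun _ => ν) m + negEntropy μ (Measure.pi fun _ => ν) m) := by
    simp_rw [hGlog]
    rw [integral_add hsum1 hsum3, integral_add hCint hsum2,
      integral_finsetSum _ hQint', integral_finsetSum _ hUDint, hCval]
    congr 2
    rw [← htel]
    refine Finset.sum_congr rfl fun t _ => ?_
    rw [integral_sub (hUint t) (hDint t), hUval, hDval]
  have hmain := integral_log_le_of_ratio (P := copyLaw μ ν n)
    (measurable_comp₂ hBm (by fun_prop) hout) (measurable_comp₂ hGm (by fun_prop) hout)
    (fun ω => hB0 _ _) (fun ω => hBt _ _) (fun ω => hG0 _ _) (fun ω => hGt _ _) hle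
    (by simp_rw [hGlog]; exact hsum1.add hsum3) hBint
  rw [hGval, hBval] at hmain
  simp only [Qf, out] at hmain
  linarith

end Copy
end MISOWiretap

namespace MISOWiretap

lemma integral_comp_measurePreserving {X Y : Type*} [MeasurableSpace X] [MeasurableSpace Y]
    {μ : Measure X} {ν : Measure Y} {f : X → Y} (hf : MeasurePreserving f μ ν) {g : Y → ℝ}
    (hg : AEStronglyMeasurable g ν) : ∫ x, g (f x) ∂μ = ∫ y, g y ∂ν := by
  have h := integral_map (φ := f) hf.measurable.aemeasurable (f := g) (by rwa [hf.map_eq])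
  rw [← h, hf.map_eq]

section Power

/-- Squared Euclidean norm as a real number. -/
noncomputable def realSqNorm (x : Vec) : ℝ := ∑ i, ‖x i‖ ^ 2

lemma realSqNorm_nonneg (x : Vec) : 0 ≤ realSqNorm x := Finset.sum_nonneg fun _ _ => sq_nonneg _

@[fun_prop]
lemma measurable_realSqNorm : Measurable realSqNorm := by
  unfold realSqNorm
  fun_prop

lemma sqNorm_eq_ofReal (x : Vec) : sqNorm x = ENNReal.ofReal (realSqNorm x) := by
  unfold sqNorm realSqNorm
  rw [ENNReal.ofReal_sum_of_nonneg fun _ _ => sq_nonneg _]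
  refine Finset.sum_congr rfl fun i _ => ?_
  rw [ENNReal.ofReal_pow (norm_nonneg _), ofReal_norm]

lemma norm_dotProduct_sq_le (u x : Vec) : ‖u ⬝ᵥ x‖ ^ 2 ≤ realSqNorm u * realSqNorm x := by
  have h1 : ‖u ⬝ᵥ x‖ ≤ ∑ i, ‖u i‖ * ‖x i‖ := by
    refine (norm_sum_le _ _).trans (Finset.sum_le_sum fun i _ => ?_)
    rw [norm_mul]
  calc ‖u ⬝ᵥ x‖ ^ 2 ≤ (∑ i, ‖u i‖ * ‖x i‖) ^ 2 := pow_le_pow_left₀ (norm_nonneg _) h1 2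
    _ ≤ _ := Finset.sum_mul_sq_le_sq_mul_sq _ _ _

/-- The noise power. -/
noncomputable def noisePower : ℝ := ∫ z, ‖z‖ ^ 2 ∂stdComplexGaussian

lemma norm_add_sq_le (a b : ℂ) : ‖a + b‖ ^ 2 ≤ 2 * (‖a‖ ^ 2 + ‖b‖ ^ 2) := by
  have h1 := pow_le_pow_left₀ (norm_nonneg _) (norm_add_le a b) 2
  nlinarith [sq_nonneg (‖a‖ - ‖b‖)]

variable {Θ S ι : Type*} [MeasurableSpace Θ] [MeasurableSpace S] [Fintype ι]
  {μ : Measure Θ} {κ : Measure S} [IsProbabilityMeasure μ] [IsProbabilityMeasure κ]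

lemma measurePreserving_noise_eval (i : ι) :
    MeasurePreserving (fun ω : Θ × S × (ι → ℂ) => ω.2.2 i) (channelLaw μ κ ι)
      stdComplexGaussian :=
  (measurePreserving_eval (fun _ : ι => stdComplexGaussian) i).comp
    (measurePreserving_snd.comp measurePreserving_snd)

lemma measurePreserving_input_state :
    MeasurePreserving (fun ω : Θ × S × (ι → ℂ) => (ω.1, ω.2.1)) (channelLaw μ κ ι)
      (μ.prod κ) :=
  (MeasurePreserving.id μ).prod measurePreserving_fst

lemma integrable_noise_sq (i : ι) :
    Integrable (fun ω : Θ × S × (ι → ℂ) => ‖ω.2.2 i‖ ^ 2) (channelLaw μ κ ι) :=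
  (measurePreserving_noise_eval i).integrable_comp_of_integrable
    integrable_norm_sq_stdComplexGaussian

lemma integral_noise_sq (i : ι) :
    ∫ ω, ‖ω.2.2 i‖ ^ 2 ∂(channelLaw μ κ ι) = noisePower :=
  integral_comp_measurePreserving (measurePreserving_noise_eval i)
    integrable_norm_sq_stdComplexGaussian.1

/-- The entropy of outputs of bounded power is at most the one of Gaussian outputs. -/
lemma gaussian_le_negEntropy {m : Θ → S → ι → ℂ} (hm : Measurable fun p : Θ × S => m p.1 p.2)
    {c : ι → ℝ} (hc : ∀ i, 1 ≤ c i) {g : ι → Θ × S → ℝ}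
    (hg : ∀ i, Integrable (g i) (μ.prod κ))
    (hmg : ∀ i θ s, ‖m θ s i‖ ^ 2 ≤ c i * g i (θ, s)) :
    Integrable (fun ω => Real.log (mixDensity μ m ω.2.1 (m ω.1 ω.2.1 + ω.2.2)).toReal)
      (channelLaw μ κ ι) ∧
    -∑ i, (Real.log Real.pi + Real.log (c i) + 2 * ∫ p, g i p ∂(μ.prod κ) + 2 * noisePower) ≤
      negEntropy μ κ m := by
  have hc0 : ∀ i, 0 < c i := fun i => one_pos.trans_le (hc i)
  let q : S → (ι → ℂ) → ℝ≥0∞ := fun _ o => ∏ i, gaussDensity (c i) 0 (o i)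
  have hq : Measurable fun p : S × (ι → ℂ) => q p.1 p.2 := by
    simp only [q]; fun_prop
  have hq1 : ∀ s, ∫⁻ o, q s o ≤ 1 := fun s => by
    simp only [q]
    rw [volume_pi, lintegral_pi_prod (fun _ : ι => (volume : Measure ℂ)) fun i => by fun_prop]
    simp [lintegral_gaussDensity (hc0 _)]
  have hq0 : ∀ s o, q s o ≠ 0 := fun s o =>
    Finset.prod_ne_zero_iff.2 fun i _ => (gaussDensity_pos (hc0 i) _ _).ne'
  have hqt : ∀ s o, q s o ≠ ∞ := fun s o => ENNReal.prod_ne_top fun i _ => gaussDensity_ne_top _ _ _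
  let B : Θ × S × (ι → ℂ) → ℝ := fun ω =>
    ∑ i, (Real.log Real.pi + Real.log (c i) + 2 * g i (ω.1, ω.2.1) + 2 * ‖ω.2.2 i‖ ^ 2)
  have hgi : ∀ i, Integrable (fun ω : Θ × S × (ι → ℂ) => g i (ω.1, ω.2.1)) (channelLaw μ κ ι) :=
    fun i => measurePreserving_input_state.integrable_comp_of_integrable (hg i)
  have hgv : ∀ i, ∫ ω, g i (ω.1, ω.2.1) ∂(channelLaw μ κ ι) = ∫ p, g i p ∂(μ.prod κ) := fun i =>
    integral_comp_measurePreserving measurePreserving_input_state (hg i).1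
  have hBi : ∀ i ∈ Finset.univ, Integrable (fun ω : Θ × S × (ι → ℂ) => Real.log Real.pi +
      Real.log (c i) + 2 * g i (ω.1, ω.2.1) + 2 * ‖ω.2.2 i‖ ^ 2) (channelLaw μ κ ι) := fun i _ =>
    ((integrable_const _).add ((hgi i).const_mul 2)).add ((integrable_noise_sq i).const_mul 2)
  have hBint : Integrable B (channelLaw μ κ ι) := integrable_finsetSum _ hBi
  have hBval : ∫ ω, B ω ∂(channelLaw μ κ ι) =
      ∑ i, (Real.log Real.pi + Real.log (c i) + 2 * ∫ p, g i p ∂(μ.prod κ) + 2 * noisePower) := by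
    simp only [B]
    rw [integral_finsetSum _ hBi]
    refine Finset.sum_congr rfl fun i _ => ?_
    have h1 : Integrable (fun ω : Θ × S × (ι → ℂ) => Real.log Real.pi +
      Real.log (c i) + 2 * g i (ω.1, ω.2.1)) (channelLaw μ κ ι) :=
      (integrable_const _).add ((hgi i).const_mul 2)
    rw [integral_add h1 ((integrable_noise_sq i).const_mul 2),
      integral_add (integrable_const _) ((hgi i).const_mul 2), integral_const_mul,
      integral_const_mul, hgv, integral_noise_sq]
    simp
  have hlog : ∀ ω : Θ × S × (ι → ℂ), Real.log (q ω.2.1 (m ω.1 ω.2.1 + ω.2.2)).toReal =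
      -∑ i, (Real.log Real.pi + Real.log (c i) +
        ‖(m ω.1 ω.2.1 + ω.2.2) i - 0‖ ^ 2 / c i) := fun ω => by
    rw [log_toReal_prod _ (fun i => (gaussDensity_pos (hc0 i) _ _).ne')
      fun i => gaussDensity_ne_top _ _ _, ← Finset.sum_neg_distrib]
    exact Finset.sum_congr rfl fun i _ => log_gaussDensity (hc0 i) _ _
  have hle : ∀ ω, -B ω ≤ Real.log (q ω.2.1 (m ω.1 ω.2.1 + ω.2.2)).toReal := fun ω => by
    rw [hlog]
    refine neg_le_neg (Finset.sum_le_sum fun i _ => ?_)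
    have h1 : ‖(m ω.1 ω.2.1 + ω.2.2) i - 0‖ ^ 2 / c i ≤
        2 * g i (ω.1, ω.2.1) + 2 * ‖ω.2.2 i‖ ^ 2 := by
      rw [div_le_iff₀ (hc0 i), sub_zero, Pi.add_apply]
      have h2 := norm_add_sq_le (m ω.1 ω.2.1 i) (ω.2.2 i)
      have h3 := hmg i ω.1 ω.2.1
      nlinarith [sq_nonneg ‖ω.2.2 i‖, hc i]
    linarith
  have hnonpos : ∀ ω : Θ × S × (ι → ℂ), Real.log (q ω.2.1 (m ω.1 ω.2.1 + ω.2.2)).toReal ≤ 0 := fun ω =>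
    log_toReal_nonpos (Finset.prod_le_one' fun i _ => gaussDensity_le_one (hc i) _ _)
  have hmm : Measurable fun ω : Θ × S × (ι → ℂ) => m ω.1 ω.2.1 :=
    measurable_comp₂ hm (by fun_prop) (by fun_prop)
  have hqm : Measurable fun ω : Θ × S × (ι → ℂ) => q ω.2.1 (m ω.1 ω.2.1 + ω.2.2) := by
    simp only [q]
    fun_prop
  have hint : Integrable (fun ω => Real.log (q ω.2.1 (m ω.1 ω.2.1 + ω.2.2)).toReal)
      (channelLaw μ κ ι) :=
    hBint.mono' hqm.ennreal_toReal.log.aestronglyMeasurable (ae_of_all _ fun ω => by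
      rw [Real.norm_eq_abs, abs_of_nonpos (hnonpos ω)]
      linarith [hle ω])
  obtain ⟨h1, h2⟩ := crossEntropy_le_negEntropy hm hq hq1 hq0 hqt hint
  refine ⟨h1, ?_⟩
  rw [← hBval, ← integral_neg]
  exact (integral_mono hBint.neg hint hle).trans h2

end Power

section Link

variable {Θ : Type*} [MeasurableSpace Θ] {n : ℕ} {μ : Measure Θ} {ν : Measure ChannelState}
  [IsProbabilityMeasure μ] [IsProbabilityMeasure ν]

/-- The mean output over links with gains `c`, channel vectors `u`, and inputs `x`. -/
noncomputable def linkMean (c : Fin n → ℝ) (u : ChannelState → Vec)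
    (x : Θ → (Fin n → ChannelState) → Fin n → Vec) (θ : Θ) (s : Fin n → ChannelState)
    (t : Fin n) : ℂ :=
  (Real.sqrt (c t) : ℂ) * (u (s t) ⬝ᵥ x θ s t)

/-- Inputs that depend on past states only. -/
def IsStrictlyCausal (x : Θ → (Fin n → ChannelState) → Fin n → Vec) : Prop :=
  ∀ θ s s' t, (∀ i < t, s i = s' i) → x θ s t = x θ s' t

variable {c : Fin n → ℝ} {u v : ChannelState → Vec}
  {x : Θ → (Fin n → ChannelState) → Fin n → Vec}

lemma isCausal_linkMean (hx : IsStrictlyCausal x) : IsCausal (linkMean c u x) :=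
  fun θ s s' t h => by
    unfold linkMean
    rw [h t le_rfl, hx θ s s' t fun i hi => h i hi.le]

lemma measurable_linkMean (hu : Measurable u)
    (hx : Measurable fun p : Θ × (Fin n → ChannelState) => x p.1 p.2) :
    Measurable fun p : Θ × (Fin n → ChannelState) => linkMean c u x p.1 p.2 := by
  refine measurable_pi_iff.2 fun t => ?_
  unfold linkMean dotProduct
  have h1 : ∀ i, Measurable fun p : Θ × (Fin n → ChannelState) => u (p.2 t) i := fun i =>
    (measurable_pi_apply i).comp (hu.comp (by fun_prop))
  have h2 : ∀ i, Measurable fun p : Θ × (Fin n → ChannelState) => x p.1 p.2 t i := fun i =>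
    (measurable_pi_apply i).comp ((measurable_pi_apply t).comp hx)
  exact measurable_const.mul (Finset.measurable_sum _ fun i _ => (h1 i).mul (h2 i))

lemma norm_linkMean_sq_le {t : Fin n} (hc : 0 ≤ c t) (θ : Θ) (s : Fin n → ChannelState) :
    ‖linkMean c u x θ s t‖ ^ 2 ≤ c t * (realSqNorm (u (s t)) * realSqNorm (x θ s t)) := by
  unfold linkMean
  rw [norm_mul, mul_pow, Complex.norm_real, Real.norm_eq_abs, sq_abs, Real.sq_sqrt hc]
  exact mul_le_mul_of_nonneg_left (norm_dotProduct_sq_le _ _) hc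

lemma measurePreserving_input_update (t : Fin n) :
    MeasurePreserving (fun p : (Θ × (Fin n → ChannelState)) × (Fin n → ChannelState) =>
      (p.1.1, Function.update p.1.2 t (p.2 t)))
      ((μ.prod (Measure.pi fun _ => ν)).prod (Measure.pi fun _ => ν))
      (μ.prod (Measure.pi fun _ => ν)) :=
  ((MeasurePreserving.id μ).prod (measurePreserving_update_copy ν t)).comp
    (measurePreserving_prodAssoc μ (Measure.pi fun _ : Fin n => ν) (Measure.pi fun _ => ν))

/-- The present channel vector and the present input are independent. -/
lemma received_power (hu : Measurable u)
    (hx : Measurable fun p : Θ × (Fin n → ChannelState) => x p.1 p.2) (hxc : IsStrictlyCausal x)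
    (huint : Integrable (fun S => realSqNorm (u S)) ν) {t : Fin n}
    (hxint : Integrable (fun p : Θ × (Fin n → ChannelState) => realSqNorm (x p.1 p.2 t))
      (μ.prod (Measure.pi fun _ => ν))) :
    Integrable (fun p : Θ × (Fin n → ChannelState) =>
      realSqNorm (u (p.2 t)) * realSqNorm (x p.1 p.2 t)) (μ.prod (Measure.pi fun _ => ν)) ∧
    ∫ p, realSqNorm (u (p.2 t)) * realSqNorm (x p.1 p.2 t) ∂(μ.prod (Measure.pi fun _ => ν)) =
      (∫ S, realSqNorm (u S) ∂ν) *
        ∫ p, realSqNorm (x p.1 p.2 t) ∂(μ.prod (Measure.pi fun _ => ν)) := by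
  have h := measurePreserving_input_update (μ := μ) (ν := ν) t
  have h1 : ∀ p : (Θ × (Fin n → ChannelState)) × (Fin n → ChannelState),
      realSqNorm (u (Function.update p.1.2 t (p.2 t) t)) *
        realSqNorm (x p.1.1 (Function.update p.1.2 t (p.2 t)) t) =
      realSqNorm (x p.1.1 p.1.2 t) * realSqNorm (u (p.2 t)) := fun p => by
    rw [Function.update_self, mul_comm, hxc p.1.1 (Function.update p.1.2 t (p.2 t)) p.1.2 t
      fun i hi => Function.update_of_ne hi.ne _ _]
  have hmeas : Measurable fun p : Θ × (Fin n → ChannelState) =>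
      realSqNorm (u (p.2 t)) * realSqNorm (x p.1 p.2 t) :=
    (measurable_realSqNorm.comp (hu.comp (by fun_prop))).mul
      (measurable_realSqNorm.comp ((measurable_pi_apply t).comp hx))
  have he := measurePreserving_eval (fun _ : Fin n => ν) t
  have hut : Integrable (fun s : Fin n → ChannelState => realSqNorm (u (s t)))
      (Measure.pi fun _ => ν) := he.integrable_comp_of_integrable huint
  have hutv : ∫ s, realSqNorm (u (s t)) ∂(Measure.pi fun _ : Fin n => ν) =
      ∫ S, realSqNorm (u S) ∂ν := integral_comp_measurePreserving he huint.1
  constructor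
  · rw [← h.integrable_comp hmeas.aestronglyMeasurable]
    have h2 := hxint.mul_prod hut
    exact h2.congr (ae_of_all _ fun p => (h1 p).symm)
  · rw [← integral_comp_measurePreserving h hmeas.aestronglyMeasurable]
    simp_rw [h1]
    rw [integral_prod_mul (fun p : Θ × (Fin n → ChannelState) => realSqNorm (x p.1 p.2 t))
      (fun s : Fin n → ChannelState => realSqNorm (u (s t))), hutv, mul_comm]

lemma pairMean_linkMean_power {a b : Fin n → ℝ} (ha : ∀ t, 1 ≤ a t) (hb : ∀ t, 1 ≤ b t)
    (i : Fin n ⊕ Fin n) (θ : Θ) (s : Fin n → ChannelState) :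
    ‖pairMean (linkMean b v x) (linkMean a u x) θ s i‖ ^ 2 ≤ Sum.elim b a i *
      Sum.elim (fun t (p : Θ × (Fin n → ChannelState)) =>
          realSqNorm (v (p.2 t)) * realSqNorm (x p.1 p.2 t))
        (fun t p => realSqNorm (u (p.2 t)) * realSqNorm (x p.1 p.2 t)) i (θ, s) := by
  rcases i with t | t
  · exact norm_linkMean_sq_le (zero_le_one.trans (hb t)) θ s
  · exact norm_linkMean_sq_le (zero_le_one.trans (ha t)) θ s

lemma integrable_log_pairMean_linkMean {a b : Fin n → ℝ} (ha : ∀ t, 1 ≤ a t) (hb : ∀ t, 1 ≤ b t)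
    (hu : Measurable u) (hv : Measurable v)
    (hx : Measurable fun p : Θ × (Fin n → ChannelState) => x p.1 p.2) (hxc : IsStrictlyCausal x)
    (huint : Integrable (fun S => realSqNorm (u S)) ν)
    (hvint : Integrable (fun S => realSqNorm (v S)) ν)
    (hxint : ∀ t, Integrable (fun p : Θ × (Fin n → ChannelState) => realSqNorm (x p.1 p.2 t))
      (μ.prod (Measure.pi fun _ => ν))) :
    Integrable (fun ω => Real.log (mixDensity μ (pairMean (linkMean b v x) (linkMean a u x)) ω.2.1
      (pairMean (linkMean b v x) (linkMean a u x) ω.1 ω.2.1 + ω.2.2)).toReal)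
      (channelLaw μ (Measure.pi fun _ => ν) (Fin n ⊕ Fin n)) := by
  refine (gaussian_le_negEntropy (measurable_pairMean (measurable_linkMean hv hx)
    (measurable_linkMean hu hx)) (c := Sum.elim b a) ?_ ?_
    (pairMean_linkMean_power (u := u) (v := v) (x := x) ha hb)).1
  · rintro (t | t)
    exacts [hb t, ha t]
  · rintro (t | t)
    exacts [(received_power hv hx hxc hvint (hxint t)).1,
      (received_power hu hx hxc huint (hxint t)).1]

lemma integrable_log_linkMean (hc : ∀ t, 1 ≤ c t) (hu : Measurable u)
    (hx : Measurable fun p : Θ × (Fin n → ChannelState) => x p.1 p.2) (hxc : IsStrictlyCausal x)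
    (huint : Integrable (fun S => realSqNorm (u S)) ν)
    (hxint : ∀ t, Integrable (fun p : Θ × (Fin n → ChannelState) => realSqNorm (x p.1 p.2 t))
      (μ.prod (Measure.pi fun _ => ν))) :
    Integrable (fun ω => Real.log (mixDensity μ (linkMean c u x) ω.2.1
      (linkMean c u x ω.1 ω.2.1 + ω.2.2)).toReal)
      (channelLaw μ (Measure.pi fun _ => ν) (Fin n)) :=
  (gaussian_le_negEntropy (measurable_linkMean hu hx) hc
    (fun t => (received_power hu hx hxc huint (hxint t)).1)
    fun t θ s => norm_linkMean_sq_le (zero_le_one.trans (hc t)) θ s).1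

lemma gaussian_le_negEntropy_linkMean (hc : ∀ t, 1 ≤ c t) (hu : Measurable u)
    (hx : Measurable fun p : Θ × (Fin n → ChannelState) => x p.1 p.2) (hxc : IsStrictlyCausal x)
    (huint : Integrable (fun S => realSqNorm (u S)) ν)
    (hxint : ∀ t, Integrable (fun p : Θ × (Fin n → ChannelState) => realSqNorm (x p.1 p.2 t))
      (μ.prod (Measure.pi fun _ => ν))) :
    -∑ t, (Real.log Real.pi + Real.log (c t) + 2 * ((∫ S, realSqNorm (u S) ∂ν) *
      ∫ p, realSqNorm (x p.1 p.2 t) ∂(μ.prod (Measure.pi fun _ => ν))) + 2 * noisePower) ≤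
      negEntropy μ (Measure.pi fun _ => ν) (linkMean c u x) := by
  refine le_of_eq_of_le ?_ (gaussian_le_negEntropy (measurable_linkMean hu hx) hc
    (fun t => (received_power hu hx hxc huint (hxint t)).1)
    fun t θ s => norm_linkMean_sq_le (zero_le_one.trans (hc t)) θ s).2
  simp_rw [(received_power hu hx hxc huint (hxint _)).2]

lemma norm_add_three_sq_le (a b c : ℂ) :
    ‖a + b + c‖ ^ 2 ≤ 3 * (‖a‖ ^ 2 + ‖b‖ ^ 2 + ‖c‖ ^ 2) := by
  have h1 := pow_le_pow_left₀ (norm_nonneg _) (norm_add₃_le (a := a) (b := b) (c := c)) 2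
  nlinarith [sq_nonneg (‖a‖ - ‖b‖), sq_nonneg (‖b‖ - ‖c‖), sq_nonneg (‖a‖ - ‖c‖)]

/-- The channel vector `u` of a receiver is, in good states, a bounded combination of two independent
copies of the channel vector `v` of another receiver. This bounds the joint entropy of both
receivers by the entropy of the other one. -/
lemma combination_le_negEntropy {a b : Fin n → ℝ} (ha : ∀ t, 1 ≤ a t) (hb : ∀ t, 1 ≤ b t)
    (hu : Measurable u) (hv : Measurable v)
    (hx : Measurable fun p : Θ × (Fin n → ChannelState) => x p.1 p.2) (hxc : IsStrictlyCausal x)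
    (huint : Integrable (fun S => realSqNorm (u S)) ν)
    (hvint : Integrable (fun S => realSqNorm (v S)) ν)
    (hxint : ∀ t, Integrable (fun p : Θ × (Fin n → ChannelState) => realSqNorm (x p.1 p.2 t))
      (μ.prod (Measure.pi fun _ => ν)))
    {E : Set (ChannelState × ChannelState)} (hE : MeasurableSet E) {K : ℝ} (hK : 0 ≤ K)
    {k₁ k₂ : ChannelState × ChannelState → ℂ} (hk₁ : Measurable k₁) (hk₂ : Measurable k₂)
    (hEk : ∀ p ∈ E, u p.1 = k₁ p • v p.1 + k₂ p • v p.2)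
    (hEk₁ : ∀ p ∈ E, ‖k₁ p‖ ^ 2 ≤ K) (hEk₂ : ∀ p ∈ E, ‖k₂ p‖ ^ 2 ≤ K) :
    2 * negEntropy μ (Measure.pi fun _ => ν) (linkMean b v x) -
      ∑ t, (Real.log Real.pi + Real.log (1 + a t / b t * K) +
        (ν.prod ν).real Eᶜ * Real.log (a t) + 9 * noisePower +
        2 * ((∫ S, realSqNorm (u S) ∂ν) *
          ∫ p, realSqNorm (x p.1 p.2 t) ∂(μ.prod (Measure.pi fun _ => ν)))) ≤
      negEntropy μ (Measure.pi fun _ => ν) (pairMean (linkMean b v x) (linkMean a u x)) := by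
  classical
  set κ : Measure (Fin n → ChannelState) := Measure.pi fun _ => ν with hκ
  set m := linkMean b v x with hmdef
  set m' := linkMean a u x with hmdef'
  have ha0 : ∀ t, 0 < a t := fun t => one_pos.trans_le (ha t)
  have hb0 : ∀ t, 0 < b t := fun t => one_pos.trans_le (hb t)
  have hr0 : ∀ t, 0 ≤ a t / b t := fun t => (div_pos (ha0 t) (hb0 t)).le
  let V : Fin n → ChannelState × ChannelState → ℝ := fun t p =>
    E.piecewise (fun _ => 1 + a t / b t * K) (fun _ => a t) p
  let c : Fin n → (ChannelState × ChannelState) × (ℂ × ℂ) → ℂ := fun t p =>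
    E.indicator 1 p.1 * ((Real.sqrt (a t / b t) : ℂ) * (k₁ p.1 * p.2.1 + k₂ p.1 * p.2.2))
  have hV : ∀ t, Measurable (V t) := fun t =>
    Measurable.piecewise hE measurable_const measurable_const
  have hcm : ∀ t, Measurable (c t) := fun t => by
    have h1 : Measurable fun p : (ChannelState × ChannelState) × (ℂ × ℂ) =>
        E.indicator (1 : ChannelState × ChannelState → ℂ) p.1 :=
      (measurable_one.indicator hE).comp measurable_fst
    simp only [c]
    fun_prop
  have hV1 : ∀ t p, 1 ≤ V t p := fun t p => by
    simp only [V, Set.piecewise]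
    split_ifs
    · nlinarith [mul_nonneg (hr0 t) hK]
    · exact ha t
  have hV0 : ∀ t p, 0 < V t p := fun t p => one_pos.trans_le (hV1 t p)
  let q : Fin n → (ChannelState × ChannelState) × (ℂ × ℂ) → ℂ → ℝ≥0∞ := fun t p y =>
    gaussDensity (V t p.1) (c t p) y
  have hq : ∀ t, Measurable fun p : ((ChannelState × ChannelState) × (ℂ × ℂ)) × ℂ => q t p.1 p.2 :=
    fun t => measurable_gaussDensity ((hV t).comp (by fun_prop)) ((hcm t).comp (by fun_prop))
      (by fun_prop)
  let B : Fin n → Θ × ((Fin n → ChannelState) × (Fin n → ChannelState)) ×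
      (Fin n ⊕ (Fin n ⊕ Fin n) → ℂ) → ℝ := fun t ω =>
    Real.log Real.pi + Real.log (1 + a t / b t * K) +
      Eᶜ.indicator (fun _ => Real.log (a t)) (ω.2.1.1 t, ω.2.1.2 t) +
      3 * (‖ω.2.2 (Sum.inr (Sum.inr t))‖ ^ 2 + ‖ω.2.2 (Sum.inl t)‖ ^ 2 +
        ‖ω.2.2 (Sum.inr (Sum.inl t))‖ ^ 2) +
      2 * (realSqNorm (u (ω.2.1.1 t)) * realSqNorm (x ω.1 ω.2.1.1 t))
  let F : Fin n → Θ × ((Fin n → ChannelState) × (Fin n → ChannelState)) ×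
      (Fin n ⊕ (Fin n ⊕ Fin n) → ℂ) → ℝ := fun t ω =>
    Real.log (q t ((ω.2.1.1 t, ω.2.1.2 t),
      ((copyMean m m' ω.1 ω.2.1 + ω.2.2) (Sum.inl t),
        (copyMean m m' ω.1 ω.2.1 + ω.2.2) (Sum.inr (Sum.inl t))))
      ((copyMean m m' ω.1 ω.2.1 + ω.2.2) (Sum.inr (Sum.inr t)))).toReal
  have hFB : ∀ t ω, -B t ω ≤ F t ω := by
    intro t ω
    have hxu : x ω.1 (Function.update ω.2.1.1 t (ω.2.1.2 t)) t = x ω.1 ω.2.1.1 t :=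
      hxc _ _ _ t fun i hi => Function.update_of_ne hi.ne _ _
    simp only [F, q, B]
    rw [log_gaussDensity (hV0 _ _)]
    refine neg_le_neg ?_
    set e₁ := ω.2.2 (Sum.inl t)
    set e₂ := ω.2.2 (Sum.inr (Sum.inl t))
    set e₃ := ω.2.2 (Sum.inr (Sum.inr t))
    set X := x ω.1 ω.2.1.1 t with hX
    have hz : (copyMean m m' ω.1 ω.2.1 + ω.2.2) (Sum.inl t) =
        (Real.sqrt (b t) : ℂ) * (v (ω.2.1.1 t) ⬝ᵥ X) + e₁ := rfl
    have hz' : (copyMean m m' ω.1 ω.2.1 + ω.2.2) (Sum.inr (Sum.inl t)) =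
        (Real.sqrt (b t) : ℂ) * (v (ω.2.1.2 t) ⬝ᵥ X) + e₂ := by
      simp [copyMean, hmdef, linkMean, e₂, hxu, hX]
    have hy : (copyMean m m' ω.1 ω.2.1 + ω.2.2) (Sum.inr (Sum.inr t)) =
        (Real.sqrt (a t) : ℂ) * (u (ω.2.1.1 t) ⬝ᵥ X) + e₃ := rfl
    have hg0 : 0 ≤ realSqNorm (u (ω.2.1.1 t)) * realSqNorm X :=
      mul_nonneg (realSqNorm_nonneg _) (realSqNorm_nonneg _)
    rw [hz, hz', hy]
    by_cases hp : (ω.2.1.1 t, ω.2.1.2 t) ∈ E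
    · have hVt : V t (ω.2.1.1 t, ω.2.1.2 t) = 1 + a t / b t * K := Set.piecewise_eq_of_mem _ _ _ hp
      rw [Set.indicator_of_notMem (by simpa using hp), hVt]
      set k := k₁ (ω.2.1.1 t, ω.2.1.2 t) with hk
      set k' := k₂ (ω.2.1.1 t, ω.2.1.2 t) with hk'
      have hsq : (Real.sqrt (a t) : ℂ) = Real.sqrt (a t / b t) * Real.sqrt (b t) := by
        rw [← Complex.ofReal_mul, ← Real.sqrt_mul (hr0 t), div_mul_cancel₀ _ (hb0 t).ne']
      have hres : (Real.sqrt (a t) : ℂ) * (u (ω.2.1.1 t) ⬝ᵥ X) + e₃ -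
          c t ((ω.2.1.1 t, ω.2.1.2 t), ((Real.sqrt (b t) : ℂ) * (v (ω.2.1.1 t) ⬝ᵥ X) + e₁,
            (Real.sqrt (b t) : ℂ) * (v (ω.2.1.2 t) ⬝ᵥ X) + e₂)) =
          e₃ + (-((Real.sqrt (a t / b t) : ℂ) * k * e₁)) +
            (-((Real.sqrt (a t / b t) : ℂ) * k' * e₂)) := by
        simp only [c, Set.indicator_of_mem hp, hsq, ← hk, ← hk']
        have h1 := hEk _ hp
        simp only at h1
        rw [h1, add_dotProduct, smul_dotProduct, smul_dotProduct]
        simp only [smul_eq_mul, Pi.one_apply]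
        ring
      rw [hres]
      have h2 := norm_add_three_sq_le e₃ (-((Real.sqrt (a t / b t) : ℂ) * k * e₁))
        (-((Real.sqrt (a t / b t) : ℂ) * k' * e₂))
      have h3 : ∀ (κ e : ℂ), ‖κ‖ ^ 2 ≤ K → ‖-((Real.sqrt (a t / b t) : ℂ) * κ * e)‖ ^ 2 ≤
          a t / b t * K * ‖e‖ ^ 2 := fun κ e hκ => by
        rw [norm_neg, norm_mul, norm_mul, mul_pow, mul_pow, Complex.norm_real, Real.norm_eq_abs,
          sq_abs, Real.sq_sqrt (hr0 t)]
        gcongr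
        exact hr0 t
      have h4 := h3 k e₁ (hEk₁ _ hp)
      have h5 := h3 k' e₂ (hEk₂ _ hp)
      have h6 : ‖e₃ + (-((Real.sqrt (a t / b t) : ℂ) * k * e₁)) +
            (-((Real.sqrt (a t / b t) : ℂ) * k' * e₂))‖ ^ 2 / (1 + a t / b t * K) ≤
          3 * (‖e₃‖ ^ 2 + ‖e₁‖ ^ 2 + ‖e₂‖ ^ 2) := by
        have hrK := mul_nonneg (hr0 t) hK
        rw [div_le_iff₀ (by linarith)]
        nlinarith [mul_nonneg hrK (sq_nonneg ‖e₃‖), sq_nonneg ‖e₁‖, sq_nonneg ‖e₂‖]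
      linarith
    · have hVt : V t (ω.2.1.1 t, ω.2.1.2 t) = a t := Set.piecewise_eq_of_notMem _ _ _ hp
      rw [Set.indicator_of_mem (by simpa using hp), hVt]
      have hct : c t ((ω.2.1.1 t, ω.2.1.2 t), ((Real.sqrt (b t) : ℂ) * (v (ω.2.1.1 t) ⬝ᵥ X) + e₁,
            (Real.sqrt (b t) : ℂ) * (v (ω.2.1.2 t) ⬝ᵥ X) + e₂)) = 0 := by
        simp [c, Set.indicator_of_notMem hp]
      rw [hct, sub_zero]
      have h1 := norm_add_sq_le ((Real.sqrt (a t) : ℂ) * (u (ω.2.1.1 t) ⬝ᵥ X)) e₃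
      have h2 : ‖(Real.sqrt (a t) : ℂ) * (u (ω.2.1.1 t) ⬝ᵥ X)‖ ^ 2 ≤
          a t * (realSqNorm (u (ω.2.1.1 t)) * realSqNorm X) :=
        norm_linkMean_sq_le (u := u) (x := x) (ha0 t).le ω.1 ω.2.1.1
      have h3 : ‖(Real.sqrt (a t) : ℂ) * (u (ω.2.1.1 t) ⬝ᵥ X) + e₃‖ ^ 2 / a t ≤
          2 * (realSqNorm (u (ω.2.1.1 t)) * realSqNorm X) + 2 * ‖e₃‖ ^ 2 := by
        rw [div_le_iff₀ (ha0 t)]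
        nlinarith [sq_nonneg ‖e₃‖, ha t]
      have h4 : 0 ≤ Real.log (1 + a t / b t * K) :=
        Real.log_nonneg (by linarith [mul_nonneg (hr0 t) hK])
      nlinarith [sq_nonneg ‖e₁‖, sq_nonneg ‖e₂‖, sq_nonneg ‖e₃‖]
  have hF0 : ∀ t ω, F t ω ≤ 0 := fun t ω => log_toReal_nonpos (gaussDensity_le_one (hV1 _ _) _ _)
  have hstates : ∀ t, MeasurePreserving (fun ω : Θ × ((Fin n → ChannelState) ×
      (Fin n → ChannelState)) × (Fin n ⊕ (Fin n ⊕ Fin n) → ℂ) => (ω.2.1.1 t, ω.2.1.2 t))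
      (copyLaw μ ν n) (ν.prod ν) := fun t =>
    ((measurePreserving_eval (fun _ : Fin n => ν) t).prod
      (measurePreserving_eval (fun _ : Fin n => ν) t)).comp
      (measurePreserving_fst.comp measurePreserving_snd)
  have hinput : MeasurePreserving (fun ω : Θ × ((Fin n → ChannelState) ×
      (Fin n → ChannelState)) × (Fin n ⊕ (Fin n ⊕ Fin n) → ℂ) => (ω.1, ω.2.1.1))
      (copyLaw μ ν n) (μ.prod κ) :=
    (MeasurePreserving.id μ).prod (measurePreserving_fst.comp measurePreserving_fst)
  have hI1 : Integrable (Eᶜ.indicator fun _ => (1 : ℝ)) (ν.prod ν) :=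
    (integrable_const _).indicator hE.compl
  have hi1 : ∀ t, Integrable (Eᶜ.indicator fun _ => Real.log (a t)) (ν.prod ν) := fun t =>
    (integrable_const _).indicator hE.compl
  have hi2 : ∀ t, Integrable (fun ω => Eᶜ.indicator (fun _ => Real.log (a t))
      (ω.2.1.1 t, ω.2.1.2 t)) (copyLaw μ ν n) := fun t =>
    (hstates t).integrable_comp_of_integrable (hi1 t)
  have hv2 : ∀ t, ∫ ω, Eᶜ.indicator (fun _ => Real.log (a t)) (ω.2.1.1 t, ω.2.1.2 t)
      ∂(copyLaw μ ν n) = (ν.prod ν).real Eᶜ * Real.log (a t) := fun t => by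
    rw [integral_comp_measurePreserving (hstates t) (hi1 t).1, integral_indicator_const _ hE.compl,
      smul_eq_mul]
  have hi3 : ∀ t, Integrable (fun ω : Θ × ((Fin n → ChannelState) × (Fin n → ChannelState)) ×
      (Fin n ⊕ (Fin n ⊕ Fin n) → ℂ) => ‖ω.2.2 (Sum.inr (Sum.inr t))‖ ^ 2 +
        ‖ω.2.2 (Sum.inl t)‖ ^ 2 + ‖ω.2.2 (Sum.inr (Sum.inl t))‖ ^ 2) (copyLaw μ ν n) := fun t =>
    ((integrable_noise_sq _).add (integrable_noise_sq _)).add (integrable_noise_sq _)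
  have hv3 : ∀ t, ∫ ω, (‖ω.2.2 (Sum.inr (Sum.inr t))‖ ^ 2 +
        ‖ω.2.2 (Sum.inl t)‖ ^ 2 + ‖ω.2.2 (Sum.inr (Sum.inl t))‖ ^ 2) ∂(copyLaw μ ν n) =
      3 * noisePower := fun t => by
    have h1 : Integrable (fun ω : Θ × ((Fin n → ChannelState) × (Fin n → ChannelState)) ×
      (Fin n ⊕ (Fin n ⊕ Fin n) → ℂ) => ‖ω.2.2 (Sum.inr (Sum.inr t))‖ ^ 2 +
        ‖ω.2.2 (Sum.inl t)‖ ^ 2) (copyLaw μ ν n) :=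
      (integrable_noise_sq _).add (integrable_noise_sq _)
    rw [integral_add h1 (integrable_noise_sq _),
      integral_add (integrable_noise_sq _) (integrable_noise_sq _), integral_noise_sq,
      integral_noise_sq, integral_noise_sq]
    ring
  have hi4 : ∀ t, Integrable (fun ω : Θ × ((Fin n → ChannelState) × (Fin n → ChannelState)) ×
      (Fin n ⊕ (Fin n ⊕ Fin n) → ℂ) => realSqNorm (u (ω.2.1.1 t)) * realSqNorm (x ω.1 ω.2.1.1 t))
      (copyLaw μ ν n) := fun t =>
    hinput.integrable_comp_of_integrable (received_power hu hx hxc huint (hxint t)).1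
  have hv4 : ∀ t, ∫ ω, realSqNorm (u (ω.2.1.1 t)) * realSqNorm (x ω.1 ω.2.1.1 t)
      ∂(copyLaw μ ν n) = (∫ S, realSqNorm (u S) ∂ν) *
        ∫ p, realSqNorm (x p.1 p.2 t) ∂(μ.prod κ) := fun t => by
    have h := received_power hu hx hxc huint (hxint t)
    rw [← h.2]
    exact integral_comp_measurePreserving hinput h.1.1
  have hi5 : ∀ t, Integrable (fun ω => Real.log Real.pi + Real.log (1 + a t / b t * K) +
      Eᶜ.indicator (fun _ => Real.log (a t)) (ω.2.1.1 t, ω.2.1.2 t)) (copyLaw μ ν n) := fun t =>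
    (integrable_const _).add (hi2 t)
  have hi6 : ∀ t, Integrable (fun ω => Real.log Real.pi + Real.log (1 + a t / b t * K) +
      Eᶜ.indicator (fun _ => Real.log (a t)) (ω.2.1.1 t, ω.2.1.2 t) +
      3 * (‖ω.2.2 (Sum.inr (Sum.inr t))‖ ^ 2 + ‖ω.2.2 (Sum.inl t)‖ ^ 2 +
        ‖ω.2.2 (Sum.inr (Sum.inl t))‖ ^ 2)) (copyLaw μ ν n) := fun t =>
    (hi5 t).add ((hi3 t).const_mul 3)
  have hBint : ∀ t, Integrable (B t) (copyLaw μ ν n) := fun t =>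
    (hi6 t).add ((hi4 t).const_mul 2)
  have hBval : ∀ t, ∫ ω, B t ω ∂(copyLaw μ ν n) = Real.log Real.pi +
      Real.log (1 + a t / b t * K) + (ν.prod ν).real Eᶜ * Real.log (a t) + 9 * noisePower +
        2 * ((∫ S, realSqNorm (u S) ∂ν) *
          ∫ p, realSqNorm (x p.1 p.2 t) ∂(μ.prod κ)) := fun t => by
    simp only [B]
    rw [integral_add (hi6 t) ((hi4 t).const_mul 2), integral_add (hi5 t) ((hi3 t).const_mul 3),
      integral_add (integrable_const _) (hi2 t), integral_const_mul, integral_const_mul, hv2, hv3,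
      hv4]
    simp
    ring
  have hm := measurable_linkMean (c := b) hv hx
  have hm' := measurable_linkMean (c := a) hu hx
  have hcopy : Measurable fun ω : Θ × ((Fin n → ChannelState) × (Fin n → ChannelState)) ×
      (Fin n ⊕ (Fin n ⊕ Fin n) → ℂ) => copyMean m m' ω.1 ω.2.1 :=
    measurable_comp₂ (measurable_copyMean hm hm') (by fun_prop) (by fun_prop)
  have hFmeas : ∀ t, Measurable (F t) := fun t =>
    (measurable_comp₂ (hq t) (by fun_prop) (by fun_prop)).ennreal_toReal.log
  have hFint : ∀ t, Integrable (F t) (copyLaw μ ν n) := fun t =>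
    (hBint t).mono' (hFmeas t).aestronglyMeasurable (ae_of_all _ fun ω => by
      rw [Real.norm_eq_abs, abs_of_nonpos (hF0 t ω)]
      linarith [hFB t ω])
  have hmain := copy_le_negEntropy (μ := μ) (ν := ν) hm hm' (isCausal_linkMean hxc) hq
    (fun t p => (lintegral_gaussDensity (hV0 t p.1) (c t p)).le)
    (fun t p y => (gaussDensity_pos (hV0 t p.1) (c t p) y).ne')
    (fun t p y => gaussDensity_ne_top _ _ _) hFint
    (integrable_log_linkMean hb hv hx hxc hvint hxint)
    (integrable_log_pairMean_linkMean ha hb hu hv hx hxc huint hvint hxint)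
  have hsum : -∑ t, (Real.log Real.pi + Real.log (1 + a t / b t * K) +
        (ν.prod ν).real Eᶜ * Real.log (a t) + 9 * noisePower +
        2 * ((∫ S, realSqNorm (u S) ∂ν) *
          ∫ p, realSqNorm (x p.1 p.2 t) ∂(μ.prod κ))) ≤ ∑ t, ∫ ω, F t ω ∂(copyLaw μ ν n) := by
    rw [← Finset.sum_neg_distrib]
    refine Finset.sum_le_sum fun t _ => ?_
    rw [← hBval, ← integral_neg]
    exact integral_mono (hBint t).neg (hFint t) (hFB t)
  linarith

end Link
end MISOWiretap

namespace MISOWiretap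

section Converse

variable {M : ℕ} [NeZero M] {V : Type*} [MeasurableSpace V] {σ : Measure V}
  [IsProbabilityMeasure σ] {ν : Measure ChannelState} [IsProbabilityMeasure ν] {n : ℕ}
  {a b : Fin n → ℝ} {x : Fin M × V → (Fin n → ChannelState) → Fin n → Vec}

/-- The combination of Fano's inequality for the legitimate receiver and for both receivers, of the
entropy relations between the receivers, and of the leakage. -/
lemma three_mul_rate_le (ha : ∀ t, 1 ≤ a t) (hb : ∀ t, 1 ≤ b t)
    (hx : Measurable fun p : (Fin M × V) × (Fin n → ChannelState) => x p.1 p.2)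
    (hxc : IsStrictlyCausal x)
    (hint₁ : Integrable (fun S : ChannelState => realSqNorm S.1) ν)
    (hint₂ : Integrable (fun S : ChannelState => realSqNorm S.2) ν)
    (hxw : ∀ w t, Integrable (fun p : V × (Fin n → ChannelState) =>
      realSqNorm (x (w, p.1) p.2 t)) (σ.prod (Measure.pi fun _ => ν)))
    (hxp : ∀ t, ∫ p, realSqNorm (x p.1 p.2 t)
      ∂(((messageLaw M).prod σ).prod (Measure.pi fun _ => ν)) ≤ 1)
    {K : ℝ} (hK : 0 ≤ K)
    {E₁ : Set (ChannelState × ChannelState)} (hE₁ : MeasurableSet E₁)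
    {k₁ l₁ : ChannelState × ChannelState → ℂ} (hk₁ : Measurable k₁) (hl₁ : Measurable l₁)
    (hEk₁ : ∀ p ∈ E₁, p.1.1 = k₁ p • p.1.2 + l₁ p • p.2.2)
    (hkK₁ : ∀ p ∈ E₁, ‖k₁ p‖ ^ 2 ≤ K) (hlK₁ : ∀ p ∈ E₁, ‖l₁ p‖ ^ 2 ≤ K)
    {E₂ : Set (ChannelState × ChannelState)} (hE₂ : MeasurableSet E₂)
    {k₂ l₂ : ChannelState × ChannelState → ℂ} (hk₂ : Measurable k₂) (hl₂ : Measurable l₂)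
    (hEk₂ : ∀ p ∈ E₂, p.1.2 = k₂ p • p.1.1 + l₂ p • p.2.1)
    (hkK₂ : ∀ p ∈ E₂, ‖k₂ p‖ ^ 2 ≤ K) (hlK₂ : ∀ p ∈ E₂, ‖l₂ p‖ ^ 2 ≤ K)
    {d : (Fin n → ChannelState) → (Fin n → ℂ) → Fin M}
    (hd : Measurable fun p : (Fin n → ChannelState) × (Fin n → ℂ) => d p.1 p.2) :
    3 * ((1 - (channelLaw ((messageLaw M).prod σ) (Measure.pi fun _ => ν) (Fin n)).real
      {ω | d ω.2.1 (linkMean a Prod.fst x ω.1 ω.2.1 + ω.2.2) ≠ ω.1.1}) * Real.log M -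
        Real.log 2) ≤
      2 * ((M : ℝ)⁻¹ * ∑ w, negEntropy σ (Measure.pi fun _ => ν)
          (fixMessage (linkMean b Prod.snd x) w) -
        negEntropy ((messageLaw M).prod σ) (Measure.pi fun _ => ν) (linkMean b Prod.snd x)) +
      ∑ t, (2 * Real.log (a t) + Real.log (1 + a t / b t * K) + Real.log (1 + b t / a t * K) +
        (ν.prod ν).real E₁ᶜ * Real.log (a t) + (ν.prod ν).real E₂ᶜ * Real.log (b t) +
        (4 * Real.log Real.pi + 22 * noisePower + 6 * (∫ S : ChannelState, realSqNorm S.1 ∂ν) +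
          2 * ∫ S : ChannelState, realSqNorm S.2 ∂ν)) := by
  have hM : (0 : ℝ) < M := by exact_mod_cast Nat.pos_of_ne_zero (NeZero.ne M)
  set κ : Measure (Fin n → ChannelState) := Measure.pi fun _ => ν with hκ
  set G₁ := ∫ S : ChannelState, realSqNorm S.1 ∂ν with hG₁
  set G₂ := ∫ S : ChannelState, realSqNorm S.2 ∂ν with hG₂
  have hG₁0 : 0 ≤ G₁ := integral_nonneg fun _ => realSqNorm_nonneg _
  have hG₂0 : 0 ≤ G₂ := integral_nonneg fun _ => realSqNorm_nonneg _
  set P := (messageLaw M).prod σ with hP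
  have hf : Measurable (Prod.fst : ChannelState → Vec) := measurable_fst
  have hs : Measurable (Prod.snd : ChannelState → Vec) := measurable_snd
  let xw : Fin M → V → (Fin n → ChannelState) → Fin n → Vec := fun w v => x (w, v)
  have hxwm : ∀ w, Measurable fun p : V × (Fin n → ChannelState) => xw w p.1 p.2 := fun w =>
    measurable_comp₂ (F := x) hx (by fun_prop) (by fun_prop)
  have hxwc : ∀ w, IsStrictlyCausal (xw w) := fun w v => hxc (w, v)
  have hxnm : ∀ t, Measurable fun p : (Fin M × V) × (Fin n → ChannelState) =>
      realSqNorm (x p.1 p.2 t) := fun t =>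
    measurable_realSqNorm.comp ((measurable_pi_apply t).comp hx)
  have hxint : ∀ t, Integrable (fun p : (Fin M × V) × (Fin n → ChannelState) =>
      realSqNorm (x p.1 p.2 t)) (P.prod κ) := fun t =>
    integrable_message_slice (hxnm t) fun w => hxw w t
  have hslice : ∀ t, (M : ℝ)⁻¹ * ∑ w, ∫ p, realSqNorm (xw w p.1 p.2 t) ∂(σ.prod κ) ≤ 1 := fun t =>
    (integral_message_slice (hxint t)).symm.le.trans (hxp t)
  let y := linkMean a Prod.fst x
  let z := linkMean b Prod.snd x
  have hy : Measurable fun p : (Fin M × V) × (Fin n → ChannelState) => y p.1 p.2 :=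
    measurable_linkMean hf hx
  have hz : Measurable fun p : (Fin M × V) × (Fin n → ChannelState) => z p.1 p.2 :=
    measurable_linkMean hs hx
  have hiy := integrable_log_linkMean (μ := P) ha hf hx hxc hint₁ hxint
  have hizy := integrable_log_pairMean_linkMean (μ := P) ha hb hf hs hx hxc hint₁ hint₂ hxint
  have hiyw := fun w => integrable_log_linkMean (μ := σ) ha hf (hxwm w) (hxwc w) hint₁ (hxw w)
  have hizw := fun w => integrable_log_linkMean (μ := σ) hb hs (hxwm w) (hxwc w) hint₂ (hxw w)
  have hizyw := fun w => integrable_log_pairMean_linkMean (μ := σ) ha hb hf hs (hxwm w) (hxwc w)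
    hint₁ hint₂ (hxw w)
  have hfano₁ := fano_le hy hiyw hiy hd
  have hinr : Measurable fun o : Fin n ⊕ Fin n → ℂ => o ∘ Sum.inr :=
    measurePreserving_noiseLaw_inr.measurable
  have hfano₂ := fano_le (measurable_pairMean hz hy) hizyw hizy
    (d := fun s o => d s (o ∘ Sum.inr)) (measurable_comp₂ hd (by fun_prop) (by fun_prop))
  have hyout : Measurable fun ω : (Fin M × V) × (Fin n → ChannelState) × (Fin n → ℂ) =>
      y ω.1 ω.2.1 := measurable_comp₂ hy (by fun_prop) (by fun_prop)
  have hdout : Measurable fun ω : (Fin M × V) × (Fin n → ChannelState) × (Fin n → ℂ) =>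
      d ω.2.1 (y ω.1 ω.2.1 + ω.2.2) := measurable_comp₂ hd (by fun_prop) (by fun_prop)
  have herr : (channelLaw P κ (Fin n ⊕ Fin n)).real
      {ω | d ω.2.1 ((pairMean z y ω.1 ω.2.1 + ω.2.2) ∘ Sum.inr) ≠ ω.1.1} =
      (channelLaw P κ (Fin n)).real {ω | d ω.2.1 (y ω.1 ω.2.1 + ω.2.2) ≠ ω.1.1} := by
    have h := measurePreserving_channelLaw_noise (μ := P) (κ := κ)
      (measurePreserving_noiseLaw_inr (ι₁ := Fin n) (ι₂ := Fin n))
    exact h.measureReal_preimage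
      (s := {ω | d ω.2.1 (y ω.1 ω.2.1 + ω.2.2) ≠ ω.1.1})
      (measurableSet_eq_fun hdout (by fun_prop)).compl.nullMeasurableSet
  rw [herr] at hfano₂
  have hpair : 2 * negEntropy P κ z - _ ≤ negEntropy P κ (pairMean z y) :=
    combination_le_negEntropy (μ := P) ha hb hf hs hx hxc hint₁ hint₂ hxint hE₁ hK hk₁ hl₁ hEk₁
      hkK₁ hlK₁
  have hpairw : ∀ w, 2 * negEntropy σ κ (fixMessage y w) - _ ≤
      negEntropy σ κ (pairMean (fixMessage y w) (fixMessage z w)) := fun w =>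
    combination_le_negEntropy (μ := σ) hb ha hs hf (hxwm w) (hxwc w) hint₂ hint₁ (hxw w) hE₂ hK
      hk₂ hl₂ hEk₂ hkK₂ hlK₂
  have hlew : ∀ w, negEntropy σ κ (fixMessage (pairMean z y) w) ≤ negEntropy σ κ (fixMessage z w) :=
    fun w => negEntropy_pairMean_le (measurable_fixMessage hz w) (measurable_fixMessage hy w)
      (hizyw w) (hizw w)
  have hpairw' : ∀ w, negEntropy σ κ (pairMean (fixMessage y w) (fixMessage z w)) =
      negEntropy σ κ (fixMessage (pairMean z y) w) := fun w =>
    negEntropy_pairMean_swap (measurable_fixMessage hy w) (measurable_fixMessage hz w)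
  have hgauss : -_ ≤ negEntropy P κ y :=
    gaussian_le_negEntropy_linkMean (μ := P) ha hf hx hxc hint₁ hxint
  have havg₁ : (M : ℝ)⁻¹ * ∑ w, negEntropy σ κ (fixMessage (pairMean z y) w) ≤
      (M : ℝ)⁻¹ * ∑ w, negEntropy σ κ (fixMessage z w) :=
    mul_le_mul_of_nonneg_left (Finset.sum_le_sum fun w _ => hlew w) (inv_nonneg.2 hM.le)
  have havg₂ : 2 * ((M : ℝ)⁻¹ * ∑ w, negEntropy σ κ (fixMessage y w)) -
      ∑ t, (Real.log Real.pi + Real.log (1 + b t / a t * K) + (ν.prod ν).real E₂ᶜ * Real.log (b t) +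
        9 * noisePower + 2 * G₂) ≤
      (M : ℝ)⁻¹ * ∑ w, negEntropy σ κ (fixMessage (pairMean z y) w) := by
    have h1 : (M : ℝ)⁻¹ * ∑ w, (2 * negEntropy σ κ (fixMessage y w) -
        ∑ t, (Real.log Real.pi + Real.log (1 + b t / a t * K) +
          (ν.prod ν).real E₂ᶜ * Real.log (b t) + 9 * noisePower +
          2 * (G₂ * ∫ p, realSqNorm (xw w p.1 p.2 t) ∂(σ.prod κ)))) ≤
        (M : ℝ)⁻¹ * ∑ w, negEntropy σ κ (fixMessage (pairMean z y) w) :=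
      mul_le_mul_of_nonneg_left (Finset.sum_le_sum fun w _ => (hpairw w).trans_eq (hpairw' w))
        (inv_nonneg.2 hM.le)
    refine le_trans ?_ h1
    rw [Finset.sum_sub_distrib, ← Finset.mul_sum, Finset.sum_comm, mul_sub, mul_left_comm,
      Finset.mul_sum (a := (M : ℝ)⁻¹) (s := (Finset.univ : Finset (Fin n)))]
    refine sub_le_sub_left (Finset.sum_le_sum fun t _ => ?_) _
    rw [Finset.sum_add_distrib, ← Finset.mul_sum, ← Finset.mul_sum, mul_add]
    have h2 : (M : ℝ)⁻¹ * (2 * (G₂ * ∑ w, ∫ p, realSqNorm (xw w p.1 p.2 t) ∂(σ.prod κ))) =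
        2 * G₂ * ((M : ℝ)⁻¹ * ∑ w, ∫ p, realSqNorm (xw w p.1 p.2 t) ∂(σ.prod κ)) := by ring
    rw [h2, Finset.sum_const, Finset.card_univ, Fintype.card_fin, nsmul_eq_mul,
      inv_mul_cancel_left₀ hM.ne']
    nlinarith [mul_le_mul_of_nonneg_left (hslice t) hG₂0]
  have hpair' : 2 * negEntropy P κ z - ∑ t, (Real.log Real.pi + Real.log (1 + a t / b t * K) +
      (ν.prod ν).real E₁ᶜ * Real.log (a t) + 9 * noisePower + 2 * G₁) ≤
      negEntropy P κ (pairMean z y) := by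
    refine le_trans (sub_le_sub_left (Finset.sum_le_sum fun t _ => ?_) _) hpair
    nlinarith [mul_le_mul_of_nonneg_left (hxp t) hG₁0]
  have hgauss' : -∑ t, (Real.log Real.pi + Real.log (a t) + 2 * G₁ + 2 * noisePower) ≤
      negEntropy P κ y := by
    refine le_trans (neg_le_neg (Finset.sum_le_sum fun t _ => ?_)) hgauss
    nlinarith [mul_le_mul_of_nonneg_left (hxp t) hG₁0]
  have hsum : ∑ t, (2 * Real.log (a t) + Real.log (1 + a t / b t * K) +
        Real.log (1 + b t / a t * K) +
        (ν.prod ν).real E₁ᶜ * Real.log (a t) + (ν.prod ν).real E₂ᶜ * Real.log (b t) +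
        (4 * Real.log Real.pi + 22 * noisePower + 6 * G₁ + 2 * G₂)) =
      2 * ∑ t, (Real.log Real.pi + Real.log (a t) + 2 * G₁ + 2 * noisePower) +
      (∑ t, (Real.log Real.pi + Real.log (1 + a t / b t * K) +
        (ν.prod ν).real E₁ᶜ * Real.log (a t) + 9 * noisePower + 2 * G₁) +
      ∑ t, (Real.log Real.pi + Real.log (1 + b t / a t * K) + (ν.prod ν).real E₂ᶜ * Real.log (b t) +
        9 * noisePower + 2 * G₂)) := by
    rw [Finset.mul_sum, ← Finset.sum_add_distrib, ← Finset.sum_add_distrib]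
    refine Finset.sum_congr rfl fun t _ => ?_
    ring
  rw [hsum]
  linarith

end Converse
end MISOWiretap

namespace MISOWiretap

section Combination

lemma det_ne_zero_of_linearIndependent {x y : Vec} (h : LinearIndependent ℂ ![x, y]) :
    x 0 * y 1 - x 1 * y 0 ≠ 0 := by
  intro hD
  rw [LinearIndependent.pair_iff] at h
  have h1 := h (y 1) (-(x 1)) (by
    funext i
    fin_cases i
    · simp; linear_combination hD
    · simp; ring)
  have h2 := h (y 0) (-(x 0)) (by
    funext i
    fin_cases i
    · simp; ring
    · simp; linear_combination -hD)
  have h3 := h 1 0 (by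
    funext i
    fin_cases i
    · simpa using h2.2
    · simpa using h1.2)
  exact one_ne_zero h3.1

/-- Channel vectors `u` are combinations of two copies of channel vectors `v` with coefficients that
are bounded with high probability. -/
lemma exists_bounded_combination {ν : Measure ChannelState} [IsProbabilityMeasure ν]
    {u v : ChannelState → Vec} (hu : Measurable u) (hv : Measurable v)
    (h : ∀ᵐ p ∂(ν.prod ν), LinearIndependent ℂ ![v p.1, v p.2]) {ε : ℝ} (hε : 0 < ε) :
    ∃ (k l : ChannelState × ChannelState → ℂ) (K₀ : ℝ), Measurable k ∧ Measurable l ∧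
      ∀ K, K₀ ≤ K → ∃ E, MeasurableSet E ∧ (ν.prod ν).real Eᶜ ≤ ε ∧
        (∀ p ∈ E, u p.1 = k p • v p.1 + l p • v p.2) ∧ (∀ p ∈ E, ‖k p‖ ^ 2 ≤ K) ∧
        ∀ p ∈ E, ‖l p‖ ^ 2 ≤ K := by
  let D : ChannelState × ChannelState → ℂ := fun p => v p.1 0 * v p.2 1 - v p.1 1 * v p.2 0
  let k : ChannelState × ChannelState → ℂ := fun p =>
    (u p.1 0 * v p.2 1 - u p.1 1 * v p.2 0) / D p
  let l : ChannelState × ChannelState → ℂ := fun p =>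
    (v p.1 0 * u p.1 1 - v p.1 1 * u p.1 0) / D p
  have hu1 : ∀ i, Measurable fun p : ChannelState × ChannelState => u p.1 i := fun i =>
    (measurable_pi_apply i).comp (hu.comp measurable_fst)
  have hv1 : ∀ i, Measurable fun p : ChannelState × ChannelState => v p.1 i := fun i =>
    (measurable_pi_apply i).comp (hv.comp measurable_fst)
  have hv2 : ∀ i, Measurable fun p : ChannelState × ChannelState => v p.2 i := fun i =>
    (measurable_pi_apply i).comp (hv.comp measurable_snd)
  have hD : Measurable D := ((hv1 0).mul (hv2 1)).sub ((hv1 1).mul (hv2 0))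
  have hk : Measurable k := (((hu1 0).mul (hv2 1)).sub ((hu1 1).mul (hv2 0))).div hD
  have hl : Measurable l := (((hv1 0).mul (hu1 1)).sub ((hv1 1).mul (hu1 0))).div hD
  let E : ℝ → Set (ChannelState × ChannelState) := fun K =>
    {p | D p ≠ 0 ∧ ‖k p‖ ^ 2 ≤ K ∧ ‖l p‖ ^ 2 ≤ K}
  have hE : ∀ K, MeasurableSet (E K) := fun K =>
    (hD (measurableSet_singleton 0)).compl.inter
      ((measurableSet_le (hk.norm.pow_const 2) measurable_const).inter
        (measurableSet_le (hl.norm.pow_const 2) measurable_const))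
  have hmono : Monotone E := fun K K' hKK' p hp =>
    ⟨hp.1, hp.2.1.trans hKK', hp.2.2.trans hKK'⟩
  have hae : (ν.prod ν) (⋂ K, (E K)ᶜ) = 0 := by
    refine measure_mono_null ?_ (ae_iff.1 h)
    intro p hp hli
    rw [Set.mem_iInter] at hp
    refine hp (max (‖k p‖ ^ 2) (‖l p‖ ^ 2))
      ⟨det_ne_zero_of_linearIndependent hli, le_max_left _ _, le_max_right _ _⟩
  have htend : Tendsto (fun K => (ν.prod ν) (E K)ᶜ) atTop (𝓝 0) := by
    rw [← hae]
    exact tendsto_measure_iInter_atTop (fun K => (hE K).compl.nullMeasurableSet)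
      (fun K K' hKK' => Set.compl_subset_compl.2 (hmono hKK')) ⟨0, measure_ne_top _ _⟩
  obtain ⟨K₀, hK₀⟩ := eventually_atTop.1
    (htend.eventually (ge_mem_nhds (show (0 : ℝ≥0∞) < ENNReal.ofReal ε by simpa)))
  refine ⟨k, l, K₀, hk, hl, fun K hK => ⟨E K, hE K, ?_, fun p hp => ?_, fun p hp => hp.2.1,
    fun p hp => hp.2.2⟩⟩
  · exact ENNReal.toReal_le_of_le_ofReal hε.le (hK₀ K hK)
  · have hD0 : v p.1 0 * v p.2 1 - v p.1 1 * v p.2 0 ≠ 0 := hp.1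
    have h0 : ∀ i, u p.1 i = k p * v p.1 i + l p * v p.2 i := by
      intro i
      simp only [k, l, D]
      rw [div_mul_eq_mul_div, div_mul_eq_mul_div, ← add_div, eq_div_iff hD0]
      fin_cases i <;> simp only [Fin.zero_eta, Fin.mk_one] <;> ring
    funext i
    simpa using h0 i

end Combination

namespace Code

variable {n : ℕ} (C : Code n)

instance : NeZero C.size := ⟨C.size_pos.ne'⟩

/-- The law of message and seed. -/
noncomputable abbrev dataLaw : Measure (Fin C.size × C.Seed) := (messageLaw C.size).prod C.seedLaw

/-- The channel inputs as a function of message, seed, and states. -/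
def codeInput (θ : Fin C.size × C.Seed) (s : Fin n → ChannelState) (t : Fin n) : Vec :=
  C.enc t (θ.1, θ.2, fun i => s i)

lemma measurable_codeInput :
    Measurable fun p : (Fin C.size × C.Seed) × (Fin n → ChannelState) => C.codeInput p.1 p.2 := by
  refine measurable_pi_iff.2 fun t => (C.measurable_enc t).comp ?_
  fun_prop

lemma isStrictlyCausal_codeInput : IsStrictlyCausal C.codeInput := fun θ s s' t h => by
  unfold codeInput
  congr 3
  funext i
  exact h i i.2

variable {ν : Measure ChannelState} [IsProbabilityMeasure ν]

lemma measurePreserving_law {ι : Type*} [Fintype ι] {f : (Fin n → ℂ × ℂ) → ι → ℂ}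
    (hf : MeasurePreserving f
      (Measure.pi fun _ => stdComplexGaussian.prod stdComplexGaussian) (noiseLaw ι)) :
    MeasurePreserving (fun ω : C.Outcome => (((ω.1, ω.2.1) : Fin C.size × C.Seed), ω.2.2.1, f ω.2.2.2))
      (C.law ν) (channelLaw C.dataLaw (Measure.pi fun _ => ν) ι) :=
  (measurePreserving_prodAssoc (messageLaw C.size) C.seedLaw
    ((Measure.pi fun _ : Fin n => ν).prod (noiseLaw ι))).symm.comp
    ((MeasurePreserving.id _).prod ((MeasurePreserving.id _).prod
      ((MeasurePreserving.id _).prod hf)))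

lemma measurePreserving_law₁ :
    MeasurePreserving (fun ω : C.Outcome =>
        (((ω.1, ω.2.1) : Fin C.size × C.Seed), ω.2.2.1, fun t => (ω.2.2.2 t).1))
      (C.law ν) (channelLaw C.dataLaw (Measure.pi fun _ => ν) (Fin n)) :=
  C.measurePreserving_law (f := fun e t => (e t).1) (measurePreserving_fst.comp
    (measurePreserving_arrowProdEquivProdArrow ℂ ℂ (Fin n) (fun _ => stdComplexGaussian)
      fun _ => stdComplexGaussian))

lemma measurePreserving_law₂ :
    MeasurePreserving (fun ω : C.Outcome =>
        (((ω.1, ω.2.1) : Fin C.size × C.Seed), ω.2.2.1, fun t => (ω.2.2.2 t).2))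
      (C.law ν) (channelLaw C.dataLaw (Measure.pi fun _ => ν) (Fin n)) :=
  C.measurePreserving_law (f := fun e t => (e t).2) (measurePreserving_snd.comp
    (measurePreserving_arrowProdEquivProdArrow ℂ ℂ (Fin n) (fun _ => stdComplexGaussian)
      fun _ => stdComplexGaussian))

lemma lintegral_codeInput_le (h : C.PowerConstraint ν) (t : Fin n) :
    ∫⁻ p, ENNReal.ofReal (realSqNorm (C.codeInput p.1 p.2 t))
      ∂(C.dataLaw.prod (Measure.pi fun _ => ν)) ≤ 1 := by
  have h1 := measurePreserving_input_state.comp (C.measurePreserving_law₁ (ν := ν))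
  have h2 : Measurable fun p : (Fin C.size × C.Seed) × (Fin n → ChannelState) =>
      ENNReal.ofReal (realSqNorm (C.codeInput p.1 p.2 t)) :=
    (measurable_realSqNorm.comp
      ((measurable_pi_apply t).comp C.measurable_codeInput)).ennreal_ofReal
  rw [← h1.lintegral_comp h2]
  simp_rw [← sqNorm_eq_ofReal]
  exact h t

lemma integrable_codeInput (h : C.PowerConstraint ν) (t : Fin n) :
    Integrable (fun p => realSqNorm (C.codeInput p.1 p.2 t))
      (C.dataLaw.prod (Measure.pi fun _ => ν)) := by
  refine ⟨(measurable_realSqNorm.comp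
    ((measurable_pi_apply t).comp C.measurable_codeInput)).aestronglyMeasurable, ?_⟩
  rw [hasFiniteIntegral_iff_ofReal (ae_of_all _ fun _ => realSqNorm_nonneg _)]
  exact (C.lintegral_codeInput_le h t).trans_lt ENNReal.one_lt_top

lemma integral_codeInput_le (h : C.PowerConstraint ν) (t : Fin n) :
    ∫ p, realSqNorm (C.codeInput p.1 p.2 t) ∂(C.dataLaw.prod (Measure.pi fun _ => ν)) ≤ 1 := by
  rw [integral_eq_lintegral_of_nonneg_ae (ae_of_all _ fun _ => realSqNorm_nonneg _)
    (C.integrable_codeInput h t).1]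
  exact ENNReal.toReal_le_of_le_ofReal zero_le_one (by simpa using C.lintegral_codeInput_le h t)

lemma integrable_codeInput_slice (h : C.PowerConstraint ν) (w : Fin C.size) (t : Fin n) :
    Integrable (fun p : C.Seed × (Fin n → ChannelState) =>
      realSqNorm (C.codeInput (w, p.1) p.2 t)) (C.seedLaw.prod (Measure.pi fun _ => ν)) := by
  have h2 : Measurable fun p : (Fin C.size × C.Seed) × (Fin n → ChannelState) =>
      realSqNorm (C.codeInput p.1 p.2 t) :=
    measurable_realSqNorm.comp ((measurable_pi_apply t).comp C.measurable_codeInput)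
  refine ⟨(h2.comp (by fun_prop : Measurable fun p : C.Seed × (Fin n → ChannelState) =>
    ((w, p.1), p.2))).aestronglyMeasurable, ?_⟩
  rw [hasFiniteIntegral_iff_ofReal (ae_of_all _ fun _ => realSqNorm_nonneg _)]
  have h3 := C.lintegral_codeInput_le h t
  rw [lintegral_message_slice h2.ennreal_ofReal] at h3
  have hM0 : (C.size : ℝ≥0∞) ≠ 0 := by exact_mod_cast C.size_pos.ne'
  rw [ENNReal.inv_mul_le_iff hM0 (ENNReal.natCast_ne_top _), mul_one] at h3
  exact ((Finset.single_le_sum (f := fun w => ∫⁻ p : C.Seed × (Fin n → ChannelState),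
    ENNReal.ofReal (realSqNorm (C.codeInput (w, p.1) p.2 t))
      ∂(C.seedLaw.prod (Measure.pi fun _ => ν))) (fun _ _ => zero_le) (Finset.mem_univ w)).trans
    h3).trans_lt (ENNReal.natCast_lt_top _)

variable (α ρ : ℝ) (T : Fin n → TopologyState)

/-- The link power gains to receiver 1. -/
noncomputable def gain₁ (t : Fin n) : ℝ := ρ ^ (T t).1.exponent α

/-- The link power gains to receiver 2. -/
noncomputable def gain₂ (t : Fin n) : ℝ := ρ ^ (T t).2.exponent α

/-- The decoder as a function of states and outputs. -/
def stateDec (s : Fin n → ChannelState) (y : Fin n → ℂ) : Fin C.size :=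
  C.dec (y, fun t => (s t).1, fun t => (s t).2)

lemma measurable_stateDec :
    Measurable fun p : (Fin n → ChannelState) × (Fin n → ℂ) => C.stateDec p.1 p.2 := by
  refine C.measurable_dec.comp ?_
  fun_prop

lemma toReal_errorProb :
    (C.errorProb α ρ T ν).toReal =
      (channelLaw C.dataLaw (Measure.pi fun _ => ν) (Fin n)).real
        {ω | C.stateDec ω.2.1 (linkMean (gain₁ α ρ T) Prod.fst C.codeInput ω.1 ω.2.1 + ω.2.2)
          ≠ ω.1.1} := by
  have h1 : Measurable fun ω : (Fin C.size × C.Seed) × (Fin n → ChannelState) × (Fin n → ℂ) =>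
      linkMean (gain₁ α ρ T) Prod.fst C.codeInput ω.1 ω.2.1 :=
    measurable_comp₂ (measurable_linkMean measurable_fst C.measurable_codeInput) (by fun_prop)
      (by fun_prop)
  have h2 : Measurable fun ω : (Fin C.size × C.Seed) × (Fin n → ChannelState) × (Fin n → ℂ) =>
      C.stateDec ω.2.1 (linkMean (gain₁ α ρ T) Prod.fst C.codeInput ω.1 ω.2.1 + ω.2.2) :=
    measurable_comp₂ C.measurable_stateDec (by fun_prop) (by fun_prop)
  exact (C.measurePreserving_law₁ (ν := ν)).measureReal_preimage
    (s := {ω | C.stateDec ω.2.1 (linkMean (gain₁ α ρ T) Prod.fst C.codeInput ω.1 ω.2.1 + ω.2.2)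
      ≠ ω.1.1})
    (measurableSet_eq_fun h2 (by fun_prop)).compl.nullMeasurableSet

lemma toReal_leakage (hint₂ : Integrable (fun S : ChannelState => realSqNorm S.2) ν)
    (hp : C.PowerConstraint ν) (hb : ∀ t, 1 ≤ gain₂ α ρ T t) :
    (C.leakage α ρ T ν).toReal =
      (C.size : ℝ)⁻¹ * ∑ w, negEntropy C.seedLaw (Measure.pi fun _ => ν)
          (fixMessage (linkMean (gain₂ α ρ T) Prod.snd C.codeInput) w) -
        negEntropy C.dataLaw (Measure.pi fun _ => ν)
          (linkMean (gain₂ α ρ T) Prod.snd C.codeInput) := by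
  set z := linkMean (gain₂ α ρ T) Prod.snd C.codeInput with hz
  have hzm : Measurable fun p : (Fin C.size × C.Seed) × (Fin n → ChannelState) => z p.1 p.2 :=
    measurable_linkMean measurable_snd C.measurable_codeInput
  let g : (Fin n → ChannelState) → (Fin n → ℂ) → Observation n := fun s o =>
    (o, fun t => (s t).2, fun t => (s t).1)
  have hg : Measurable fun p : (Fin n → ChannelState) × (Fin n → ℂ) => g p.1 p.2 := by
    simp only [g]; fun_prop
  let r : Observation n → Fin n → ChannelState := fun o t =>
    (if h : (t : ℕ) + 1 < n then o.2.2 ⟨t, h⟩ else 0, o.2.1 t)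
  have hr : Measurable r := by
    refine measurable_pi_iff.2 fun t => ?_
    by_cases h : (t : ℕ) + 1 < n
    · simp only [r, h, dif_pos]; fun_prop
    · simp only [r, h, dif_neg, not_false_eq_true]; fun_prop
  have hzr : ∀ θ s o, z θ (r (g s o)) = z θ s := by
    intro θ s o
    funext t
    have h1 : C.codeInput θ (r (g s o)) t = C.codeInput θ s t := by
      refine C.isStrictlyCausal_codeInput θ _ _ t fun i hi => ?_
      have hin : (i : ℕ) + 1 < n := lt_of_le_of_lt (Nat.succ_le_of_lt hi) t.2
      simp [r, g, hin]
    simp only [hz, linkMean, h1]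
    rfl
  have hw := fun w => integrable_log_linkMean (μ := C.seedLaw) (c := gain₂ α ρ T) hb
    (x := fun v => C.codeInput (w, v)) measurable_snd
    (measurable_comp₂ (F := C.codeInput) C.measurable_codeInput (by fun_prop) (by fun_prop))
    (fun v => C.isStrictlyCausal_codeInput (w, v)) hint₂ fun t => C.integrable_codeInput_slice hp w t
  have hf := integrable_log_linkMean (μ := C.dataLaw) (c := gain₂ α ρ T) hb measurable_snd
    C.measurable_codeInput C.isStrictlyCausal_codeInput hint₂ fun t => C.integrable_codeInput hp t
  have hkey := toReal_klDiv_message hzm hw hf hg hr measurable_fst hzr fun s o => rfl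
  rw [← hkey]
  have hmp := C.measurePreserving_law₂ (ν := ν)
  have hzo : Measurable fun ω : (Fin C.size × C.Seed) × (Fin n → ChannelState) × (Fin n → ℂ) =>
      z ω.1 ω.2.1 := measurable_comp₂ hzm (by fun_prop) (by fun_prop)
  have hgo : Measurable fun ω : (Fin C.size × C.Seed) × (Fin n → ChannelState) × (Fin n → ℂ) =>
      g ω.2.1 (z ω.1 ω.2.1 + ω.2.2) := measurable_comp₂ hg (by fun_prop) (by fun_prop)
  unfold leakage
  rw [← hmp.map_eq, Measure.map_map (by fun_prop) hmp.measurable,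
    Measure.map_map (by fun_prop) hmp.measurable, Measure.map_map hgo hmp.measurable]
  rfl

/-- The converse for a single code, in terms of its error probability and leakage. -/
lemma three_mul_log_size_le (hint₁ : Integrable (fun S : ChannelState => realSqNorm S.1) ν)
    (hint₂ : Integrable (fun S : ChannelState => realSqNorm S.2) ν) (hp : C.PowerConstraint ν)
    (ha : ∀ t, 1 ≤ gain₁ α ρ T t) (hb : ∀ t, 1 ≤ gain₂ α ρ T t) {K : ℝ} (hK : 0 ≤ K)
    {E₁ : Set (ChannelState × ChannelState)} (hE₁ : MeasurableSet E₁)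
    {k₁ l₁ : ChannelState × ChannelState → ℂ} (hk₁ : Measurable k₁) (hl₁ : Measurable l₁)
    (hEk₁ : ∀ p ∈ E₁, p.1.1 = k₁ p • p.1.2 + l₁ p • p.2.2)
    (hkK₁ : ∀ p ∈ E₁, ‖k₁ p‖ ^ 2 ≤ K) (hlK₁ : ∀ p ∈ E₁, ‖l₁ p‖ ^ 2 ≤ K)
    {E₂ : Set (ChannelState × ChannelState)} (hE₂ : MeasurableSet E₂)
    {k₂ l₂ : ChannelState × ChannelState → ℂ} (hk₂ : Measurable k₂) (hl₂ : Measurable l₂)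
    (hEk₂ : ∀ p ∈ E₂, p.1.2 = k₂ p • p.1.1 + l₂ p • p.2.1)
    (hkK₂ : ∀ p ∈ E₂, ‖k₂ p‖ ^ 2 ≤ K) (hlK₂ : ∀ p ∈ E₂, ‖l₂ p‖ ^ 2 ≤ K) :
    3 * ((1 - (C.errorProb α ρ T ν).toReal) * Real.log C.size - Real.log 2) ≤
      2 * (C.leakage α ρ T ν).toReal +
      ∑ t, (2 * Real.log (gain₁ α ρ T t) + Real.log (1 + gain₁ α ρ T t / gain₂ α ρ T t * K) +
        Real.log (1 + gain₂ α ρ T t / gain₁ α ρ T t * K) +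
        (ν.prod ν).real E₁ᶜ * Real.log (gain₁ α ρ T t) +
        (ν.prod ν).real E₂ᶜ * Real.log (gain₂ α ρ T t) +
        (4 * Real.log Real.pi + 22 * noisePower + 6 * (∫ S : ChannelState, realSqNorm S.1 ∂ν) +
          2 * ∫ S : ChannelState, realSqNorm S.2 ∂ν)) := by
  rw [C.toReal_errorProb, C.toReal_leakage α ρ T hint₂ hp hb]
  exact three_mul_rate_le ha hb C.measurable_codeInput C.isStrictlyCausal_codeInput hint₁ hint₂
    (C.integrable_codeInput_slice hp) (C.integral_codeInput_le hp) hK hE₁ hk₁ hl₁ hEk₁ hkK₁ hlK₁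
    hE₂ hk₂ hl₂ hEk₂ hkK₂ hlK₂ C.measurable_stateDec

end Code

end MISOWiretap

namespace MISOWiretap

section Gains

lemma Link.exponent_nonneg {α : ℝ} (h : 0 ≤ α) (a : Link) : 0 ≤ a.exponent α := by
  cases a
  · exact zero_le_one
  · exact h

lemma Link.exponent_le_one {α : ℝ} (h : α ≤ 1) (a : Link) : a.exponent α ≤ 1 := by
  cases a
  · exact le_rfl
  · exact h

/-- Three times the contribution of one channel use to the bound on the secure degrees of
freedom. -/
noncomputable def stateWeight (α : ℝ) (s : TopologyState) : ℝ :=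
  2 * s.1.exponent α + |s.1.exponent α - s.2.exponent α|

lemma log_one_add_rpow_mul_le {ρ K : ℝ} (hρ : 1 < ρ) (hK : 0 ≤ K) (x : ℝ) :
    Real.log (1 + ρ ^ x * K) ≤ max x 0 * Real.log ρ + Real.log (1 + K) := by
  have hρ0 : 0 < ρ := by linarith
  rw [← Real.log_rpow hρ0, ← Real.log_mul (Real.rpow_pos_of_pos hρ0 _).ne' (by positivity)]
  have h1 : (1 : ℝ) ≤ ρ ^ max x 0 := Real.one_le_rpow hρ.le (le_max_right _ _)
  have h2 : ρ ^ x ≤ ρ ^ max x 0 := Real.rpow_le_rpow_of_exponent_le hρ.le (le_max_left _ _)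
  refine Real.log_le_log (by positivity) ?_
  nlinarith [mul_le_mul_of_nonneg_right h2 hK]

lemma gain_term_le {α ρ K ε e₁ e₂ : ℝ} (hα0 : 0 ≤ α) (hα1 : α ≤ 1) (hρ : 1 < ρ) (hK : 0 ≤ K)
    (he₁ : e₁ ≤ ε) (he₂ : e₂ ≤ ε) (hε : 0 ≤ ε) (s : TopologyState) :
    2 * Real.log (ρ ^ s.1.exponent α) +
      Real.log (1 + ρ ^ s.1.exponent α / ρ ^ s.2.exponent α * K) +
      Real.log (1 + ρ ^ s.2.exponent α / ρ ^ s.1.exponent α * K) +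
      e₁ * Real.log (ρ ^ s.1.exponent α) + e₂ * Real.log (ρ ^ s.2.exponent α) ≤
    (stateWeight α s + 2 * ε) * Real.log ρ + 2 * Real.log (1 + K) := by
  have hρ0 : 0 < ρ := by linarith
  have hL : 0 < Real.log ρ := Real.log_pos hρ
  rw [← Real.rpow_sub hρ0, ← Real.rpow_sub hρ0, Real.log_rpow hρ0, Real.log_rpow hρ0]
  have h1 := log_one_add_rpow_mul_le hρ hK (s.1.exponent α - s.2.exponent α)
  have h2 := log_one_add_rpow_mul_le hρ hK (s.2.exponent α - s.1.exponent α)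
  have habs : max (s.1.exponent α - s.2.exponent α) 0 + max (s.2.exponent α - s.1.exponent α) 0 =
      |s.1.exponent α - s.2.exponent α| := by
    rcases le_total (s.1.exponent α) (s.2.exponent α) with h | h
    · rw [max_eq_right (by linarith), max_eq_left (by linarith), abs_of_nonpos (by linarith)]
      ring
    · rw [max_eq_left (by linarith), max_eq_right (by linarith), abs_of_nonneg (by linarith)]
      ring
  have h3 : ∀ (e : ℝ) (a : Link), e ≤ ε → e * (a.exponent α * Real.log ρ) ≤ ε * Real.log ρ := by
    intro e a he
    have ha0 := Link.exponent_nonneg hα0 a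
    have ha1 := Link.exponent_le_one hα1 a
    exact mul_le_mul he (by nlinarith) (by positivity) hε
  have h4 := h3 e₁ s.1 he₁
  have h5 := h3 e₂ s.2 he₂
  unfold stateWeight
  rw [← habs]
  linarith

end Gains

/-- The converse for all codes: the error term per channel use is an arbitrarily small multiple of
`log ρ` plus a constant that does not depend on `ρ`. -/
lemma exists_three_mul_log_size_le {ν : Measure ChannelState} (hν : IsFadingLaw ν) {ε : ℝ}
    (hε : 0 < ε) :
    ∃ c : ℝ, ∀ (α ρ : ℝ), 0 ≤ α → α ≤ 1 → 1 < ρ → ∀ (n : ℕ) (T : Fin n → TopologyState)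
      (C : Code n), C.PowerConstraint ν →
      3 * ((1 - (C.errorProb α ρ T ν).toReal) * Real.log C.size - Real.log 2) ≤
        2 * (C.leakage α ρ T ν).toReal + (∑ t, stateWeight α (T t)) * Real.log ρ +
          n * (2 * ε * Real.log ρ + c) := by
  have := hν.isProbabilityMeasure
  have hint : ∀ f : ChannelState → Vec, Measurable f →
      (∀ S, sqNorm (f S) ≤ sqNorm S.1 + sqNorm S.2) → Integrable (fun S => realSqNorm (f S)) ν := by
    intro f hf hle
    refine ⟨(measurable_realSqNorm.comp hf).aestronglyMeasurable, ?_⟩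
    rw [hasFiniteIntegral_iff_ofReal (ae_of_all _ fun _ => realSqNorm_nonneg _)]
    simp_rw [← sqNorm_eq_ofReal]
    exact (lintegral_mono hle).trans_lt hν.power_ne_top.lt_top
  have hint₁ := hint Prod.fst measurable_fst fun S => le_self_add
  have hint₂ := hint Prod.snd measurable_snd fun S => le_add_self
  obtain ⟨k₁, l₁, K₁, hk₁, hl₁, h₁⟩ :=
    exists_bounded_combination measurable_fst measurable_snd hν.fullRank_copy₂ hε
  obtain ⟨k₂, l₂, K₂, hk₂, hl₂, h₂⟩ :=
    exists_bounded_combination measurable_snd measurable_fst hν.fullRank_copy₁ hε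
  set K := max 0 (max K₁ K₂) with hKdef
  have hK : 0 ≤ K := le_max_left _ _
  obtain ⟨E₁, hE₁, hεE₁, hEk₁, hkK₁, hlK₁⟩ := h₁ K ((le_max_left _ _).trans (le_max_right _ _))
  obtain ⟨E₂, hE₂, hεE₂, hEk₂, hkK₂, hlK₂⟩ := h₂ K ((le_max_right _ _).trans (le_max_right _ _))
  set G := 4 * Real.log Real.pi + 22 * noisePower + 6 * (∫ S : ChannelState, realSqNorm S.1 ∂ν) +
    2 * ∫ S : ChannelState, realSqNorm S.2 ∂ν with hG
  refine ⟨2 * Real.log (1 + K) + G, fun α ρ hα0 hα1 hρ n T C hp => ?_⟩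
  have h := C.three_mul_log_size_le α ρ T hint₁ hint₂ hp
    (fun t => Real.one_le_rpow hρ.le (Link.exponent_nonneg hα0 _))
    (fun t => Real.one_le_rpow hρ.le (Link.exponent_nonneg hα0 _)) hK hE₁ hk₁ hl₁ hEk₁ hkK₁ hlK₁
    hE₂ hk₂ hl₂ hEk₂ hkK₂ hlK₂
  refine h.trans ?_
  refine (add_le_add_right ?_ _).trans (add_assoc _ _ _).symm.le
  refine (Finset.sum_le_sum fun t _ => add_le_add
    (gain_term_le hα0 hα1 hρ hK hεE₁ hεE₂ hε.le (T t)) le_rfl).trans (le_of_eq ?_)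
  simp only [Finset.sum_add_distrib, ← Finset.sum_mul, Finset.sum_const, Finset.card_univ,
    Fintype.card_fin, nsmul_eq_mul]
  ring

lemma sum_topology {n : ℕ} (T : Fin n → TopologyState) (f : TopologyState → ℝ) :
    ∑ t, f (T t) =
      (Finset.univ.filter fun t => T t = (.strong, .strong)).card * f (.strong, .strong) +
      (Finset.univ.filter fun t => T t = (.strong, .weak)).card * f (.strong, .weak) +
      (Finset.univ.filter fun t => T t = (.weak, .strong)).card * f (.weak, .strong) +
      (Finset.univ.filter fun t => T t = (.weak, .weak)).card * f (.weak, .weak) := by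
  simp only [← Finset.sum_boole, Finset.sum_mul, ← Finset.sum_add_distrib]
  refine Finset.sum_congr rfl fun t _ => ?_
  rcases h : T t with ⟨a, b⟩
  cases a <;> cases b <;> simp

lemma HasFractions.tendsto_sum {T : (n : ℕ) → Fin n → TopologyState} {lam : Link → Link → ℝ}
    (hT : HasFractions T lam) (f : TopologyState → ℝ) :
    Tendsto (fun n : ℕ => (∑ t, f (T n t)) / n) atTop
      (𝓝 (lam .strong .strong * f (.strong, .strong) + lam .strong .weak * f (.strong, .weak) +
        lam .weak .strong * f (.weak, .strong) + lam .weak .weak * f (.weak, .weak))) := by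
  have h := ((((hT .strong .strong).mul_const (f (.strong, .strong))).add
    ((hT .strong .weak).mul_const (f (.strong, .weak)))).add
    ((hT .weak .strong).mul_const (f (.weak, .strong)))).add
    ((hT .weak .weak).mul_const (f (.weak, .weak)))
  refine h.congr fun n => ?_
  rw [sum_topology]
  ring

lemma tendsto_toReal_of_limsup_eq_zero {u : ℕ → ℝ≥0∞} (h : limsup u atTop = 0) :
    Tendsto (fun n => (u n).toReal) atTop (𝓝 0) := by
  have h1 : Tendsto u atTop (𝓝 0) := tendsto_of_le_liminf_of_limsup_le zero_le h.le
  exact (ENNReal.tendsto_toReal ENNReal.zero_ne_top).comp h1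

/-- Asymptotic rate bound at fixed `ρ`. -/
lemma liminf_rate_le {L B δ c : ℝ} (hL : 0 < L) {size : ℕ → ℕ} {e k W : ℕ → ℝ}
    (he : Tendsto e atTop (𝓝 0)) (hk : Tendsto (fun n => k n / n) atTop (𝓝 0))
    (hW : Tendsto (fun n => W n / n) atTop (𝓝 B))
    (h : ∀ n, 3 * ((1 - e n) * Real.log (size n) - Real.log 2) ≤
      2 * k n + W n * L + n * (δ * L + c)) :
    liminf (fun n : ℕ => ((Real.log (size n) / (n * L) : ℝ) : EReal)) atTop ≤
      (((B + δ + c / L) / 3 : ℝ) : EReal) := by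
  have hlim : Tendsto (fun n : ℕ => (3 * Real.log 2 / L * (n : ℝ)⁻¹ + 2 / L * (k n / n) + W n / n +
      δ + c / L) / (3 * (1 - e n))) atTop (𝓝 ((B + δ + c / L) / 3)) := by
    have h1 := ((((((tendsto_inv_atTop_nhds_zero_nat (𝕜 := ℝ)).const_mul
      (3 * Real.log 2 / L)).add (hk.const_mul (2 / L))).add hW).add_const δ).add_const (c / L)).div
      ((he.const_sub 1).const_mul 3) (by norm_num)
    simp only [mul_zero, zero_add, sub_zero, mul_one] at h1
    exact h1
  have hlim' : Tendsto (fun n : ℕ => (((3 * Real.log 2 / L * (n : ℝ)⁻¹ + 2 / L * (k n / n) +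
      W n / n + δ + c / L) / (3 * (1 - e n)) : ℝ) : EReal)) atTop
      (𝓝 (((B + δ + c / L) / 3 : ℝ) : EReal)) :=
    (continuous_coe_real_ereal.tendsto _).comp hlim
  rw [← hlim'.liminf_eq]
  refine liminf_le_liminf ?_
  filter_upwards [he.eventually (gt_mem_nhds one_pos), eventually_gt_atTop 0] with n hn hn0
  have hn0' : (0 : ℝ) < n := by exact_mod_cast hn0
  rw [EReal.coe_le_coe_iff, le_div_iff₀ (by linarith), div_mul_eq_mul_div, div_le_iff₀ (by positivity)]
  have h2 : (3 * Real.log 2 / L * (n : ℝ)⁻¹ + 2 / L * (k n / n) + W n / n + δ + c / L) * (n * L) =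
      3 * Real.log 2 + (2 * k n + W n * L + n * (δ * L + c)) := by
    field_simp
    ring
  rw [h2]
  linarith [h n]

lemma Achievable.le {α : ℝ} (hα0 : 0 ≤ α) (hα1 : α ≤ 1) {ν : Measure ChannelState}
    (hν : IsFadingLaw ν) {T : (n : ℕ) → Fin n → TopologyState} {B : ℝ}
    (hB : Tendsto (fun n : ℕ => (∑ t, stateWeight α (T n t)) / n) atTop (𝓝 B)) {d : ℝ}
    (hd : Achievable α T ν d) : d ≤ B / 3 := by
  obtain ⟨C, hC, l, hl, hdl⟩ := hd
  have key : ∀ ε : ℝ, 0 < ε → d ≤ (B + 2 * ε) / 3 := by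
    intro ε hε
    obtain ⟨c, hc⟩ := exists_three_mul_log_size_le hν hε
    have hlim : Tendsto (fun ρ : ℝ => (((B + 2 * ε + c / Real.log ρ) / 3 : ℝ) : EReal)) atTop
        (𝓝 (((B + 2 * ε) / 3 : ℝ) : EReal)) := by
      refine (continuous_coe_real_ereal.tendsto _).comp ?_
      have := ((Real.tendsto_log_atTop.const_div_atTop c).const_add (B + 2 * ε)).div_const 3
      simpa using this
    have hle : l ≤ (((B + 2 * ε) / 3 : ℝ) : EReal) := by
      refine le_of_tendsto_of_tendsto hl hlim ?_
      filter_upwards [eventually_gt_atTop 1] with ρ hρ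
      obtain ⟨hp, he, hk⟩ := hC ρ hρ
      refine liminf_rate_le (Real.log_pos hρ) (tendsto_toReal_of_limsup_eq_zero he)
        ?_ hB fun n => hc α ρ hα0 hα1 hρ n (T n) (C ρ n) (hp n)
      simpa [ENNReal.toReal_div] using tendsto_toReal_of_limsup_eq_zero hk
    exact EReal.coe_le_coe_iff.1 (hdl.trans hle)
  refine le_of_forall_pos_le_add fun ε hε => ?_
  have := key (ε * (3 / 2)) (by positivity)
  linarith

end MISOWiretap

theorem theorem1 (α : ℝ) (hα0 : 0 ≤ α) (hα1 : α ≤ 1)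
    (ν : MeasureTheory.Measure MISOWiretap.ChannelState) (hν : MISOWiretap.IsFadingLaw ν)
    (T : (n : ℕ) → Fin n → MISOWiretap.TopologyState)
    (lam : MISOWiretap.Link → MISOWiretap.Link → ℝ) (hT : MISOWiretap.HasFractions T lam) :
    MISOWiretap.gsdof α T ν ≤
      ((((3 - α) * lam .strong .weak + 2 * (lam .strong .strong + α * lam .weak .weak)
        + (1 + α) * lam .weak .strong) / 3 : ℝ) : EReal) := by

  refine iSup₂_le fun d hd => EReal.coe_le_coe_iff.2 ?_
  refine (hd.le hα0 hα1 hν (hT.tendsto_sum (MISOWiretap.stateWeight α))).trans (le_of_eq ?_)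
  simp only [MISOWiretap.stateWeight, MISOWiretap.Link.exponent, sub_self, abs_zero]
  rw [abs_of_nonneg (sub_nonneg.2 hα1), abs_of_nonpos (sub_nonpos.2 hα1)]
  ring
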